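/- Let $\widetilde{\mathrm{SU}}(1,1)=\{(c,w): c\in\mathbb R,\ w\in\mathbb C\}$ be the universal cover of $\mathrm{SU}(1,1)$, with covering homomorphism $$\pi(c,w)=\begin{pmatrix}\sqrt{1+|w|^2}\,e^{ic}& w\\ \bar w&\sqrt{1+|w|^2}\,e^{-ic}\end{pmatrix}$$ and identity $\tilde 1=(0,0)$. Let $\widetilde Y,\widetilde Z$ be the left-invariant vector fields corresponding to $Y=\begin{pmatrix}0&i\\-i&0\end{pmatrix}$ and $Z=\begin{pmatrix}-i&0\\0&i\end{pmatrix}$ in $\mathfrak{su}(1,1)$. Let $\tilde\rho$ be the left-invariant Lorentzian metric given on $\mathfrak{su}(1,1)$ by $\frac18\mathrm{Kil}(A,B)=\frac12\operatorname{trace}(AB)$. Consider the sub-Lorentzian structure $(\operatorname{span}\{\widetilde Y,\widetilde Z\},\tilde\rho)$ with time orientation $\widetilde Z$. A normal geodesic is the projection of an integral curve of the Hamiltonian system on the cotangent bundle with Hamiltonian $-h_{\widetilde Z}^2+h_{\widetilde Y}^2$, where $h_V(q,\xi)=\xi(V(q))$. By a geodesic from $\tilde 1$ to $\tilde g$ we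 mean below a timelike, future-directed normal geodesic $\gamma:[0,1]\to\widetilde{\mathrm{SU}}(1,1)$ with $\gamma(0)=\tilde 1$ and $\gamma(1)=\tilde g$ (horizontal, with $\tilde\rho(\dot\gamma,\dot\gamma)<0$ and $\tilde\rho(\widetilde Z,\dot\gamma)<0$). For $k\in\mathbb N=\{1,2,\dots\}$ let $\omega_k\in(0,1)$ be the unique number with $\frac{\omega_k}{\sqrt{1-\omega_k^2}}-\sin^{-1}\omega_k=\pi k$, and for $0<\omega<1$, $s\ge\omega$ put $$F(s,\omega)=\sqrt{1-\omega^2}\cosh\sqrt{\tfrac{s^2-\omega^2}{1-\omega^2}}-\sqrt{s^2-\omega^2}\,\sinh\sqrt{\tfrac{s^2-\omega^2}{1-\omega^2}}.$$ For $k\ge0$ and a rule $s\mapsto P(s)\subseteq\mathbb R$ let $R_k(P)$ be the set of all points $$c=-\pi k+\operatorname{Arg}\bigl(x_1-i\sqrt{s^2+y_2^2}\bigr),\qquad w=\pm\sqrt{x_1^2+s^2-1}+iy_2,\qquad s>0,\ y_2\in\mathbb R,\ x_1\in P(s).$$ * $\Omega_0=R_0(P)$ with $P(s)=(-\infty,-\sqrt{1-s^2}]\cup[\sqrt{1-s^2},1-\frac{s^2}{2})$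 for $s<1$, and $P(s)=(-\infty,1-\frac{s^2}{2})$ for $s\ge1$. * For $k\ge1$, $\Omega_k=R_k(P)$ with $P(s)=\mathbb R\setminus(-\sqrt{1-s^2},\sqrt{1-s^2})$ for $s<1$, and $P(s)=(-\infty,F(s,\omega_k)]$ for $s\ge1$. * For $k\ge1$, $A_k=R_k(P)$ with $P(s)=\mathbb R\setminus(-\sqrt{1-s^2},\sqrt{1-s^2})$ for $s\le\omega_k$; $P(s)=(-\infty,-\sqrt{1-s^2}]\cup(F(s,\omega_k),\infty)$ for $\omega_k<s<1$; $P(1)=(-\infty,0]\cup\{F(1,\omega_k)\}$; and $P(s)=\{F(s,\omega_k)\}$ for $s>1$. * For $k\ge1$, $B_k=R_k(P)$ with $P(s)=\emptyset$ for $s\le\omega_k$; $P(s)=\{F(s,\omega_k)\}$ for $\omega_k<s<1$; $P(1)=(0,F(1,\omega_k))$; and $P(s)=(-\infty,F(s,\omega_k))$ for $s>1$. * For $k\ge1$, $C_k=R_k(P)$ with $P(s)=[\sqrt{1-s^2},F(s,\omega_k))$ for $\omega_k<s<1$ and $P(s)=\emptyset$ otherwise. * For $k\ge1$, $\Xi_k=\{(-\pi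 k,x_2): x_2\in\mathbb R\}$. Let $\Omega=\Omega_0\cup\bigcup_{k\ge1}(\Omega_k\cup\Xi_k)$, $A=\Omega_0\cup\bigcup_{k\ge1}A_k$, $B=\bigcup_{k\ge1}B_k$, $C=\bigcup_{k\ge1}C_k$, $\Xi=\bigcup_{k\ge1}\Xi_k$. **Proposition.** There is a geodesic from $\tilde 1$ to $\tilde g$ only if $\tilde g\in\Omega$. More precisely: if $\tilde g\in A$, there is exactly one geodesic from $\tilde 1$ to $\tilde g$; if $\tilde g\in B$, there are exactly two; if $\tilde g\in C$, there are exactly three; and if $\tilde g\in\Xi$, there are uncountably many. -/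

import Mathlib

open scoped ComplexConjugate

namespace SubLorentzSU11

/-- The underlying manifold `ℝ × ℂ` of the universal cover of `SU(1,1)`, with points `(c, w)`. -/
abbrev Cover : Type := ℝ × ℂ

/-- The covering map `(c, w) ↦ [[√(1+|w|²) e^{ic}, w], [w̄, √(1+|w|²) e^{-ic}]]` onto `SU(1,1)`. -/
noncomputable def proj (g : Cover) : Matrix (Fin 2) (Fin 2) ℂ :=
  !![(√(1 + ‖g.2‖ ^ 2) : ℂ) * Complex.exp (g.1 * Complex.I), g.2;
     conj g.2, (√(1 + ‖g.2‖ ^ 2) : ℂ) * Complex.exp (-(g.1 * Complex.I))]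

/-- The identity element `(0, 0)`. -/
def one : Cover := (0, 0)

/-- The lifted group law. The argument below is that of a number with positive real part, so it
depends continuously on the factors; `proj_mul` says that `proj` is a homomorphism. (This is not
the componentwise product of `ℝ × ℂ`.) -/
noncomputable def mul (g h : Cover) : Cover :=
  (g.1 + h.1 + Complex.arg ((√(1 + ‖g.2‖ ^ 2) : ℂ) * (√(1 + ‖h.2‖ ^ 2) : ℂ)
      + g.2 * conj h.2 * Complex.exp (-((g.1 + h.1 : ℝ) * Complex.I))),
   h.2 * (√(1 + ‖g.2‖ ^ 2) : ℂ) * Complex.exp (g.1 * Complex.I)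
      + g.2 * (√(1 + ‖h.2‖ ^ 2) : ℂ) * Complex.exp (-(h.1 * Complex.I)))

/-- The inverse `(c, w)⁻¹ = (-c, -w)`. -/
def inv (g : Cover) : Cover := (-g.1, -g.2)

theorem proj_one : proj one = 1 := by
  ext i j
  fin_cases i <;> fin_cases j <;> simp [proj, one]

theorem one_add_norm_sq_mul (g h : Cover) :
    1 + ‖(mul g h).2‖ ^ 2 =
      ‖(√(1 + ‖g.2‖ ^ 2) : ℂ) * (√(1 + ‖h.2‖ ^ 2) : ℂ)
        + g.2 * conj h.2 * Complex.exp (-((g.1 + h.1 : ℝ) * Complex.I))‖ ^ 2 := by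
  have hR (w : ℂ) : ((√(1 + ‖w‖ ^ 2) : ℝ) : ℂ) ^ 2 = 1 + w * conj w := by
    rw [← Complex.ofReal_pow, Real.sq_sqrt (by positivity), Complex.mul_conj']
    push_cast; rfl
  have he (x : ℝ) : Complex.exp (x * Complex.I) * Complex.exp (-(x * Complex.I)) = 1 := by
    rw [← Complex.exp_add]; simp
  have h1 := hR g.2
  have h2 := hR h.2
  have e1 := he g.1
  have e2 := he h.1
  apply Complex.ofReal_injective
  push_cast
  rw [← Complex.mul_conj', ← Complex.mul_conj']
  simp only [mul, map_add, map_mul, Complex.conj_ofReal, Complex.conj_conj, ← Complex.exp_conj,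
    map_neg, Complex.conj_I, mul_neg, neg_neg, Complex.ofReal_add, add_mul, neg_add, Complex.exp_add]
  generalize Complex.exp (g.1 * Complex.I) = a at *
  generalize Complex.exp (-(g.1 * Complex.I)) = a' at *
  generalize Complex.exp (h.1 * Complex.I) = b at *
  generalize Complex.exp (-(h.1 * Complex.I)) = b' at *
  generalize ((√(1 + ‖g.2‖ ^ 2) : ℝ) : ℂ) = R at *
  generalize ((√(1 + ‖h.2‖ ^ 2) : ℝ) : ℂ) = S at *
  generalize conj g.2 = x' at *
  generalize conj h.2 = y' at *
  generalize g.2 = x at *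
  generalize h.2 = y at *
  linear_combination (y*y'*R^2 - x*y'*x'*y*b*b') * e1 + (x*x'*S^2 - x*y'*x'*y) * e2 + (y*y' - S^2) * h1 + (-1) * h2

theorem proj_mul (g h : Cover) : proj (mul g h) = proj g * proj h := by
  have key : ((√(1 + ‖(mul g h).2‖ ^ 2) : ℝ) : ℂ) * Complex.exp ((mul g h).1 * Complex.I) =
      (√(1 + ‖g.2‖ ^ 2) : ℂ) * (√(1 + ‖h.2‖ ^ 2) : ℂ) *
        (Complex.exp (g.1 * Complex.I) * Complex.exp (h.1 * Complex.I)) + g.2 * conj h.2 := by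
    rw [one_add_norm_sq_mul, Real.sqrt_sq (norm_nonneg _)]
    have : Complex.exp ((mul g h).1 * Complex.I) = Complex.exp (g.1 * Complex.I) *
        Complex.exp (h.1 * Complex.I) * Complex.exp ((Complex.arg ((√(1 + ‖g.2‖ ^ 2) : ℂ) *
        (√(1 + ‖h.2‖ ^ 2) : ℂ)
        + g.2 * conj h.2 * Complex.exp (-((g.1 + h.1 : ℝ) * Complex.I))) : ℝ) * Complex.I) := by
      rw [← Complex.exp_add, ← Complex.exp_add]
      simp only [mul]
      push_cast
      ring_nf
    rw [this]
    have hz := Complex.norm_mul_exp_arg_mul_I ((√(1 + ‖g.2‖ ^ 2) : ℂ) * (√(1 + ‖h.2‖ ^ 2) : ℂ)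
        + g.2 * conj h.2 * Complex.exp (-((g.1 + h.1 : ℝ) * Complex.I)))
    have hE : Complex.exp (g.1 * Complex.I) * Complex.exp (h.1 * Complex.I) *
        Complex.exp (-((g.1 + h.1 : ℝ) * Complex.I)) = 1 := by
      rw [← Complex.exp_add, ← Complex.exp_add]
      simp [add_mul]
    rw [mul_left_comm, hz]
    linear_combination g.2 * conj h.2 * hE
  have hc (x : ℝ) : conj (Complex.exp (x * Complex.I)) = Complex.exp (-(x * Complex.I)) := by
    rw [← Complex.exp_conj]; simp
  have key' := congrArg conj key
  simp only [map_mul, map_add, Complex.conj_ofReal, Complex.conj_conj, hc] at key'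
  have hw : (mul g h).2 = h.2 * (√(1 + ‖g.2‖ ^ 2) : ℂ) * Complex.exp (g.1 * Complex.I)
      + g.2 * (√(1 + ‖h.2‖ ^ 2) : ℂ) * Complex.exp (-(h.1 * Complex.I)) := rfl
  have hw' := congrArg conj hw
  simp only [map_mul, map_add, Complex.conj_ofReal, ← hc, Complex.conj_conj] at hw'
  ext i j
  fin_cases i <;> fin_cases j <;> simp [proj, Matrix.mul_apply, Fin.sum_univ_two]
  · rw [key]; ring
  · rw [hw]; ring
  · rw [hw', ← hc]; ring
  · rw [key']; ring

theorem inv_mul' (g : Cover) : mul (inv g) g = one := by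
  have h : 0 ≤ 1 + ‖g.2‖ ^ 2 := by positivity
  have h2 : ((√(1 + ‖g.2‖ ^ 2) : ℝ) : ℂ) * ((√(1 + ‖g.2‖ ^ 2) : ℝ) : ℂ) = 1 + g.2 * conj g.2 := by
    rw [← Complex.ofReal_mul, Real.mul_self_sqrt h, Complex.mul_conj']
    push_cast; rfl
  refine Prod.ext ?_ ?_
  · simp [mul, inv, one, h2]
  · simp [mul, inv, one]

/-- The identification of the tangent space `ℝ × ℂ` at the identity with `𝔰𝔲(1,1)`, by the
differential of the covering map at the identity: `(b₀, b) ↦ [[i b₀, b], [b̄, -i b₀]]`. -/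
noncomputable def toLie (b : Cover) : Matrix (Fin 2) (Fin 2) ℂ :=
  !![b.1 * Complex.I, b.2; conj b.2, -(b.1 * Complex.I)]

/-- The tangent vector at the identity corresponding to `Y = [[0, i], [-i, 0]]`. -/
def vecY : Cover := (0, Complex.I)

/-- The tangent vector at the identity corresponding to `Z = [[-i, 0], [0, i]]`. -/
def vecZ : Cover := (-1, 0)

theorem toLie_vecY : toLie vecY = !![0, Complex.I; -Complex.I, 0] := by
  simp [toLie, vecY]

theorem toLie_vecZ : toLie vecZ = !![-Complex.I, 0; 0, Complex.I] := by
  simp [toLie, vecZ]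

/-- The left-invariant vector field with value `b` at the identity: `g ↦ dL_g b`. -/
noncomputable def leftInvariant (b : Cover) (g : Cover) : Cover :=
  fderiv ℝ (mul g) one b

/-- The left-invariant field `Ỹ`. -/
noncomputable def fieldY : Cover → Cover := leftInvariant vecY

/-- The left-invariant field `Z̃`, the time orientation. -/
noncomputable def fieldZ : Cover → Cover := leftInvariant vecZ

/-- The bilinear form `Kil / 8` on `𝔰𝔲(1,1)`, where `Kil(A, B) = 4 trace(A B)`. -/
noncomputable def lieMetric (A B : Matrix (Fin 2) (Fin 2) ℂ) : ℝ :=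
  (1 / 8) * (4 * (A * B).trace.re)

/-- The left-invariant Lorentzian metric `ρ̃`: tangent vectors at `g` are moved to the identity by
`dL_{g⁻¹}`, where `Kil / 8` is applied. -/
noncomputable def metric (g v v' : Cover) : ℝ :=
  lieMetric (toLie (fderiv ℝ (mul (inv g)) g v)) (toLie (fderiv ℝ (mul (inv g)) g v'))

/-- The cotangent bundle of `ℝ × ℂ`, trivialized by the global coordinates: pairs `(q, ξ)`. -/
abbrev Cotangent : Type := Cover × (Cover →L[ℝ] ℝ)

/-- The function `h_V(q, ξ) = ξ(V(q))` on the cotangent bundle. -/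
noncomputable def momentum (V : Cover → Cover) (l : Cotangent) : ℝ := l.2 (V l.1)

/-- The sub-Lorentzian Hamiltonian `-h_Z̃² + h_Ỹ²`; `(Z̃, Ỹ)` is a global orthonormal frame of the
distribution `span{Ỹ, Z̃}`, and `Z̃` is its time orientation. -/
noncomputable def hamiltonian (l : Cotangent) : ℝ :=
  -(momentum fieldZ l) ^ 2 + (momentum fieldY l) ^ 2

/-- `(v, κ)` is the value at `(q, ξ)` of the Hamiltonian vector field of `H`, that is
`q̇ = ∂H/∂ξ`, `ξ̇ = -∂H/∂q`, written without choosing a basis. -/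
def IsHamiltonianVector (H : Cotangent → ℝ) (l : Cotangent) (v : Cover)
    (κ : Cover →L[ℝ] ℝ) : Prop :=
  (∀ η : Cover →L[ℝ] ℝ, η v = fderiv ℝ (fun ξ => H (l.1, ξ)) l.2 η) ∧
    ∀ u : Cover, κ u = -(fderiv ℝ (fun q => H (q, l.2)) l.1 u)

/-- `γ`, on the interval `[0, 1]`, is a normal geodesic: the projection of an integral curve of
the Hamiltonian system of `-h_Z̃² + h_Ỹ²`. -/
def IsNormalGeodesic (γ : ℝ → Cover) : Prop :=
  ∃ ξ : ℝ → (Cover →L[ℝ] ℝ), ∀ t ∈ Set.Icc (0 : ℝ) 1,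
    ∃ (v : Cover) (κ : Cover →L[ℝ] ℝ),
      HasDerivWithinAt γ v (Set.Icc 0 1) t ∧ HasDerivWithinAt ξ κ (Set.Icc 0 1) t ∧
        IsHamiltonianVector hamiltonian (γ t, ξ t) v κ

/-- A tangent vector `v` at `q` is horizontal, timelike and future directed. -/
def IsTimelikeFuture (q v : Cover) : Prop :=
  v ∈ Submodule.span ℝ {fieldY q, fieldZ q} ∧ metric q v v < 0 ∧ metric q (fieldZ q) v < 0

/-- The set of timelike future-directed normal geodesics `[0, 1] → ℝ × ℂ` from the identity
to `g`. -/
def geodesicsTo (g : Cover) : Set (unitInterval → Cover) :=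
  {σ | ∃ γ : ℝ → Cover, (∀ t : unitInterval, σ t = γ t) ∧ IsNormalGeodesic γ ∧
    (∀ t ∈ Set.Icc (0 : ℝ) 1, IsTimelikeFuture (γ t) (derivWithin γ (Set.Icc 0 1) t)) ∧
    γ 0 = one ∧ γ 1 = g}

theorem existsUnique_omega (k : ℕ) (hk : 1 ≤ k) :
    ∃! ω : ℝ, (0 < ω ∧ ω < 1) ∧ ω / √(1 - ω ^ 2) - Real.arcsin ω = Real.pi * k := by
  have hmono : StrictMonoOn (fun x : ℝ => Real.tan x - x) (Set.Ico 0 (Real.pi / 2)) := by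
    refine strictMonoOn_of_deriv_pos (convex_Ico _ _) ?_ ?_
    · refine ContinuousOn.sub (Real.continuousOn_tan_Ioo.mono ?_) continuousOn_id
      intro x hx
      exact ⟨by linarith [hx.1, Real.pi_pos], hx.2⟩
    · intro x hx
      rw [interior_Ico] at hx
      have hc : 0 < Real.cos x := Real.cos_pos_of_mem_Ioo ⟨by linarith [hx.1, Real.pi_pos], hx.2⟩
      have hs : 0 < Real.sin x := Real.sin_pos_of_pos_of_lt_pi hx.1 (by linarith [hx.2, Real.pi_pos])
      have hd : HasDerivAt (fun x : ℝ => Real.tan x - x) (1 / Real.cos x ^ 2 - 1) x :=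
        (Real.hasDerivAt_tan hc.ne').sub (hasDerivAt_id x)
      rw [hd.deriv, sub_pos, lt_div_iff₀ (by positivity)]
      nlinarith [Real.sin_sq_add_cos_sq x]
  have htrans : ∀ ω : ℝ, 0 < ω → ω < 1 →
      ω / √(1 - ω ^ 2) - Real.arcsin ω = Real.tan (Real.arcsin ω) - Real.arcsin ω := by
    intro ω _ _
    rw [Real.tan_arcsin]
  have hpos : 0 < Real.pi * k := by
    have : (1 : ℝ) ≤ k := by exact_mod_cast hk
    have := Real.pi_pos
    positivity
  obtain ⟨x, hx, hxe⟩ : ∃ x ∈ Set.Ioo 0 (Real.pi / 2), Real.tan x - x = Real.pi * k := by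
    have hx0 := Real.arctan_lt_pi_div_two (Real.pi * k + Real.pi)
    have hx1 : 0 < Real.arctan (Real.pi * k + Real.pi) :=
      Real.arctan_pos.2 (by linarith [Real.pi_pos])
    have hcont : ContinuousOn (fun x : ℝ => Real.tan x - x)
        (Set.Icc 0 (Real.arctan (Real.pi * k + Real.pi))) := by
      refine ContinuousOn.sub (Real.continuousOn_tan_Ioo.mono ?_) continuousOn_id
      intro x hx
      exact ⟨by linarith [hx.1, Real.pi_pos], lt_of_le_of_lt hx.2 hx0⟩
    have := intermediate_value_Ioo hx1.le hcont
    obtain ⟨x, hx, he⟩ := this (show Real.pi * k ∈ _ by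
      refine ⟨by simpa using hpos, ?_⟩
      simp only [Real.tan_arctan]
      linarith [Real.pi_pos])
    exact ⟨x, ⟨hx.1, hx.2.trans hx0⟩, he⟩
  have harc : Real.arcsin (Real.sin x) = x :=
    Real.arcsin_sin (by linarith [hx.1, Real.pi_pos]) hx.2.le
  have hs1 : Real.sin x < 1 := by
    have := Real.sin_lt_sin_of_lt_of_le_pi_div_two (by linarith [hx.1, Real.pi_pos]) le_rfl hx.2
    simpa using this
  have hs0 : 0 < Real.sin x := Real.sin_pos_of_pos_of_lt_pi hx.1 (by linarith [hx.2, Real.pi_pos])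
  refine ⟨Real.sin x, ⟨⟨hs0, hs1⟩, ?_⟩, ?_⟩
  · rw [htrans _ hs0 hs1, harc, hxe]
  · rintro ω ⟨⟨h0, h1⟩, he⟩
    rw [htrans _ h0 h1] at he
    have hinj := hmono.injOn
      (show Real.arcsin ω ∈ _ from ⟨(Real.arcsin_pos.2 h0).le, Real.arcsin_lt_pi_div_two.2 h1⟩)
      (show x ∈ _ from ⟨hx.1.le, hx.2⟩) (he.trans hxe.symm)
    rw [← hinj, Real.sin_arcsin (by linarith) h1.le]

open Classical in
/-- For `k ≥ 1`, the number `ω_k ∈ (0, 1)` with `ω / √(1 - ω²) - arcsin ω = π k`. -/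
noncomputable def omega (k : ℕ) : ℝ :=
  if hk : 1 ≤ k then (existsUnique_omega k hk).choose else 0

theorem omega_spec (k : ℕ) (hk : 1 ≤ k) :
    (0 < omega k ∧ omega k < 1) ∧
      omega k / √(1 - omega k ^ 2) - Real.arcsin (omega k) = Real.pi * k := by
  rw [omega, dif_pos hk]
  exact (existsUnique_omega k hk).choose_spec.1

/-- The function `F(s, ω)`; it is only used for `0 < ω < 1` and `ω ≤ s`. -/
noncomputable def F (s ω : ℝ) : ℝ :=
  √(1 - ω ^ 2) * Real.cosh √((s ^ 2 - ω ^ 2) / (1 - ω ^ 2))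
    - √(s ^ 2 - ω ^ 2) * Real.sinh √((s ^ 2 - ω ^ 2) / (1 - ω ^ 2))

/-- All points `c = -πk + Arg(x₁ - i √(s² + y₂²))`, `w = ±√(x₁² + s² - 1) + i y₂` with `s > 0`,
`y₂ ∈ ℝ` and `x₁ ∈ P s`. -/
def region (k : ℕ) (P : ℝ → Set ℝ) : Set Cover :=
  {g | ∃ s x₁ y₂ : ℝ, 0 < s ∧ x₁ ∈ P s ∧
    g.1 = -(Real.pi * k) + Complex.arg ((x₁ : ℂ) - Complex.I * (√(s ^ 2 + y₂ ^ 2) : ℝ)) ∧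
    (g.2 = (√(x₁ ^ 2 + s ^ 2 - 1) : ℝ) + Complex.I * y₂ ∨
      g.2 = -(√(x₁ ^ 2 + s ^ 2 - 1) : ℝ) + Complex.I * y₂)}

/-- The set `Ω₀`. -/
def Omega0 : Set Cover :=
  region 0 fun s => {x | (s < 1 ∧ (x ≤ -√(1 - s ^ 2) ∨ √(1 - s ^ 2) ≤ x ∧ x < 1 - s ^ 2 / 2)) ∨
    (1 ≤ s ∧ x < 1 - s ^ 2 / 2)}

/-- The sets `Ω_k`, `k ≥ 1`. -/
def OmegaSet (k : ℕ) : Set Cover :=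
  region k fun s => {x | (s < 1 ∧ (x ≤ -√(1 - s ^ 2) ∨ √(1 - s ^ 2) ≤ x)) ∨
    (1 ≤ s ∧ x ≤ F s (omega k))}

/-- The sets `A_k`, `k ≥ 1`. -/
def ASet (k : ℕ) : Set Cover :=
  region k fun s => {x |
    (s ≤ omega k ∧ (x ≤ -√(1 - s ^ 2) ∨ √(1 - s ^ 2) ≤ x)) ∨
    (omega k < s ∧ s < 1 ∧ (x ≤ -√(1 - s ^ 2) ∨ F s (omega k) < x)) ∨
    (s = 1 ∧ (x ≤ 0 ∨ x = F 1 (omega k))) ∨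
    (1 < s ∧ x = F s (omega k))}

/-- The sets `B_k`, `k ≥ 1`. -/
def BSet (k : ℕ) : Set Cover :=
  region k fun s => {x |
    (omega k < s ∧ s < 1 ∧ x = F s (omega k)) ∨
    (s = 1 ∧ 0 < x ∧ x < F 1 (omega k)) ∨
    (1 < s ∧ x < F s (omega k))}

/-- The sets `C_k`, `k ≥ 1`. -/
def CSet (k : ℕ) : Set Cover :=
  region k fun s => {x | omega k < s ∧ s < 1 ∧ √(1 - s ^ 2) ≤ x ∧ x < F s (omega k)}

/-- The lines `Ξ_k = {(-πk, x₂) : x₂ ∈ ℝ}`. -/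
def XiSet (k : ℕ) : Set Cover := {g | g.1 = -(Real.pi * k) ∧ g.2.im = 0}

/-- `Ω = Ω₀ ∪ ⋃_{k ≥ 1} (Ω_k ∪ Ξ_k)`. -/
def Omega : Set Cover := Omega0 ∪ {g | ∃ k : ℕ, 1 ≤ k ∧ g ∈ OmegaSet k ∪ XiSet k}

/-- `A = Ω₀ ∪ ⋃_{k ≥ 1} A_k`. -/
def A : Set Cover := Omega0 ∪ {g | ∃ k : ℕ, 1 ≤ k ∧ g ∈ ASet k}

/-- `B = ⋃_{k ≥ 1} B_k`. -/
def B : Set Cover := {g | ∃ k : ℕ, 1 ≤ k ∧ g ∈ BSet k}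

/-- `C = ⋃_{k ≥ 1} C_k`. -/
def C : Set Cover := {g | ∃ k : ℕ, 1 ≤ k ∧ g ∈ CSet k}

/-- `Ξ = ⋃_{k ≥ 1} Ξ_k`. -/
def Xi : Set Cover := {g | ∃ k : ℕ, 1 ≤ k ∧ g ∈ XiSet k}

end SubLorentzSU11

/-! Along a normal extremal the momentum of X is constant, while those of Z and Y turn
hyperbolically into each other. So a timelike future-directed geodesic has velocity r(cosh(θ+2αt) Z
+ sinh(θ+2αt) Y) with r > 0 (`exists_velocity`, conversely `isNormalGeodesic_of_velocity`). With N =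
αX + r(cosh θ Z + sinh θ Y) and κ = α² − r² one has N² = κ, and the geodesic projects to exp(tN)
exp(−tαX) in SU(1,1). Distinct triples (r, θ, α) give distinct geodesics, so counting geodesics
means counting parameters (`mem_geodesicsTo_iff`, `curve_injective`).

Winding in the cover is governed by ν = √(−κ), read as 0 when κ ≥ 0: the first coordinate of the
endpoint is within π of −ν (`abs_curve_fst_add_lt`). If ν = kπ with k ≥ 1, then exp N = (−1)^k, so θ
drops out of the endpoint and every point of Ξ_k is reached by a whole line of parameters. If ν lies
strictly between kπ and (k+1)π, or κ ≥ 0 and k = 0, the first coordinate lies strictly between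
−(k+1)π and −kπ. There s determines r and y₂ determines θ, which leaves two equations for α and y =
(−1)^k `cosk κ 1` (`encard_geodesicsTo`).

Put Φ(y) = (−1)^k `sink κ 1`. After a change of sign of x₂ if necessary, the equations read x₁+x₂ =
e^{−α}(y+αΦ) and x₁−x₂ = e^{α}(y−αΦ), with product 1−s². Hence |α|Φ = ε with ε² = y²+s²−1. On the
branch α ≥ 0 one counts the y with P(y) = x₁+x₂, on the branch α ≤ 0 those with P(y) = x₁−x₂, where
P is `nullP`.

The logarithmic derivative of P is s²Φ'/(εΦ²) (`hasDerivAt_nullP`), and (1−y²)Φ' = (Φ−y)Φ gives its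
sign. For k = 0 the function P increases to 1, and the level 1 is the boundary x₁ = 1−s²/2. For k ≥
1 it increases until Φ = y, that is y = √(1−ω_k²), then decreases to 0; its maximum is the curve x₁
= F(s, ω_k) (`compare_F`). So for s > ω_k the level x₁+x₂ has two, one or no points as x₁ is below,
at or above F, and for s < 1 the level x₁−x₂ adds one. For s ≤ ω_k the domain of P starts beyond the
maximum and a single solution remains. Points with s ≤ 1 and x₁ ≤ −√(1−s²) are handled by the
monotonicity of `nullQ` and are reached exactly once. -/

namespace SubLorentzSU11

/-! ### Left-invariant fields in coordinates -/

/-- The modulus `√(1 + |w|²)` of the diagonal entries. -/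
noncomputable def radius (w : ℂ) : ℝ := √(1 + ‖w‖ ^ 2)

theorem radius_pos (w : ℂ) : 0 < radius w := Real.sqrt_pos.2 (by positivity)

theorem radius_sq (w : ℂ) : radius w ^ 2 = 1 + ‖w‖ ^ 2 := Real.sq_sqrt (by positivity)

theorem radius_zero : radius 0 = 1 := by simp [radius]

theorem norm_lt_radius (w : ℂ) : ‖w‖ < radius w :=
  lt_of_pow_lt_pow_left₀ 2 (radius_pos w).le (by rw [radius_sq]; linarith)

theorem differentiable_radius : Differentiable ℝ radius := by
  intro w
  unfold radius
  refine DifferentiableAt.sqrt ?_ (by positivity)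
  exact (differentiableAt_const _).add (differentiableAt_id.norm_sq ℝ)

theorem hasDerivAt_radius {f : ℝ → ℂ} {f' : ℂ} {t : ℝ} (hf : HasDerivAt f f' t) :
    HasDerivAt (fun t => radius (f t)) ((f t * conj f').re / radius (f t)) t := by
  have h := ((hf.norm_sq).const_add 1).sqrt (by positivity)
  convert h using 1
  simp only [radius]
  rw [Complex.inner, mul_comm 2, mul_comm (2 : ℝ), mul_div_mul_right _ _ two_ne_zero]
  congr 1
  simp; ring

/-- The number of positive real part whose argument enters the group law. -/
noncomputable def mulAux (g h : Cover) : ℂ :=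
  (radius g.2 : ℂ) * (radius h.2 : ℂ) + g.2 * conj h.2 * Complex.exp (-((g.1 + h.1 : ℝ) * Complex.I))

theorem mul_eq (g h : Cover) : mul g h = (g.1 + h.1 + (mulAux g h).arg,
    h.2 * (radius g.2 : ℂ) * Complex.exp (g.1 * Complex.I)
      + g.2 * (radius h.2 : ℂ) * Complex.exp (-(h.1 * Complex.I))) := rfl

theorem norm_exp_neg_ofReal_mul_I (x : ℝ) : ‖Complex.exp (-((x : ℂ) * Complex.I))‖ = 1 := by
  have := Complex.norm_exp_ofReal_mul_I (-x)
  simpa using this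

/-- The second summand has modulus |g.2||h.2|, which is smaller than the product of the radii, so
the real part is positive. This makes the argument in the group law smooth. -/
theorem mulAux_mem_slitPlane (g h : Cover) : mulAux g h ∈ Complex.slitPlane := by
  refine Or.inl ?_
  have h1 : -(g.2 * conj h.2 * Complex.exp (-((g.1 + h.1 : ℝ) * Complex.I))).re ≤ ‖g.2‖ * ‖h.2‖ := by
    have := (abs_le.1 (Complex.abs_re_le_norm
      (g.2 * conj h.2 * Complex.exp (-((g.1 + h.1 : ℝ) * Complex.I))))).1
    rw [norm_mul, norm_mul, norm_exp_neg_ofReal_mul_I, RCLike.norm_conj, mul_one] at this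
    linarith
  have h2 : ‖g.2‖ * ‖h.2‖ < radius g.2 * radius h.2 :=
    mul_lt_mul'' (norm_lt_radius _) (norm_lt_radius _) (norm_nonneg _) (norm_nonneg _)
  rw [mulAux, Complex.add_re, ← Complex.ofReal_mul, Complex.ofReal_re]
  linarith

theorem differentiable_ofReal_radius_snd : Differentiable ℝ fun g : Cover => (radius g.2 : ℂ) :=
  Complex.ofRealCLM.differentiable.comp (differentiable_radius.comp differentiable_snd)

theorem differentiable_ofReal_fst : Differentiable ℝ fun g : Cover => (g.1 : ℂ) :=
  Complex.ofRealCLM.differentiable.comp differentiable_fst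

theorem differentiable_conj_snd : Differentiable ℝ fun g : Cover => conj g.2 :=
  Complex.conjCLE.differentiable.comp differentiable_snd

theorem differentiable_mulAux (g : Cover) : Differentiable ℝ (mulAux g) := by
  have h1 := differentiable_ofReal_radius_snd
  have h2 := differentiable_ofReal_fst
  have h3 := differentiable_conj_snd
  unfold mulAux
  push_cast
  fun_prop

theorem differentiable_mul (g : Cover) : Differentiable ℝ (mul g) := by
  have h1 := differentiable_ofReal_radius_snd
  have h2 := differentiable_ofReal_fst
  have h4 : Differentiable ℝ fun h => (Complex.log (mulAux g h)).im := by
    intro h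
    have := (((Complex.differentiableAt_log (mulAux_mem_slitPlane g h)).restrictScalars ℝ).comp h
      (differentiable_mulAux g h))
    exact Complex.imCLM.differentiable.differentiableAt.comp h this
  simp only [Complex.log_im] at h4
  have : mul g = fun h => (g.1 + h.1 + (mulAux g h).arg,
    h.2 * (radius g.2 : ℂ) * Complex.exp (g.1 * Complex.I)
      + g.2 * (radius h.2 : ℂ) * Complex.exp (-(h.1 * Complex.I))) := funext (mul_eq g)
  rw [this]
  refine Differentiable.prodMk ?_ ?_ <;> fun_prop

theorem hasDerivAt_affine (h v : Cover) :
    HasDerivAt (fun t : ℝ => h.1 + t * v.1) v.1 0 ∧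
      HasDerivAt (fun t : ℝ => h.2 + (t : ℂ) * v.2) v.2 0 := by
  constructor
  · simpa using ((hasDerivAt_id (0 : ℝ)).mul_const v.1).const_add h.1
  · simpa using ((Complex.ofRealCLM.hasDerivAt (x := (0 : ℝ))).mul_const v.2).const_add h.2

/-- Once differentiability is known, a directional derivative can be computed on a line, where the
one-variable rules for conjugates, moduli and exponentials apply. -/
theorem fderiv_apply_eq_of_hasDerivAt_affine {F : Type*} [NormedAddCommGroup F] [NormedSpace ℝ F]
    {f : Cover → F} {h v : Cover} {f' : F} (hf : DifferentiableAt ℝ f h)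
    (hd : HasDerivAt (fun t : ℝ => f (h.1 + t * v.1, h.2 + (t : ℂ) * v.2)) f' 0) :
    fderiv ℝ f h v = f' := by
  have hl : HasDerivAt (fun t : ℝ => ((h.1 + t * v.1, h.2 + (t : ℂ) * v.2) : Cover)) v 0 :=
    (hasDerivAt_affine h v).1.prodMk (hasDerivAt_affine h v).2
  have hf' : HasFDerivAt f (fderiv ℝ f h) ((h.1 + (0 : ℝ) * v.1, h.2 + ((0 : ℝ) : ℂ) * v.2) : Cover) := by
    simpa using hf.hasFDerivAt
  exact (hf'.comp_hasDerivAt (0 : ℝ) hl).unique hd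

theorem hasDerivAt_ofReal {f : ℝ → ℝ} {f' t : ℝ} (hf : HasDerivAt f f' t) :
    HasDerivAt (fun t => (f t : ℂ)) (f' : ℂ) t :=
  hf.ofReal_comp

theorem hasDerivAt_im {f : ℝ → ℂ} {f' : ℂ} {t : ℝ} (hf : HasDerivAt f f' t) :
    HasDerivAt (fun t => (f t).im) f'.im t := by
  exact Complex.imCLM.hasFDerivAt.comp_hasDerivAt t hf

theorem hasDerivAt_conj {f : ℝ → ℂ} {f' : ℂ} {t : ℝ} (hf : HasDerivAt f f' t) :
    HasDerivAt (fun t => conj (f t)) (conj f') t := by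
  exact Complex.conjCLE.toContinuousLinearMap.hasFDerivAt.comp_hasDerivAt t hf

theorem hasDerivAt_exp_neg {f : ℝ → ℝ} {f' t : ℝ} (hf : HasDerivAt f f' t) :
    HasDerivAt (fun t => Complex.exp (-((f t : ℂ) * Complex.I)))
      (-(f' * Complex.I) * Complex.exp (-((f t : ℂ) * Complex.I))) t :=
  ((hasDerivAt_ofReal hf).mul_const Complex.I).neg.cexp.congr_deriv (mul_comm _ _)

theorem hasDerivAt_exp {f : ℝ → ℝ} {f' t : ℝ} (hf : HasDerivAt f f' t) :
    HasDerivAt (fun t => Complex.exp ((f t : ℂ) * Complex.I))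
      ((f' * Complex.I) * Complex.exp ((f t : ℂ) * Complex.I)) t :=
  ((hasDerivAt_ofReal hf).mul_const Complex.I).cexp.congr_deriv (mul_comm _ _)

theorem fderiv_mul_apply (g h v : Cover) :
    fderiv ℝ (mul g) h v =
      (v.1 + (((radius g.2 : ℂ) * (((h.2 * conj v.2).re / radius h.2 : ℝ) : ℂ)
          + g.2 * conj v.2 * Complex.exp (-((g.1 + h.1 : ℝ) * Complex.I))
          - g.2 * conj h.2 * (v.1 * Complex.I)
            * Complex.exp (-((g.1 + h.1 : ℝ) * Complex.I))) / mulAux g h).im,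
        v.2 * (radius g.2 : ℂ) * Complex.exp (g.1 * Complex.I)
          + g.2 * (((h.2 * conj v.2).re / radius h.2 : ℝ) : ℂ) * Complex.exp (-(h.1 * Complex.I))
          - g.2 * (radius h.2 : ℂ) * (v.1 * Complex.I) * Complex.exp (-(h.1 * Complex.I))) := by
  refine fderiv_apply_eq_of_hasDerivAt_affine (differentiable_mul g h) ?_
  obtain ⟨h1, h2⟩ := hasDerivAt_affine h v
  have hr := hasDerivAt_ofReal (hasDerivAt_radius h2)
  have hc := hasDerivAt_conj h2
  have he := hasDerivAt_exp_neg h1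
  have he' := hasDerivAt_exp_neg (h1.const_add g.1)
  simp only [Complex.ofReal_zero, zero_mul, add_zero] at hr hc he he'
  have hN : HasDerivAt (fun t : ℝ => mulAux g (h.1 + t * v.1, h.2 + (t : ℂ) * v.2))
      ((radius g.2 : ℂ) * (((h.2 * conj v.2).re / radius h.2 : ℝ) : ℂ)
          + g.2 * conj v.2 * Complex.exp (-((g.1 + h.1 : ℝ) * Complex.I))
          - g.2 * conj h.2 * (v.1 * Complex.I)
            * Complex.exp (-((g.1 + h.1 : ℝ) * Complex.I))) 0 := by
    refine ((hr.const_mul (radius g.2 : ℂ)).add ((hc.const_mul g.2).mul he')).congr_deriv ?_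
    simp only [Complex.ofReal_zero, zero_mul, add_zero]
    ring
  -- The argument is differentiated as the imaginary part of the complex logarithm.
  have hL := hasDerivAt_im (hN.clog_real (mulAux_mem_slitPlane g _))
  simp only [Complex.log_im, Complex.ofReal_zero, zero_mul, add_zero] at hL
  simp only [mul_eq]
  refine HasDerivAt.prodMk ((h1.const_add g.1).add hL) ?_
  refine (((h2.mul_const (radius g.2 : ℂ)).mul_const (Complex.exp (g.1 * Complex.I))).add
      ((hr.const_mul g.2).mul he)).congr_deriv ?_
  simp only [Complex.ofReal_zero, zero_mul, add_zero]
  ring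

theorem leftInvariant_eq (b q : Cover) :
    leftInvariant b q =
      (b.1 + (q.2 * conj b.2 * Complex.exp (-(q.1 * Complex.I))).im / radius q.2,
        b.2 * (radius q.2 : ℂ) * Complex.exp (q.1 * Complex.I) - q.2 * (b.1 * Complex.I)) := by
  have hN : mulAux q one = (radius q.2 : ℂ) := by simp [mulAux, one, radius_zero]
  rw [leftInvariant, fderiv_mul_apply, hN, Complex.div_ofReal_im]
  simp [one, radius_zero]

/-- The Maurer–Cartan form in coordinates. -/
theorem fderiv_mul_inv_apply (q v : Cover) :
    fderiv ℝ (mul (inv q)) q v =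
      (radius q.2 ^ 2 * v.1 - (q.2 * conj v.2).im,
        (v.2 + Complex.I * q.2 * (radius q.2 ^ 2 * v.1 - (q.2 * conj v.2).im : ℝ))
          * Complex.exp (-(q.1 * Complex.I)) / radius q.2) := by
  have hR : (radius q.2 : ℂ) ^ 2 = 1 + q.2 * conj q.2 := by
    rw [← Complex.ofReal_pow, radius_sq, Complex.mul_conj']
    push_cast; rfl
  have hR0 : (radius q.2 : ℂ) ≠ 0 := by exact_mod_cast (radius_pos q.2).ne'
  have hinv : radius (inv q).2 = radius q.2 := by simp [radius, inv]
  have hN : mulAux (inv q) q = 1 := by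
    rw [mulAux, hinv]
    simp only [inv, neg_add_cancel, Complex.ofReal_zero, zero_mul, neg_zero, Complex.exp_zero]
    linear_combination hR
  have hre : ((q.2 * conj v.2).re : ℂ) - Complex.I * ((q.2 * conj v.2).im : ℂ) = v.2 * conj q.2 := by
    apply Complex.ext <;> simp <;> ring
  rw [fderiv_mul_apply, hN, hinv]
  simp only [inv, neg_add_cancel, Complex.ofReal_zero, zero_mul, neg_zero, Complex.exp_zero, div_one]
  refine Prod.ext ?_ ?_
  · simp only
    have h1 : ((radius q.2 : ℂ) * (((q.2 * conj v.2).re / radius q.2 : ℝ) : ℂ)) =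
        ((q.2 * conj v.2).re : ℂ) := by
      push_cast; field_simp
    have h2 : -q.2 * conj q.2 = ((-‖q.2‖ ^ 2 : ℝ) : ℂ) := by
      rw [neg_mul, Complex.mul_conj']; push_cast; rfl
    rw [h1, h2, radius_sq]
    simp [-Complex.ofReal_pow]
    ring
  · simp only [Complex.ofReal_neg, neg_mul]
    rw [eq_div_iff hR0]
    push_cast
    field_simp
    linear_combination v.2 * hR - q.2 * hre

end SubLorentzSU11

/-! ### Derivatives of the left-invariant fields and their Lie brackets. -/

namespace SubLorentzSU11

/-- The derivative of a left-invariant field in coordinates. -/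
noncomputable def leftInvariantDeriv (b q u : Cover) : Cover :=
  (((u.2 - q.2 * (u.1 * Complex.I)) * conj b.2 * Complex.exp (-(q.1 * Complex.I))).im / radius q.2
      - (q.2 * conj b.2 * Complex.exp (-(q.1 * Complex.I))).im
        * ((q.2 * conj u.2).re / radius q.2) / radius q.2 ^ 2,
    b.2 * (((q.2 * conj u.2).re / radius q.2 : ℝ) : ℂ) * Complex.exp (q.1 * Complex.I)
      + b.2 * (radius q.2 : ℂ) * (u.1 * Complex.I) * Complex.exp (q.1 * Complex.I)
      - u.2 * (b.1 * Complex.I))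

theorem differentiable_leftInvariant (b : Cover) : Differentiable ℝ (leftInvariant b) := by
  have h1 := differentiable_ofReal_radius_snd
  have h2 := differentiable_ofReal_fst
  have h5 : Differentiable ℝ fun q : Cover => radius q.2 :=
    differentiable_radius.comp differentiable_snd
  have h6 : ∀ q : Cover, radius q.2 ≠ 0 := fun q => (radius_pos _).ne'
  rw [show leftInvariant b = _ from funext (leftInvariant_eq b)]
  refine Differentiable.prodMk ?_ ?_
  · have h7 : Differentiable ℝ fun q : Cover =>
        (q.2 * conj b.2 * Complex.exp (-(q.1 * Complex.I))).im :=
      by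
      have : Differentiable ℝ fun q : Cover =>
        (q.2 * conj b.2 * Complex.exp (-(q.1 * Complex.I))) := by fun_prop
      exact Complex.imCLM.differentiable.comp this
    have h8 : Differentiable ℝ fun q : Cover => (radius q.2)⁻¹ := fun q => (h5 q).inv (h6 q)
    simp only [div_eq_mul_inv]
    fun_prop
  · fun_prop

theorem sub_div_sub_aux {r : ℝ} (hr : r ≠ 0) (a b d : ℝ) :
    a / r - b * d / r ^ 2 = (a * r - b * d) / r ^ 2 := by
  field_simp

theorem hasDerivAt_leftInvariant_of {b : Cover} {f : ℝ → ℝ} {k : ℝ → ℂ} {t f' : ℝ} {k' : ℂ}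
    (hf : HasDerivAt f f' t) (hk : HasDerivAt k k' t) :
    HasDerivAt (fun t => leftInvariant b (f t, k t)) (leftInvariantDeriv b (f t, k t) (f', k')) t := by
  simp only [leftInvariant_eq]
  have hr := hasDerivAt_radius hk
  refine HasDerivAt.prodMk ?_ ?_
  · refine ((((hasDerivAt_im (((hk.mul_const (conj b.2)).mul (hasDerivAt_exp_neg hf)))).div hr
      (radius_pos _).ne').const_add b.1)).congr_deriv ?_
    rw [← sub_div_sub_aux (radius_pos (k t)).ne']
    congr 2
    ring_nf
  · refine (((((hasDerivAt_ofReal hr).const_mul b.2)).mul (hasDerivAt_exp hf)).sub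
      (hk.mul_const (b.1 * Complex.I))).congr_deriv ?_
    simp only
    ring

theorem fderiv_leftInvariant_apply (b q u : Cover) :
    fderiv ℝ (leftInvariant b) q u = leftInvariantDeriv b q u := by
  refine fderiv_apply_eq_of_hasDerivAt_affine (differentiable_leftInvariant b q) ?_
  obtain ⟨h1, h2⟩ := hasDerivAt_affine q u
  have := hasDerivAt_leftInvariant_of (b := b) h1 h2
  simpa using this

/-- The tangent vector at the identity corresponding to `X = [[0, 1], [1, 0]]`. -/
def vecX : Cover := (0, 1)

/-- The left-invariant field of `X`. -/
noncomputable def fieldX : Cover → Cover := leftInvariant vecX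


theorem exp_neg_eq_conj (c : ℝ) :
    Complex.exp (-(c * Complex.I)) = conj (Complex.exp (c * Complex.I)) := by
  rw [← Complex.exp_conj]; simp

theorem re_sq_add_im_sq_exp (c : ℝ) :
    (Complex.exp (c * Complex.I)).re ^ 2 + (Complex.exp (c * Complex.I)).im ^ 2 = 1 := by
  rw [Complex.exp_ofReal_mul_I_re, Complex.exp_ofReal_mul_I_im, Real.cos_sq_add_sin_sq]

/-- The left side is the coordinate expression of a bracket of vector fields, so this is [X, Y] = 2Z
in 𝔰𝔲(1,1). After naming real and imaginary parts it is an identity modulo C² + S² = 1 and R² = 1 +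
x² + y². The next two lemmas treat [Y, Z] = −2X and [X, Z] = 2Y alike. -/
theorem bracket_X_Y (q : Cover) : leftInvariantDeriv vecY q (fieldX q)
    - leftInvariantDeriv vecX q (fieldY q) = (2 : ℝ) • fieldZ q := by
  have hR := radius_sq q.2
  have hR0 := (radius_pos q.2).ne'
  rw [← Complex.normSq_eq_norm_sq, Complex.normSq_apply] at hR
  have he := re_sq_add_im_sq_exp q.1
  simp only [leftInvariantDeriv, fieldX, fieldY, fieldZ, leftInvariant_eq, exp_neg_eq_conj]
  refine Prod.ext ?_ (Complex.ext ?_ ?_)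
  all_goals
    generalize Complex.exp (q.1 * Complex.I) = e at *
    simp [vecX, vecY, vecZ]
    generalize e.re = C at *
    generalize e.im = S at *
    generalize radius q.2 = R at *
    generalize q.2.re = x at *
    generalize q.2.im = y at *
    field_simp
    try grind

theorem bracket_Y_Z (q : Cover) : leftInvariantDeriv vecZ q (fieldY q)
    - leftInvariantDeriv vecY q (fieldZ q) = (-2 : ℝ) • fieldX q := by
  have hR := radius_sq q.2
  have hR0 := (radius_pos q.2).ne'
  rw [← Complex.normSq_eq_norm_sq, Complex.normSq_apply] at hR
  have he := re_sq_add_im_sq_exp q.1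
  simp only [leftInvariantDeriv, fieldX, fieldY, fieldZ, leftInvariant_eq, exp_neg_eq_conj]
  refine Prod.ext ?_ (Complex.ext ?_ ?_)
  all_goals
    generalize Complex.exp (q.1 * Complex.I) = e at *
    simp [vecX, vecY, vecZ]
    generalize e.re = C at *
    generalize e.im = S at *
    generalize radius q.2 = R at *
    generalize q.2.re = x at *
    generalize q.2.im = y at *
    field_simp
    try grind

theorem bracket_X_Z (q : Cover) : leftInvariantDeriv vecZ q (fieldX q)
    - leftInvariantDeriv vecX q (fieldZ q) = (2 : ℝ) • fieldY q := by
  have hR := radius_sq q.2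
  have hR0 := (radius_pos q.2).ne'
  rw [← Complex.normSq_eq_norm_sq, Complex.normSq_apply] at hR
  have he := re_sq_add_im_sq_exp q.1
  simp only [leftInvariantDeriv, fieldX, fieldY, fieldZ, leftInvariant_eq, exp_neg_eq_conj]
  refine Prod.ext ?_ (Complex.ext ?_ ?_)
  all_goals
    generalize Complex.exp (q.1 * Complex.I) = e at *
    simp [vecX, vecY, vecZ]
    generalize e.re = C at *
    generalize e.im = S at *
    generalize radius q.2 = R at *
    generalize q.2.re = x at *
    generalize q.2.im = y at *
    field_simp
    try grind

end SubLorentzSU11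

namespace SubLorentzSU11

/-! ### The Maurer–Cartan form and the metric -/

theorem leftInvariant_add_smul (a a' : ℝ) (b b' q : Cover) :
    leftInvariant (a • b + a' • b') q = a • leftInvariant b q + a' • leftInvariant b' q := by
  simp [leftInvariant]

/-- This is the chain rule for the composition of the translations by q and its inverse, verified on
the coordinate formulas so that associativity of the lifted product is not needed. -/
theorem fderiv_mul_inv_leftInvariant (b q : Cover) :
    fderiv ℝ (mul (inv q)) q (leftInvariant b q) = b := by
  have hR : (radius q.2 : ℂ) ^ 2 = 1 + q.2 * conj q.2 := by
    rw [← Complex.ofReal_pow, radius_sq, Complex.mul_conj']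
    push_cast; rfl
  have hR' := radius_sq q.2
  rw [← Complex.normSq_eq_norm_sq, Complex.normSq_apply] at hR'
  have hR0 := (radius_pos q.2).ne'
  have he := re_sq_add_im_sq_exp q.1
  rw [fderiv_mul_inv_apply]
  simp only [leftInvariant_eq, exp_neg_eq_conj]
  refine Prod.ext ?_ (Complex.ext ?_ ?_)
  all_goals
    generalize Complex.exp (q.1 * Complex.I) = e at *
    simp [-Complex.ofReal_pow]
    generalize e.re = C at *
    generalize e.im = S at *
    generalize radius q.2 = R at *
    generalize q.2.re = x at *
    generalize q.2.im = y at *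
    field_simp
    try grind

/-- A one-sided inverse of an endomorphism of a finite-dimensional space is two-sided. Consequently
the left-invariant frame spans every tangent space. -/
theorem leftInvariant_fderiv_mul_inv (u q : Cover) :
    leftInvariant (fderiv ℝ (mul (inv q)) q u) q = u := by
  have h : (fderiv ℝ (mul (inv q)) q).toLinearMap * (fderiv ℝ (mul q) one).toLinearMap = 1 :=
    LinearMap.ext fun b => fderiv_mul_inv_leftInvariant b q
  exact LinearMap.congr_fun (mul_eq_one_comm.1 h) u

theorem leftInvariant_eq_frame (b q : Cover) :
    leftInvariant b q = b.2.re • fieldX q + b.2.im • fieldY q + (-b.1) • fieldZ q := by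
  have : b = b.2.re • vecX + b.2.im • vecY + (-b.1) • vecZ :=
    Prod.ext (by simp [vecX, vecY, vecZ]) (Complex.ext (by simp [vecX, vecY, vecZ])
      (by simp [vecX, vecY, vecZ]))
  conv_lhs => rw [this]
  simp [leftInvariant, fieldX, fieldY, fieldZ]

theorem exists_eq_frame (u q : Cover) :
    ∃ x y z : ℝ, u = x • fieldX q + y • fieldY q + z • fieldZ q :=
  ⟨_, _, _, (leftInvariant_fderiv_mul_inv u q).symm.trans (leftInvariant_eq_frame _ q)⟩

theorem fderiv_mul_inv_horizontal (a b : ℝ) (q : Cover) :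
    fderiv ℝ (mul (inv q)) q (a • fieldZ q + b • fieldY q) = (-a, b * Complex.I) := by
  rw [fieldZ, fieldY, ← leftInvariant_add_smul, fderiv_mul_inv_leftInvariant]
  simp [vecZ, vecY]

theorem horizontal_injective {a b a' b' : ℝ} {q : Cover}
    (h : a • fieldZ q + b • fieldY q = a' • fieldZ q + b' • fieldY q) : a = a' ∧ b = b' := by
  have := congrArg (fderiv ℝ (mul (inv q)) q) h
  rw [fderiv_mul_inv_horizontal, fderiv_mul_inv_horizontal, Prod.ext_iff] at this
  refine ⟨neg_injective this.1, ?_⟩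
  have h2 := this.2
  simp only [mul_eq_mul_right_iff, Complex.I_ne_zero, or_false] at h2
  exact_mod_cast h2

theorem metric_horizontal (a b a' b' : ℝ) (q : Cover) :
    metric q (a • fieldZ q + b • fieldY q) (a' • fieldZ q + b' • fieldY q) = b * b' - a * a' := by
  rw [metric, fderiv_mul_inv_horizontal, fderiv_mul_inv_horizontal]
  simp [lieMetric, toLie, Matrix.trace, Fin.sum_univ_two]
  ring

theorem isTimelikeFuture_horizontal_iff (a b : ℝ) (q : Cover) :
    IsTimelikeFuture q (a • fieldZ q + b • fieldY q) ↔ 0 < a ∧ b ^ 2 < a ^ 2 := by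
  have h1 : a • fieldZ q + b • fieldY q ∈ Submodule.span ℝ {fieldY q, fieldZ q} :=
    Submodule.mem_span_pair.2 ⟨b, a, add_comm _ _⟩
  have h2 := metric_horizontal 1 0 a b q
  simp only [one_smul, zero_smul, add_zero] at h2
  rw [IsTimelikeFuture, metric_horizontal, h2]
  constructor
  · rintro ⟨-, h, h'⟩
    constructor <;> nlinarith
  · rintro ⟨h, h'⟩
    exact ⟨h1, by nlinarith, by linarith⟩

/-! ### The Hamiltonian system -/

theorem fderiv_hamiltonian_fiber (q : Cover) (ξ η : Cover →L[ℝ] ℝ) :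
    fderiv ℝ (fun ξ => hamiltonian (q, ξ)) ξ η =
      η ((-2 * ξ (fieldZ q)) • fieldZ q + (2 * ξ (fieldY q)) • fieldY q) := by
  have h (u : Cover) : HasFDerivAt (fun ξ : Cover →L[ℝ] ℝ => ξ u)
      (ContinuousLinearMap.apply ℝ ℝ u) ξ := (ContinuousLinearMap.apply ℝ ℝ u).hasFDerivAt
  have := ((h (fieldZ q)).pow 2).neg.add ((h (fieldY q)).pow 2)
  rw [HasFDerivAt.fderiv (f := fun ξ => hamiltonian (q, ξ)) this]
  simp

theorem fderiv_hamiltonian_base (q : Cover) (ξ : Cover →L[ℝ] ℝ) (u : Cover) :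
    fderiv ℝ (fun q => hamiltonian (q, ξ)) q u =
      -2 * ξ (fieldZ q) * ξ (leftInvariantDeriv vecZ q u)
        + 2 * ξ (fieldY q) * ξ (leftInvariantDeriv vecY q u) := by
  have h (b : Cover) : HasFDerivAt (fun q => ξ (leftInvariant b q))
      (ξ.comp (fderiv ℝ (leftInvariant b) q)) q :=
    ξ.hasFDerivAt.comp q (differentiable_leftInvariant b q).hasFDerivAt
  have := ((h vecZ).pow 2).neg.add ((h vecY).pow 2)
  rw [HasFDerivAt.fderiv (f := fun q => hamiltonian (q, ξ)) this]
  simp [fderiv_leftInvariant_apply, fieldZ, fieldY]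

theorem eq_of_forall_dual {v v' : Cover} (h : ∀ η : Cover →L[ℝ] ℝ, η v = η v') : v = v' := by
  refine Prod.ext ?_ (Complex.ext ?_ ?_)
  · exact h (ContinuousLinearMap.fst ℝ ℝ ℂ)
  · exact h (Complex.reCLM.comp (ContinuousLinearMap.snd ℝ ℝ ℂ))
  · exact h (Complex.imCLM.comp (ContinuousLinearMap.snd ℝ ℝ ℂ))

theorem isHamiltonianVector_iff (q : Cover) (ξ : Cover →L[ℝ] ℝ) (v : Cover) (κ : Cover →L[ℝ] ℝ) :
    IsHamiltonianVector hamiltonian (q, ξ) v κ ↔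
      v = (-2 * ξ (fieldZ q)) • fieldZ q + (2 * ξ (fieldY q)) • fieldY q ∧
        ∀ u, κ u = 2 * ξ (fieldZ q) * ξ (leftInvariantDeriv vecZ q u)
          - 2 * ξ (fieldY q) * ξ (leftInvariantDeriv vecY q u) := by
  simp only [IsHamiltonianVector, fderiv_hamiltonian_fiber, fderiv_hamiltonian_base]
  refine and_congr ⟨eq_of_forall_dual, fun h η => by rw [h]⟩ (forall_congr' fun u => ?_)
  rw [show -(-2 * ξ (fieldZ q) * ξ (leftInvariantDeriv vecZ q u)
        + 2 * ξ (fieldY q) * ξ (leftInvariantDeriv vecY q u)) =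
      2 * ξ (fieldZ q) * ξ (leftInvariantDeriv vecZ q u)
          - 2 * ξ (fieldY q) * ξ (leftInvariantDeriv vecY q u) by ring]

theorem leftInvariantDeriv_add_smul (b q u u' : Cover) (a a' : ℝ) :
    leftInvariantDeriv b q (a • u + a' • u') =
      a • leftInvariantDeriv b q u + a' • leftInvariantDeriv b q u' := by
  simp [← fderiv_leftInvariant_apply]

/-- The right-hand sides of the equations for the momenta of the frame. -/
theorem momentum_equations {q v : Cover} {ξ κ : Cover →L[ℝ] ℝ}
    (h : IsHamiltonianVector hamiltonian (q, ξ) v κ) :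
    κ (fieldX q) + ξ (leftInvariantDeriv vecX q v) = 0 ∧
      κ (fieldY q) + ξ (leftInvariantDeriv vecY q v) = -4 * ξ (fieldZ q) * ξ (fieldX q) ∧
      κ (fieldZ q) + ξ (leftInvariantDeriv vecZ q v) = -4 * ξ (fieldY q) * ξ (fieldX q) := by
  obtain ⟨rfl, hκ⟩ := (isHamiltonianVector_iff q ξ v κ).1 h
  have h1 := congrArg ξ (bracket_X_Y q)
  have h2 := congrArg ξ (bracket_Y_Z q)
  have h3 := congrArg ξ (bracket_X_Z q)
  simp only [map_sub, map_smul, smul_eq_mul] at h1 h2 h3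
  simp only [hκ, leftInvariantDeriv_add_smul, map_add, map_smul, smul_eq_mul]
  refine ⟨?_, ?_, ?_⟩
  -- The brackets [X, Z] = 2Y and [X, Y] = 2Z contribute opposite multiples of the product of the
  -- momenta of Y and Z: the flow of X preserves the Hamiltonian, so its momentum is conserved.
  · linear_combination 2 * ξ (fieldZ q) * h3 - 2 * ξ (fieldY q) * h1
  · linear_combination 2 * ξ (fieldZ q) * h2
  · linear_combination 2 * ξ (fieldY q) * h2

theorem HasDerivWithinAt.momentum {γ : ℝ → Cover} {ξ : ℝ → Cover →L[ℝ] ℝ} {v : Cover}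
    {κ : Cover →L[ℝ] ℝ} {s : Set ℝ} {t : ℝ} (b : Cover) (hγ : HasDerivWithinAt γ v s t)
    (hξ : HasDerivWithinAt ξ κ s t) :
    HasDerivWithinAt (fun t => ξ t (leftInvariant b (γ t)))
      (κ (leftInvariant b (γ t)) + ξ t (leftInvariantDeriv b (γ t) v)) s t := by
  have h := (differentiable_leftInvariant b (γ t)).hasFDerivAt.comp_hasDerivWithinAt t hγ
  have := hξ.clm_apply h
  rwa [fderiv_leftInvariant_apply] at this

/-- A covector is a fixed linear combination of its values on three basis vectors, so
differentiability of the evaluations is enough. -/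
theorem hasDerivWithinAt_clm {ξ : ℝ → Cover →L[ℝ] ℝ} {s : Set ℝ} {t : ℝ}
    (h : ∀ u, DifferentiableWithinAt ℝ (fun t => ξ t u) s t) :
    ∃ κ : Cover →L[ℝ] ℝ, HasDerivWithinAt ξ κ s t := by
  have key (η : Cover →L[ℝ] ℝ) : η = η (1, 0) • ContinuousLinearMap.fst ℝ ℝ ℂ
      + η (0, 1) • Complex.reCLM.comp (ContinuousLinearMap.snd ℝ ℝ ℂ)
      + η (0, Complex.I) • Complex.imCLM.comp (ContinuousLinearMap.snd ℝ ℝ ℂ) := by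
    ext u
    · simp
    · have : ((0, u) : Cover) = u.re • (0, 1) + u.im • (0, Complex.I) := by
        ext <;> simp
      simp [this, -Prod.smul_mk, -Prod.mk_add_mk, mul_comm]
  rw [show ξ = fun t => _ from funext fun t => key (ξ t)]
  refine ⟨_, (DifferentiableWithinAt.hasDerivWithinAt ?_)⟩
  exact (((h _).smul_const _).add ((h _).smul_const _)).add ((h _).smul_const _)

theorem differentiable_fderiv_mul_inv (u : Cover) :
    Differentiable ℝ fun q : Cover => fderiv ℝ (mul (inv q)) q u := by
  have h1 := differentiable_ofReal_radius_snd
  have h2 := differentiable_ofReal_fst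
  have h5 : Differentiable ℝ fun q : Cover => radius q.2 :=
    differentiable_radius.comp differentiable_snd
  have h6 : Differentiable ℝ fun q : Cover => (radius q.2 : ℂ)⁻¹ := fun q =>
    (h1 q).inv (by exact_mod_cast (radius_pos q.2).ne')
  have h7 : Differentiable ℝ fun q : Cover => (q.2 * conj u.2).im := by
    have : Differentiable ℝ fun q : Cover => q.2 * conj u.2 := by fun_prop
    exact Complex.imCLM.differentiable.comp this
  have h8 : Differentiable ℝ fun q : Cover =>
      ((radius q.2 ^ 2 * u.1 - (q.2 * conj u.2).im : ℝ) : ℂ) :=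
    Complex.ofRealCLM.differentiable.comp (((h5.pow 2).mul_const _).sub h7)
  simp only [fderiv_mul_inv_apply, div_eq_mul_inv]
  fun_prop

end SubLorentzSU11

namespace SubLorentzSU11

/-! ### The vertical part of the system -/

theorem eq_of_hasDerivWithinAt_zero {E : Type*} [NormedAddCommGroup E] [NormedSpace ℝ E]
    {f : ℝ → E} (h : ∀ t ∈ Set.Icc (0 : ℝ) 1, HasDerivWithinAt f 0 (Set.Icc 0 1) t) :
    ∀ t ∈ Set.Icc (0 : ℝ) 1, f t = f 0 :=
  constant_of_derivWithin_zero (fun t ht => (h t ht).differentiableWithinAt) fun t ht =>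
    (h t (Set.Ico_subset_Icc_self ht)).derivWithin
      (uniqueDiffOn_Icc_zero_one t (Set.Ico_subset_Icc_self ht))

theorem hasDerivAt_cosh_affine (a b t : ℝ) :
    HasDerivAt (fun t => Real.cosh (a + b * t)) (b * Real.sinh (a + b * t)) t :=
  (((hasDerivAt_id t).const_mul b).const_add a).cosh.congr_deriv (by simp [mul_comm])

theorem hasDerivAt_sinh_affine (a b t : ℝ) :
    HasDerivAt (fun t => Real.sinh (a + b * t)) (b * Real.cosh (a + b * t)) t :=
  (((hasDerivAt_id t).const_mul b).const_add a).sinh.congr_deriv (by simp [mul_comm])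

/-- Solutions of `x' = b y`, `y' = b x` are hyperbolic rotations. -/
theorem hyperbolic_rotation {x y : ℝ → ℝ} {b : ℝ}
    (hx : ∀ t ∈ Set.Icc (0 : ℝ) 1, HasDerivWithinAt x (b * y t) (Set.Icc 0 1) t)
    (hy : ∀ t ∈ Set.Icc (0 : ℝ) 1, HasDerivWithinAt y (b * x t) (Set.Icc 0 1) t)
    (h0 : 0 < x 0) (h1 : y 0 ^ 2 < x 0 ^ 2) :
    ∃ r θ : ℝ, 0 < r ∧ ∀ t ∈ Set.Icc (0 : ℝ) 1,
      x t = r * Real.cosh (θ + b * t) ∧ y t = r * Real.sinh (θ + b * t) := by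
  have hr : 0 < √(x 0 ^ 2 - y 0 ^ 2) := Real.sqrt_pos.2 (by linarith)
  have hr2 := Real.sq_sqrt (show 0 ≤ x 0 ^ 2 - y 0 ^ 2 by linarith)
  set r := √(x 0 ^ 2 - y 0 ^ 2)
  have hs : r * Real.sinh (Real.arsinh (y 0 / r)) = y 0 := by
    rw [Real.sinh_arsinh]; field_simp
  have hc : r * Real.cosh (Real.arsinh (y 0 / r)) = x 0 := by
    refine (pow_left_inj₀ (by positivity) h0.le two_ne_zero).1 ?_
    rw [mul_pow, Real.cosh_sq, mul_add, ← mul_pow, hs, hr2]; ring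
  refine ⟨r, Real.arsinh (y 0 / r), hr, fun t ht => ?_⟩
  have hcosh (t : ℝ) : HasDerivWithinAt (fun t => Real.cosh (b * t)) (b * Real.sinh (b * t))
      (Set.Icc 0 1) t := by simpa using (hasDerivAt_cosh_affine 0 b t).hasDerivWithinAt
  have hsinh (t : ℝ) : HasDerivWithinAt (fun t => Real.sinh (b * t)) (b * Real.cosh (b * t))
      (Set.Icc 0 1) t := by simpa using (hasDerivAt_sinh_affine 0 b t).hasDerivWithinAt
  -- Turning (x, y) back by the hyperbolic angle b t yields two constants of motion, which solves
  -- the system without an existence and uniqueness theorem.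
  have e1 := eq_of_hasDerivWithinAt_zero (f := fun t => x t * Real.cosh (b * t) - y t * Real.sinh (b * t))
    (fun t ht => (((hx t ht).mul (hcosh t)).sub ((hy t ht).mul (hsinh t))).congr_deriv (by ring)) t ht
  have e2 := eq_of_hasDerivWithinAt_zero (f := fun t => y t * Real.cosh (b * t) - x t * Real.sinh (b * t))
    (fun t ht => (((hy t ht).mul (hcosh t)).sub ((hx t ht).mul (hsinh t))).congr_deriv (by ring)) t ht
  simp only [mul_zero, Real.cosh_zero, Real.sinh_zero, mul_one, sub_zero] at e1 e2
  have e3 := Real.cosh_sq (b * t)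
  rw [Real.cosh_add, Real.sinh_add]
  constructor
  · linear_combination (-x t) * e3 + Real.cosh (b * t) * e1 + Real.sinh (b * t) * e2
      - Real.cosh (b * t) * hc - Real.sinh (b * t) * hs
  · linear_combination (-y t) * e3 + Real.cosh (b * t) * e2 + Real.sinh (b * t) * e1
      - Real.cosh (b * t) * hs - Real.sinh (b * t) * hc

/-- The velocity at time `t` of the geodesics with parameters `r`, `θ`, `α`. -/
noncomputable def velocity (r θ α t : ℝ) (q : Cover) : Cover :=
  (r * Real.cosh (θ + 2 * α * t)) • fieldZ q + (r * Real.sinh (θ + 2 * α * t)) • fieldY q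

/-- Since the momentum of X is conserved, the equations for the momenta of Z and Y become linear
with constant coefficients; α is twice the momentum of X. The causal condition is needed only at t =
0, where it places the initial momenta on the future branch of a hyperbola. -/
theorem exists_velocity {γ : ℝ → Cover} (h : IsNormalGeodesic γ)
    (ht : IsTimelikeFuture (γ 0) (derivWithin γ (Set.Icc 0 1) 0)) :
    ∃ r θ α : ℝ, 0 < r ∧ ∀ t ∈ Set.Icc (0 : ℝ) 1,
      HasDerivWithinAt γ (velocity r θ α t (γ t)) (Set.Icc 0 1) t := by
  obtain ⟨ξ, h⟩ := h
  choose! v κ hγ hξ hH using h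
  have hX : ∀ t ∈ Set.Icc (0 : ℝ) 1, ξ t (fieldX (γ t)) = ξ 0 (fieldX (γ 0)) :=
    eq_of_hasDerivWithinAt_zero (f := fun t => ξ t (fieldX (γ t))) fun t ht =>
      (HasDerivWithinAt.momentum vecX (hγ t ht) (hξ t ht)).congr_deriv
        (momentum_equations (hH t ht)).1
  have hv : ∀ t ∈ Set.Icc (0 : ℝ) 1, v t = (-2 * ξ t (fieldZ (γ t))) • fieldZ (γ t)
      + (2 * ξ t (fieldY (γ t))) • fieldY (γ t) := fun t ht =>
    ((isHamiltonianVector_iff _ _ _ _).1 (hH t ht)).1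
  have h0 : (0 : ℝ) ∈ Set.Icc (0 : ℝ) 1 := ⟨le_rfl, zero_le_one⟩
  rw [(hγ 0 h0).derivWithin (uniqueDiffOn_Icc_zero_one 0 h0), hv 0 h0,
    isTimelikeFuture_horizontal_iff] at ht
  obtain ⟨r, θ, hr, hrθ⟩ := hyperbolic_rotation (x := fun t => -2 * ξ t (fieldZ (γ t)))
    (y := fun t => 2 * ξ t (fieldY (γ t))) (b := 2 * (2 * ξ 0 (fieldX (γ 0))))
    (fun t ht => ((HasDerivWithinAt.momentum vecZ (hγ t ht) (hξ t ht)).const_mul (-2)).congr_deriv (by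
      have := (momentum_equations (hH t ht)).2.2
      rw [hX t ht] at this
      rw [show leftInvariant vecZ = fieldZ from rfl, this]; ring))
    (fun t ht => ((HasDerivWithinAt.momentum vecY (hγ t ht) (hξ t ht)).const_mul 2).congr_deriv (by
      have := (momentum_equations (hH t ht)).2.1
      rw [hX t ht] at this
      rw [show leftInvariant vecY = fieldY from rfl, this]; ring)) ht.1 ht.2
  refine ⟨r, θ, 2 * ξ 0 (fieldX (γ 0)), hr, fun t ht => (hγ t ht).congr_deriv ?_⟩
  rw [hv t ht, velocity, ← (hrθ t ht).1, ← (hrθ t ht).2]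

/-- The covector is prescribed through its frame momenta, α/2 on X, (r/2) sinh on Y and −(r/2) cosh
on Z, and moved to the point of the curve by the Maurer–Cartan form. -/
theorem isNormalGeodesic_of_velocity {γ : ℝ → Cover} {r θ α : ℝ}
    (hγ : ∀ t ∈ Set.Icc (0 : ℝ) 1,
      HasDerivWithinAt γ (velocity r θ α t (γ t)) (Set.Icc 0 1) t) :
    IsNormalGeodesic γ := by
  set ξ : ℝ → Cover →L[ℝ] ℝ := fun t =>
    ((r / 2 * Real.cosh (θ + 2 * α * t)) • ContinuousLinearMap.fst ℝ ℝ ℂ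
      + (α / 2) • Complex.reCLM.comp (ContinuousLinearMap.snd ℝ ℝ ℂ)
      + (r / 2 * Real.sinh (θ + 2 * α * t)) •
        Complex.imCLM.comp (ContinuousLinearMap.snd ℝ ℝ ℂ)).comp
      (fderiv ℝ (mul (inv (γ t))) (γ t)) with hξ
  have hE (b : Cover) (t : ℝ) : ξ t (leftInvariant b (γ t)) =
      r / 2 * Real.cosh (θ + 2 * α * t) * b.1 + α / 2 * b.2.re
        + r / 2 * Real.sinh (θ + 2 * α * t) * b.2.im := by
    simp [hξ, fderiv_mul_inv_leftInvariant]
  have hX (t : ℝ) : ξ t (fieldX (γ t)) = α / 2 := by simp [fieldX, hE, vecX]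
  have hY (t : ℝ) : ξ t (fieldY (γ t)) = r / 2 * Real.sinh (θ + 2 * α * t) := by
    simp [fieldY, hE, vecY]
  have hZ (t : ℝ) : ξ t (fieldZ (γ t)) = -(r / 2 * Real.cosh (θ + 2 * α * t)) := by
    simp [fieldZ, hE, vecZ]
  refine ⟨ξ, fun t ht => ?_⟩
  have hd : ∀ u, DifferentiableWithinAt ℝ (fun t => ξ t u) (Set.Icc 0 1) t := by
    intro u
    have h1 : DifferentiableWithinAt ℝ (fun t => fderiv ℝ (mul (inv (γ t))) (γ t) u)
        (Set.Icc 0 1) t :=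
      (differentiable_fderiv_mul_inv u (γ t)).comp_differentiableWithinAt t
        (hγ t ht).differentiableWithinAt
    have h2 := Complex.reCLM.differentiableAt.comp_differentiableWithinAt t h1.snd
    have h3 := Complex.imCLM.differentiableAt.comp_differentiableWithinAt t h1.snd
    have h4 := (hasDerivAt_cosh_affine θ (2 * α) t).differentiableAt.differentiableWithinAt
      (s := Set.Icc 0 1)
    have h5 := (hasDerivAt_sinh_affine θ (2 * α) t).differentiableAt.differentiableWithinAt
      (s := Set.Icc 0 1)
    exact (((h4.const_mul _).mul h1.fst).add (h2.const_mul _)).add ((h5.const_mul _).mul h3)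
  obtain ⟨κ, hκ⟩ := hasDerivWithinAt_clm hd
  obtain ⟨κ', hκ'⟩ : ∃ κ' : Cover →L[ℝ] ℝ, ∀ u,
      κ' u = 2 * ξ t (fieldZ (γ t)) * ξ t (leftInvariantDeriv vecZ (γ t) u)
        - 2 * ξ t (fieldY (γ t)) * ξ t (leftInvariantDeriv vecY (γ t) u) :=
    ⟨(2 * ξ t (fieldZ (γ t))) • (ξ t).comp (fderiv ℝ (leftInvariant vecZ) (γ t))
      - (2 * ξ t (fieldY (γ t))) • (ξ t).comp (fderiv ℝ (leftInvariant vecY) (γ t)),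
      fun u => by simp [fderiv_leftInvariant_apply]⟩
  have hv : velocity r θ α t (γ t) = (-2 * ξ t (fieldZ (γ t))) • fieldZ (γ t)
      + (2 * ξ t (fieldY (γ t))) • fieldY (γ t) := by
    rw [hZ, hY, velocity]
    congr 2 <;> ring
  have hH : IsHamiltonianVector hamiltonian (γ t, ξ t) (velocity r θ α t (γ t)) κ' :=
    (isHamiltonianVector_iff _ _ _ _).2 ⟨hv, hκ'⟩
  obtain ⟨m1, m2, m3⟩ := momentum_equations hH
  have hu := uniqueDiffOn_Icc_zero_one t ht
  -- The actual derivative κ of the covector and the Hamiltonian value κ' are compared on the frame: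
  -- on each field, both give the same derivative of the corresponding momentum.
  have eX : κ (fieldX (γ t)) = κ' (fieldX (γ t)) := by
    have h1 := HasDerivWithinAt.momentum vecX (hγ t ht) hκ
    have h2 : HasDerivWithinAt (fun t => ξ t (leftInvariant vecX (γ t))) 0 (Set.Icc 0 1) t := by
      rw [show (fun t => ξ t (leftInvariant vecX (γ t))) = fun _ => α / 2 from funext hX]
      exact hasDerivWithinAt_const _ _ _
    have := hu.eq_deriv _ h1 h2
    rw [show leftInvariant vecX = fieldX from rfl] at this
    linarith
  have eY : κ (fieldY (γ t)) = κ' (fieldY (γ t)) := by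
    have h1 := HasDerivWithinAt.momentum vecY (hγ t ht) hκ
    have h2 : HasDerivWithinAt (fun t => ξ t (leftInvariant vecY (γ t)))
        (r / 2 * (2 * α * Real.cosh (θ + 2 * α * t))) (Set.Icc 0 1) t := by
      rw [show (fun t => ξ t (leftInvariant vecY (γ t))) = _ from funext hY]
      exact (hasDerivAt_sinh_affine θ (2 * α) t).hasDerivWithinAt.const_mul _
    have := hu.eq_deriv _ h1 h2
    rw [show leftInvariant vecY = fieldY from rfl] at this
    rw [hZ, hX] at m2
    linarith
  have eZ : κ (fieldZ (γ t)) = κ' (fieldZ (γ t)) := by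
    have h1 := HasDerivWithinAt.momentum vecZ (hγ t ht) hκ
    have h2 : HasDerivWithinAt (fun t => ξ t (leftInvariant vecZ (γ t)))
        (-(r / 2 * (2 * α * Real.sinh (θ + 2 * α * t)))) (Set.Icc 0 1) t := by
      rw [show (fun t => ξ t (leftInvariant vecZ (γ t))) = _ from funext hZ]
      exact ((hasDerivAt_cosh_affine θ (2 * α) t).hasDerivWithinAt.const_mul _).neg
    have := hu.eq_deriv _ h1 h2
    rw [show leftInvariant vecZ = fieldZ from rfl] at this
    rw [hY, hX] at m3
    linarith
  have hκκ' : κ = κ' := by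
    refine ContinuousLinearMap.ext fun u => ?_
    obtain ⟨x, y, z, rfl⟩ := exists_eq_frame u (γ t)
    simp only [map_add, map_smul, eX, eY, eZ]
  exact ⟨_, κ, hγ t ht, hκ, hκκ' ▸ hH⟩

/-- The causal condition at all times comes for free from cosh > 0 and cosh² − sinh² = 1. -/
theorem geodesicsTo_iff_velocity {g : Cover} {σ : unitInterval → Cover} :
    σ ∈ geodesicsTo g ↔ ∃ (γ : ℝ → Cover) (r θ α : ℝ), 0 < r ∧ (∀ t : unitInterval, σ t = γ t) ∧
      γ 0 = one ∧ γ 1 = g ∧ ∀ t ∈ Set.Icc (0 : ℝ) 1,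
        HasDerivWithinAt γ (velocity r θ α t (γ t)) (Set.Icc 0 1) t := by
  constructor
  · rintro ⟨γ, hσ, hn, ht, h0, h1⟩
    obtain ⟨r, θ, α, hr, hv⟩ := exists_velocity hn (ht 0 ⟨le_rfl, zero_le_one⟩)
    exact ⟨γ, r, θ, α, hr, hσ, h0, h1, hv⟩
  · rintro ⟨γ, r, θ, α, hr, hσ, h0, h1, hv⟩
    refine ⟨γ, hσ, isNormalGeodesic_of_velocity hv, fun t ht => ?_, h0, h1⟩
    rw [(hv t ht).derivWithin (uniqueDiffOn_Icc_zero_one t ht), velocity,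
      isTimelikeFuture_horizontal_iff, mul_pow, mul_pow, Real.cosh_sq]
    have := Real.cosh_pos (θ + 2 * α * t)
    exact ⟨by positivity, by nlinarith⟩

end SubLorentzSU11

namespace SubLorentzSU11

/-! ### Explicit integration of the horizontal part -/

/-- The solution of `f'' = κ f`, `f 0 = 1`, `f' 0 = 0`. -/
noncomputable def cosk (κ t : ℝ) : ℝ :=
  if κ < 0 then Real.cos (√(-κ) * t) else Real.cosh (√κ * t)

/-- The solution of `f'' = κ f`, `f 0 = 0`, `f' 0 = 1`. -/
noncomputable def sink (κ t : ℝ) : ℝ :=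
  if κ < 0 then Real.sin (√(-κ) * t) / √(-κ) else if κ = 0 then t else Real.sinh (√κ * t) / √κ

theorem hasDerivAt_cosk (κ t : ℝ) : HasDerivAt (cosk κ) (κ * sink κ t) t := by
  have hid := fun a : ℝ => (hasDerivAt_id t).const_mul a
  rcases lt_trichotomy κ 0 with h | rfl | h
  · have h0 : √(-κ) ≠ 0 := (Real.sqrt_pos.2 (by linarith)).ne'
    have h1 := Real.sq_sqrt (show 0 ≤ -κ by linarith)
    simp only [funext fun t => show cosk κ t = _ from if_pos h, show sink κ t = _ from if_pos h]
    refine ((hid √(-κ)).cos).congr_deriv ?_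
    simp only [id]
    field_simp
    rw [h1]; ring
  · have : cosk 0 = fun _ => 1 := funext fun t => by simp [cosk]
    rw [this]
    simpa using hasDerivAt_const t (1 : ℝ)
  · have h0 : √κ ≠ 0 := (Real.sqrt_pos.2 h).ne'
    have h1 := Real.sq_sqrt h.le
    have : cosk κ = fun t => Real.cosh (√κ * t) := funext fun t => if_neg h.not_gt
    rw [this, sink, if_neg h.not_gt, if_neg h.ne']
    refine ((hid √κ).cosh).congr_deriv ?_
    simp only [id]
    field_simp
    rw [h1]; ring

theorem hasDerivAt_sink (κ t : ℝ) : HasDerivAt (sink κ) (cosk κ t) t := by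
  have hid := fun a : ℝ => (hasDerivAt_id t).const_mul a
  rcases lt_trichotomy κ 0 with h | rfl | h
  · have h0 : √(-κ) ≠ 0 := (Real.sqrt_pos.2 (by linarith)).ne'
    simp only [funext fun t => show sink κ t = _ from if_pos h, show cosk κ t = _ from if_pos h]
    refine ((hid √(-κ)).sin.div_const _).congr_deriv ?_
    simp only [id]
    field_simp
  · have : sink 0 = fun t => t := funext fun t => by simp [sink]
    rw [this]
    exact (hasDerivAt_id' t).congr_deriv (by simp [cosk])
  · have h0 : √κ ≠ 0 := (Real.sqrt_pos.2 h).ne'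
    have : sink κ = fun t => Real.sinh (√κ * t) / √κ := funext fun t => by
      rw [sink, if_neg h.not_gt, if_neg h.ne']
    rw [this, cosk, if_neg h.not_gt]
    refine ((hid √κ).sinh.div_const _).congr_deriv ?_
    simp only [id]
    field_simp

@[simp] theorem cosk_zero (κ : ℝ) : cosk κ 0 = 1 := by simp [cosk]

@[simp] theorem sink_zero (κ : ℝ) : sink κ 0 = 0 := by simp [sink]

theorem cosk_sq (κ t : ℝ) : cosk κ t ^ 2 = 1 + κ * sink κ t ^ 2 := by
  have h : ∀ t, HasDerivAt (fun t => cosk κ t ^ 2 - κ * sink κ t ^ 2) 0 t := fun t =>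
    (((hasDerivAt_cosk κ t).pow 2).sub (((hasDerivAt_sink κ t).pow 2).const_mul κ)).congr_deriv
      (by push_cast; ring)
  have := is_const_of_deriv_eq_zero (fun t => (h t).differentiableAt) (fun t => (h t).deriv) t 0
  simp only [cosk_zero, sink_zero] at this
  linarith

/-- The diagonal entry of the geodesic in `SU(1,1)`. -/
noncomputable def diag (r θ α t : ℝ) : ℂ :=
  ⟨cosk (α ^ 2 - r ^ 2) t * Real.cosh (α * t) - α * sink (α ^ 2 - r ^ 2) t * Real.sinh (α * t),
    -(sink (α ^ 2 - r ^ 2) t * r * Real.cosh (θ + α * t))⟩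

/-- The off-diagonal entry of the geodesic in `SU(1,1)`. -/
noncomputable def offDiag (r θ α t : ℝ) : ℂ :=
  ⟨α * sink (α ^ 2 - r ^ 2) t * Real.cosh (α * t) - cosk (α ^ 2 - r ^ 2) t * Real.sinh (α * t),
    sink (α ^ 2 - r ^ 2) t * r * Real.sinh (θ + α * t)⟩

/-- The two functions form the first row of exp(tN) exp(−tαX), where N = αX + r(cosh θ Z + sinh θ Y)
satisfies N² = α² − r² and so exp(tN) = `cosk` + `sink` N. The identity says that this matrix has
determinant one. -/
theorem normSq_diag (r θ α t : ℝ) :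
    ‖diag r θ α t‖ ^ 2 = 1 + ‖offDiag r θ α t‖ ^ 2 := by
  rw [← Complex.normSq_eq_norm_sq, ← Complex.normSq_eq_norm_sq, Complex.normSq_apply,
    Complex.normSq_apply]
  have h1 := cosk_sq (α ^ 2 - r ^ 2) t
  have h2 := Real.cosh_sq (α * t)
  have h3 := Real.cosh_sq (θ + α * t)
  simp only [diag, offDiag]
  generalize cosk (α ^ 2 - r ^ 2) t = C at *
  generalize sink (α ^ 2 - r ^ 2) t = S at *
  linear_combination h1 + (C ^ 2 - α ^ 2 * S ^ 2) * h2 + S ^ 2 * r ^ 2 * h3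

theorem radius_offDiag (r θ α t : ℝ) : radius (offDiag r θ α t) = ‖diag r θ α t‖ := by
  rw [radius, ← normSq_diag, Real.sqrt_sq (norm_nonneg _)]

theorem diag_ne_zero (r θ α t : ℝ) : diag r θ α t ≠ 0 := by
  rw [← norm_ne_zero_iff, ← radius_offDiag]
  exact (radius_pos _).ne'

theorem hasDerivAt_complex {f g : ℝ → ℝ} {f' g' t : ℝ} (hf : HasDerivAt f f' t)
    (hg : HasDerivAt g g' t) : HasDerivAt (fun t => (⟨f t, g t⟩ : ℂ)) ⟨f', g'⟩ t := by
  simp only [Complex.mk_eq_add_mul_I]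
  exact (hasDerivAt_ofReal hf).add ((hasDerivAt_ofReal hg).mul_const _)

theorem cosh_sinh_shift (θ a : ℝ) :
    Real.cosh (θ + 2 * a) = Real.cosh (θ + a) * Real.cosh a + Real.sinh (θ + a) * Real.sinh a ∧
    Real.sinh (θ + 2 * a) = Real.sinh (θ + a) * Real.cosh a + Real.cosh (θ + a) * Real.sinh a := by
  rw [← Real.cosh_add, ← Real.sinh_add]
  constructor <;> ring_nf

/-- The phase θ + 2αt of the velocity is split as (θ + αt) + αt, the two angles that occur in the
explicit entries; cosh² − sinh² = 1 in these angles then suffices. -/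
theorem hasDerivAt_diag (r θ α t : ℝ) : HasDerivAt (diag r θ α)
    (-Complex.I * ((r * Real.cosh (θ + 2 * α * t) : ℝ) * diag r θ α t
      + (r * Real.sinh (θ + 2 * α * t) : ℝ) * offDiag r θ α t)) t := by
  have hC := hasDerivAt_cosk (α ^ 2 - r ^ 2) t
  have hS := hasDerivAt_sink (α ^ 2 - r ^ 2) t
  have hc := hasDerivAt_cosh_affine 0 α t
  have hs := hasDerivAt_sinh_affine 0 α t
  have hp := hasDerivAt_cosh_affine θ α t
  simp only [zero_add] at hc hs
  refine (hasDerivAt_complex ((hC.mul hc).sub ((hS.const_mul α).mul hs))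
    (((hS.mul_const r).mul hp).neg)).congr_deriv ?_
  rw [mul_assoc 2 α t, (cosh_sinh_shift θ (α * t)).1, (cosh_sinh_shift θ (α * t)).2]
  have h2 := Real.cosh_sq (α * t)
  have h3 := Real.cosh_sq (θ + α * t)
  apply Complex.ext
  · simp only [diag, offDiag, Complex.mul_re, Complex.mul_im, Complex.add_re, Complex.add_im,
      Complex.neg_re, Complex.neg_im, Complex.I_re, Complex.I_im, Complex.ofReal_re,
      Complex.ofReal_im]
    linear_combination (sink (α ^ 2 - r ^ 2) t * r ^ 2 * Real.cosh (α * t)) * h3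
  · simp only [diag, offDiag, Complex.mul_re, Complex.mul_im, Complex.add_re, Complex.add_im,
      Complex.neg_re, Complex.neg_im, Complex.I_re, Complex.I_im, Complex.ofReal_re,
      Complex.ofReal_im]
    linear_combination (r * cosk (α ^ 2 - r ^ 2) t * Real.cosh (θ + α * t)
      + r * α * sink (α ^ 2 - r ^ 2) t * Real.sinh (θ + α * t)) * h2

theorem hasDerivAt_offDiag (r θ α t : ℝ) : HasDerivAt (offDiag r θ α)
    (Complex.I * ((r * Real.cosh (θ + 2 * α * t) : ℝ) * offDiag r θ α t
      + (r * Real.sinh (θ + 2 * α * t) : ℝ) * diag r θ α t)) t := by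
  have hC := hasDerivAt_cosk (α ^ 2 - r ^ 2) t
  have hS := hasDerivAt_sink (α ^ 2 - r ^ 2) t
  have hc := hasDerivAt_cosh_affine 0 α t
  have hs := hasDerivAt_sinh_affine 0 α t
  have hp := hasDerivAt_sinh_affine θ α t
  simp only [zero_add] at hc hs
  refine (hasDerivAt_complex (((hS.const_mul α).mul hc).sub (hC.mul hs))
    (((hS.mul_const r).mul hp))).congr_deriv ?_
  rw [mul_assoc 2 α t, (cosh_sinh_shift θ (α * t)).1, (cosh_sinh_shift θ (α * t)).2]
  have h2 := Real.cosh_sq (α * t)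
  have h3 := Real.cosh_sq (θ + α * t)
  apply Complex.ext
  · simp only [diag, offDiag, Complex.mul_re, Complex.mul_im, Complex.add_re, Complex.add_im,
      Complex.I_re, Complex.I_im, Complex.ofReal_re, Complex.ofReal_im]
    linear_combination (-sink (α ^ 2 - r ^ 2) t * r ^ 2 * Real.sinh (α * t)) * h3
  · simp only [diag, offDiag, Complex.mul_re, Complex.mul_im, Complex.add_re, Complex.add_im,
      Complex.I_re, Complex.I_im, Complex.ofReal_re, Complex.ofReal_im]
    linear_combination (-r * cosk (α ^ 2 - r ^ 2) t * Real.sinh (θ + α * t)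
      - r * α * sink (α ^ 2 - r ^ 2) t * Real.cosh (θ + α * t)) * h2

theorem continuous_diag (r θ α : ℝ) : Continuous (diag r θ α) :=
  continuous_iff_continuousAt.2 fun t => (hasDerivAt_diag r θ α t).continuousAt

theorem continuous_offDiag (r θ α : ℝ) : Continuous (offDiag r θ α) :=
  continuous_iff_continuousAt.2 fun t => (hasDerivAt_offDiag r θ α t).continuousAt

/-- A continuous logarithm of `diag`. -/
noncomputable def logDiag (r θ α t : ℝ) : ℂ :=
  ∫ s in (0 : ℝ)..t, -Complex.I * ((r * Real.cosh (θ + 2 * α * s) : ℝ)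
    + (r * Real.sinh (θ + 2 * α * s) : ℝ) * (offDiag r θ α s / diag r θ α s))

theorem hasDerivAt_logDiag (r θ α t : ℝ) : HasDerivAt (logDiag r θ α)
    (-Complex.I * ((r * Real.cosh (θ + 2 * α * t) : ℝ)
      + (r * Real.sinh (θ + 2 * α * t) : ℝ) * (offDiag r θ α t / diag r θ α t))) t := by
  have h1 : Continuous fun s => offDiag r θ α s / diag r θ α s :=
    (continuous_offDiag r θ α).div (continuous_diag r θ α) (diag_ne_zero r θ α)
  have h2 : Continuous fun s => -Complex.I * ((r * Real.cosh (θ + 2 * α * s) : ℝ)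
      + (r * Real.sinh (θ + 2 * α * s) : ℝ) * (offDiag r θ α s / diag r θ α s)) := by
    fun_prop
  exact (h2.integral_hasStrictDerivAt 0 t).hasDerivAt

/-- The integrand is the logarithmic derivative of `diag`, so the quotient of the two sides is
constant. The imaginary part of this logarithm lifts the matrix curve to the cover. -/
theorem exp_logDiag (r θ α t : ℝ) : Complex.exp (logDiag r θ α t) = diag r θ α t := by
  have h : ∀ t, HasDerivAt (fun t => diag r θ α t * Complex.exp (-logDiag r θ α t)) 0 t := fun t =>
    ((hasDerivAt_diag r θ α t).mul (hasDerivAt_logDiag r θ α t).neg.cexp).congr_deriv (by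
      have := diag_ne_zero r θ α t
      simp only [Pi.neg_apply]
      field_simp
      ring)
  have := is_const_of_deriv_eq_zero (fun t => (h t).differentiableAt) (fun t => (h t).deriv) t 0
  have h0 : diag r θ α 0 = 1 := by apply Complex.ext <;> simp [diag]
  have h1 : logDiag r θ α 0 = 0 := intervalIntegral.integral_same
  simp only [h0, h1, neg_zero, Complex.exp_zero, mul_one, Complex.exp_neg] at this
  rw [mul_inv_eq_one₀ (Complex.exp_ne_zero _)] at this
  exact this.symm

/-- The geodesic with parameters `r`, `θ`, `α`. -/
noncomputable def curve (r θ α t : ℝ) : Cover := ((logDiag r θ α t).im, offDiag r θ α t)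

/-- The upper left entry of `proj q`. -/
noncomputable def entry (q : Cover) : ℂ := (radius q.2 : ℂ) * Complex.exp (q.1 * Complex.I)

theorem norm_entry (q : Cover) : ‖entry q‖ = radius q.2 := by
  rw [entry, norm_mul, Complex.norm_exp_ofReal_mul_I, mul_one, Complex.norm_real, Real.norm_eq_abs,
    abs_of_pos (radius_pos _)]

theorem entry_ne_zero (q : Cover) : entry q ≠ 0 := by
  rw [← norm_ne_zero_iff, norm_entry]
  exact (radius_pos _).ne'

theorem entry_curve (r θ α t : ℝ) : entry (curve r θ α t) = diag r θ α t := by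
  rw [entry, curve, radius_offDiag, ← exp_logDiag, Complex.norm_exp, Complex.ofReal_exp,
    ← Complex.exp_add, Complex.re_add_im]

theorem curve_zero (r θ α : ℝ) : curve r θ α 0 = one := by
  refine Prod.ext ?_ (Complex.ext ?_ ?_) <;> simp [curve, one, logDiag, offDiag]

theorem velocity_eq (r θ α t : ℝ) (q : Cover) : velocity r θ α t q =
    ((-Complex.I * ((r * Real.cosh (θ + 2 * α * t) : ℝ)
      + (r * Real.sinh (θ + 2 * α * t) : ℝ) * (q.2 / entry q))).im,
    Complex.I * ((r * Real.cosh (θ + 2 * α * t) : ℝ) * q.2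
      + (r * Real.sinh (θ + 2 * α * t) : ℝ) * entry q)) := by
  have hdiv : q.2 / entry q = q.2 * Complex.exp (-(q.1 * Complex.I)) / radius q.2 := by
    rw [entry, Complex.exp_neg, mul_comm (radius q.2 : ℂ), ← div_div, div_eq_mul_inv q.2]
  rw [velocity, fieldZ, fieldY, leftInvariant_eq, leftInvariant_eq, hdiv]
  generalize r * Real.cosh (θ + 2 * α * t) = a
  generalize r * Real.sinh (θ + 2 * α * t) = b
  refine Prod.ext ?_ ?_
  · simp only [vecZ, vecY, Prod.smul_mk, Prod.mk_add_mk, map_zero, mul_zero, zero_mul,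
      Complex.zero_im, zero_div, add_zero, zero_add, smul_eq_mul, Complex.conj_I]
    rw [show q.2 * -Complex.I * Complex.exp (-(q.1 * Complex.I)) =
      -Complex.I * (q.2 * Complex.exp (-(q.1 * Complex.I))) by ring]
    generalize q.2 * Complex.exp (-(q.1 * Complex.I)) = z
    simp [Complex.div_ofReal_re, Complex.div_ofReal_im]
    ring
  · simp [vecZ, vecY, entry]
    ring

theorem hasDerivAt_curve (r θ α t : ℝ) :
    HasDerivAt (curve r θ α) (velocity r θ α t (curve r θ α t)) t := by
  rw [velocity_eq, entry_curve]
  exact (hasDerivAt_im (hasDerivAt_logDiag r θ α t)).prodMk (hasDerivAt_offDiag r θ α t)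

theorem differentiable_entry : Differentiable ℝ entry := by
  have h1 := differentiable_ofReal_radius_snd
  have h2 := differentiable_ofReal_fst
  unfold entry
  fun_prop

/-- In logarithmic form, the radius supplies the real part and the first coordinate the imaginary
part. Thus `entry` and the second coordinate of a solution obey the same linear system as `diag` and
`offDiag`. -/
theorem fderiv_entry_velocity (r θ α t : ℝ) (q : Cover) :
    fderiv ℝ entry q (velocity r θ α t q) =
      -Complex.I * ((r * Real.cosh (θ + 2 * α * t) : ℝ) * entry q
      + (r * Real.sinh (θ + 2 * α * t) : ℝ) * q.2) := by
  have key (u : Cover) : fderiv ℝ entry q u =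
      (((q.2 * conj u.2).re / radius q.2 / radius q.2 : ℝ) + u.1 * Complex.I) * entry q := by
    refine fderiv_apply_eq_of_hasDerivAt_affine (differentiable_entry q) ?_
    obtain ⟨h1, h2⟩ := hasDerivAt_affine q u
    refine ((hasDerivAt_ofReal (hasDerivAt_radius h2)).mul (hasDerivAt_exp h1)).congr_deriv ?_
    have : (radius q.2 : ℂ) ≠ 0 := by exact_mod_cast (radius_pos q.2).ne'
    simp only [Complex.ofReal_zero, zero_mul, add_zero, entry]
    push_cast
    field_simp
  rw [key, velocity_eq]
  generalize r * Real.cosh (θ + 2 * α * t) = a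
  generalize r * Real.sinh (θ + 2 * α * t) = b
  have h0 := entry_ne_zero q
  obtain ⟨z, hz⟩ : ∃ z, z = q.2 / entry q := ⟨_, rfl⟩
  have hq : q.2 = z * entry q := by rw [hz, div_mul_cancel₀ _ h0]
  have hre : (q.2 * conj (Complex.I * (a * q.2 + b * entry q))).re / radius q.2 / radius q.2
      = b * z.im := by
    have hn : ((entry q) * conj (entry q)) = ((radius q.2 ^ 2 : ℝ) : ℂ) := by
      rw [Complex.mul_conj', norm_entry]; push_cast; rfl
    have : q.2 * conj (Complex.I * (a * q.2 + b * entry q)) =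
        ((radius q.2 ^ 2 : ℝ) : ℂ) * (z * conj (Complex.I * (a * z + b))) := by
      rw [← hn]
      generalize radius q.2 = R at *
      rw [hq]
      simp only [map_mul, map_add]
      ring
    rw [this, Complex.re_ofReal_mul, div_div, ← pow_two, mul_div_cancel_left₀ _
      (pow_ne_zero 2 (radius_pos q.2).ne')]
    simp
    ring
  rw [hre, ← hz]
  conv_rhs => rw [hq]
  have hI := Complex.I_mul_I
  have hz2 := Complex.re_add_im z
  have him : ((-Complex.I * (a + b * z)).im : ℂ) = -(a + b * z.re) := by
    simp
  rw [him]
  push_cast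
  linear_combination (-Complex.I * b * entry q) * hz2 + (b * z.im * entry q) * hI

/-- Uniqueness is first proved for the projected matrices. The first coordinates then have equal
derivatives, since the velocity depends on the point only through `entry` and the second coordinate.
-/
theorem eq_curve_of_velocity {γ : ℝ → Cover} {r θ α : ℝ} (h0 : γ 0 = one)
    (hγ : ∀ t ∈ Set.Icc (0 : ℝ) 1,
      HasDerivWithinAt γ (velocity r θ α t (γ t)) (Set.Icc 0 1) t) :
    ∀ t ∈ Set.Icc (0 : ℝ) 1, γ t = curve r θ α t := by
  have hA (t) (ht : t ∈ Set.Icc (0 : ℝ) 1) := fderiv_entry_velocity r θ α t (γ t) ▸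
    (differentiable_entry (γ t)).hasFDerivAt.comp_hasDerivWithinAt t (hγ t ht)
  have hw (t) (ht : t ∈ Set.Icc (0 : ℝ) 1) : HasDerivWithinAt (fun t => (γ t).2)
      (Complex.I * ((r * Real.cosh (θ + 2 * α * t) : ℝ) * (γ t).2
      + (r * Real.sinh (θ + 2 * α * t) : ℝ) * entry (γ t))) (Set.Icc 0 1) t := by
    have := (hγ t ht).snd
    rwa [velocity_eq] at this
  have hd (t) := (hasDerivAt_diag r θ α t).hasDerivWithinAt (s := Set.Icc (0 : ℝ) 1)
  have ho (t) := (hasDerivAt_offDiag r θ α t).hasDerivWithinAt (s := Set.Icc (0 : ℝ) 1)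
  have hd' (t) := (hasDerivAt_conj (hasDerivAt_diag r θ α t)).hasDerivWithinAt (s := Set.Icc (0 : ℝ) 1)
  have ho' (t) := (hasDerivAt_conj (hasDerivAt_offDiag r θ α t)).hasDerivWithinAt
    (s := Set.Icc (0 : ℝ) 1)
  have hd0 : diag r θ α 0 = 1 := by apply Complex.ext <;> simp [diag]
  have ho0 : offDiag r θ α 0 = 0 := by apply Complex.ext <;> simp [offDiag]
  have he0 : entry (γ 0) = 1 := by simp [h0, entry, one, radius_zero]
  -- These are the entries of the matrix of γ times the inverse of the explicit matrix; both factors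
  -- solve the same linear equation, so the product stays constant.
  have e1 := eq_of_hasDerivWithinAt_zero
    (f := fun t => entry (γ t) * conj (diag r θ α t) - (γ t).2 * conj (offDiag r θ α t))
    fun t ht => (((hA t ht).mul (hd' t)).sub ((hw t ht).mul (ho' t))).congr_deriv (by
      simp only [map_mul, map_add, map_neg, Complex.conj_I, Complex.conj_ofReal, Function.comp]
      ring)
  have e2 := eq_of_hasDerivWithinAt_zero
    (f := fun t => (γ t).2 * diag r θ α t - entry (γ t) * offDiag r θ α t)
    fun t ht => (((hw t ht).mul (hd t)).sub ((hA t ht).mul (ho t))).congr_deriv (by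
      simp only [Function.comp]
      ring)
  simp only [hd0, ho0, he0, map_one, map_zero, mul_one, mul_zero, sub_zero,
    show (γ 0).2 = 0 from by rw [h0]; rfl] at e1 e2
  have key (t) (ht : t ∈ Set.Icc (0 : ℝ) 1) :
      entry (γ t) = diag r θ α t ∧ (γ t).2 = offDiag r θ α t := by
    have hN : diag r θ α t * conj (diag r θ α t) = 1 + offDiag r θ α t * conj (offDiag r θ α t) := by
      rw [Complex.mul_conj', Complex.mul_conj']
      exact_mod_cast normSq_diag r θ α t
    have e1 := e1 t ht
    have e2 := e2 t ht
    constructor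
    · linear_combination diag r θ α t * e1 - entry (γ t) * hN + conj (offDiag r θ α t) * e2
    · linear_combination offDiag r θ α t * e1 - (γ t).2 * hN + conj (diag r θ α t) * e2
  have hc := eq_of_hasDerivWithinAt_zero (f := fun t => (γ t).1 - (curve r θ α t).1) (by
    intro t ht
    have h1 : HasDerivWithinAt (fun t => (γ t).1) (velocity r θ α t (γ t)).1 (Set.Icc 0 1) t :=
      (hγ t ht).fst
    have h2 : HasDerivWithinAt (fun t => (curve r θ α t).1)
        (velocity r θ α t (curve r θ α t)).1 (Set.Icc 0 1) t :=
      (hasDerivAt_curve r θ α t).hasDerivWithinAt.fst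
    refine (h1.sub h2).congr_deriv ?_
    rw [velocity_eq, velocity_eq, (key t ht).1, (key t ht).2, entry_curve]
    simp [curve])
  intro t ht
  refine Prod.ext ?_ (key t ht).2
  have := hc t ht
  rw [h0, curve_zero, sub_self, sub_eq_zero] at this
  exact this

theorem mem_geodesicsTo_iff {g : Cover} {σ : unitInterval → Cover} :
    σ ∈ geodesicsTo g ↔ ∃ r θ α : ℝ, 0 < r ∧ curve r θ α 1 = g ∧
      σ = fun t : unitInterval => curve r θ α t := by
  rw [geodesicsTo_iff_velocity]
  constructor
  · rintro ⟨γ, r, θ, α, hr, hσ, h0, h1, hγ⟩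
    have := eq_curve_of_velocity h0 hγ
    refine ⟨r, θ, α, hr, ?_, funext fun t => ?_⟩
    · rw [← this 1 ⟨zero_le_one, le_rfl⟩, h1]
    · rw [hσ, this t t.2]
  · rintro ⟨r, θ, α, hr, h1, rfl⟩
    exact ⟨curve r θ α, r, θ, α, hr, fun t => rfl, curve_zero r θ α, h1, fun t _ =>
      (hasDerivAt_curve r θ α t).hasDerivWithinAt⟩

/-- The frame coefficients of the velocity are determined by the curve. At t = 0 they give r through
cosh² − sinh² = 1 and θ through injectivity of sinh; at t = 1 they give θ + 2α. -/
theorem curve_injective {r θ α r' θ' α' : ℝ} (hr : 0 < r) (hr' : 0 < r')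
    (h : (fun t : unitInterval => curve r θ α t) = fun t : unitInterval => curve r' θ' α' t) :
    r = r' ∧ θ = θ' ∧ α = α' := by
  have heq : Set.EqOn (curve r θ α) (curve r' θ' α') (Set.Icc 0 1) :=
    fun t ht => congrFun h ⟨t, ht⟩
  have hv (t) (ht : t ∈ Set.Icc (0 : ℝ) 1) : r * Real.cosh (θ + 2 * α * t) =
      r' * Real.cosh (θ' + 2 * α' * t) ∧ r * Real.sinh (θ + 2 * α * t) =
      r' * Real.sinh (θ' + 2 * α' * t) := by
    have h1 := (hasDerivAt_curve r θ α t).hasDerivWithinAt (s := Set.Icc (0 : ℝ) 1)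
    have h2 := ((hasDerivAt_curve r' θ' α' t).hasDerivWithinAt (s := Set.Icc (0 : ℝ) 1)).congr
      heq (heq ht)
    have := (uniqueDiffOn_Icc_zero_one t ht).eq_deriv _ h1 h2
    rw [← heq ht] at this
    exact horizontal_injective this
  have h0 := hv 0 ⟨le_rfl, zero_le_one⟩
  have h1 := hv 1 ⟨zero_le_one, le_rfl⟩
  have hrr : r = r' := by
    refine (pow_left_inj₀ hr.le hr'.le two_ne_zero).1 ?_
    have e1 := Real.cosh_sq (θ + 2 * α * 0)
    have e2 := Real.cosh_sq (θ' + 2 * α' * 0)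
    linear_combination (-r ^ 2) * e1 + r' ^ 2 * e2
      + (r * Real.cosh (θ + 2 * α * 0) + r' * Real.cosh (θ' + 2 * α' * 0)) * h0.1
      - (r * Real.sinh (θ + 2 * α * 0) + r' * Real.sinh (θ' + 2 * α' * 0)) * h0.2
  subst hrr
  have h0 := Real.sinh_injective (mul_left_cancel₀ hr.ne' h0.2)
  have h1 := Real.sinh_injective (mul_left_cancel₀ hr.ne' h1.2)
  exact ⟨rfl, by linarith, by linarith⟩

end SubLorentzSU11

namespace SubLorentzSU11

/-! ### Bands -/

/-- The values of `κ` for which the endpoint lies between the `k`-th and the `k + 1`-st line. -/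
def Band (k : ℕ) (κ : ℝ) : Prop :=
  (k = 0 ∨ k * Real.pi < √(-κ)) ∧ √(-κ) < (k + 1) * Real.pi

/-- The values of `(-1) ^ k * cosk κ 1` for `κ` in the `k`-th band. -/
def bandDomain (k : ℕ) : Set ℝ := {y | -1 < y ∧ (k = 0 ∨ y < 1)}

/-- The value of `κ` in the `k`-th band with `(-1) ^ k * cosk κ 1 = y`. -/
noncomputable def bandParam (k : ℕ) (y : ℝ) : ℝ :=
  if y ≤ 1 then -(Real.arccos y + k * Real.pi) ^ 2 else Real.arcosh y ^ 2

/-- The value of `(-1) ^ k * sink κ 1` as a function of `(-1) ^ k * cosk κ 1`. -/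
noncomputable def bandSink (k : ℕ) (y : ℝ) : ℝ := (-1) ^ k * sink (bandParam k y) 1

theorem neg_one_pow_mul_self (k : ℕ) : ((-1 : ℝ) ^ k) * (-1) ^ k = 1 := by
  rw [← mul_pow]; simp

theorem bandSink_of_lt_one {k : ℕ} {y : ℝ} (h1 : y < 1) :
    bandSink k y = √(1 - y ^ 2) / (Real.arccos y + k * Real.pi) := by
  have ha : 0 < Real.arccos y + k * Real.pi := by
    have := Real.arccos_pos.2 h1
    have := Real.pi_pos
    positivity
  rw [bandSink, bandParam, if_pos h1.le, sink, if_pos (by nlinarith), neg_neg, Real.sqrt_sq ha.le,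
    mul_one, Real.sin_add_nat_mul_pi, Real.sin_arccos, mul_div_assoc, ← mul_assoc,
    neg_one_pow_mul_self, one_mul]

theorem bandSink_of_one_lt {y : ℝ} (h1 : 1 < y) :
    bandSink 0 y = √(y ^ 2 - 1) / Real.arcosh y := by
  have ha := Real.arcosh_pos h1
  rw [bandSink, bandParam, if_neg h1.not_ge, sink, if_neg (by nlinarith), if_neg (by positivity),
    Real.sqrt_sq ha.le, mul_one, Real.sinh_arcosh h1.le, pow_zero, one_mul]

theorem bandSink_one : bandSink 0 1 = 1 := by
  simp [bandSink, bandParam, sink]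

theorem cosk_bandParam {k : ℕ} {y : ℝ} (hy : y ∈ bandDomain k) :
    (-1) ^ k * cosk (bandParam k y) 1 = y := by
  obtain ⟨h, h1⟩ := hy
  rcases lt_trichotomy y 1 with h2 | rfl | h2
  · have ha : 0 < Real.arccos y + k * Real.pi := by
      have := Real.arccos_pos.2 h2
      have := Real.pi_pos
      positivity
    rw [bandParam, if_pos h2.le, cosk, if_pos (by nlinarith), neg_neg, Real.sqrt_sq ha.le, mul_one,
      Real.cos_add_nat_mul_pi, Real.cos_arccos h.le h2.le, ← mul_assoc, neg_one_pow_mul_self,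
      one_mul]
  · rcases h1 with rfl | h1
    · simp [bandParam, cosk]
    · exact absurd h1 (lt_irrefl _)
  · obtain rfl : k = 0 := h1.resolve_right h2.not_gt
    have ha := Real.arcosh_pos h2
    rw [bandParam, if_neg h2.not_ge, cosk, if_neg (by nlinarith), Real.sqrt_sq ha.le, mul_one,
      Real.cosh_arcosh h2.le, pow_zero, one_mul]

theorem bandSink_pos {k : ℕ} {y : ℝ} (hy : y ∈ bandDomain k) : 0 < bandSink k y := by
  obtain ⟨h, h1⟩ := hy
  rcases lt_trichotomy y 1 with h2 | rfl | h2
  · have ha : 0 < Real.arccos y := Real.arccos_pos.2 h2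
    have := Real.pi_pos
    rw [bandSink_of_lt_one h2]
    have : 0 < √(1 - y ^ 2) := Real.sqrt_pos.2 (by nlinarith)
    positivity
  · rcases h1 with rfl | h1
    · rw [bandSink_one]; exact one_pos
    · exact absurd h1 (lt_irrefl _)
  · obtain rfl : k = 0 := h1.resolve_right h2.not_gt
    have ha := Real.arcosh_pos h2
    rw [bandSink_of_one_lt h2]
    have : 0 < √(y ^ 2 - 1) := Real.sqrt_pos.2 (by nlinarith)
    positivity

theorem band_bandParam {k : ℕ} {y : ℝ} (hy : y ∈ bandDomain k) : Band k (bandParam k y) := by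
  obtain ⟨h, h1⟩ := hy
  have hpi := Real.pi_pos
  by_cases h2 : y ≤ 1
  · have ha : 0 ≤ Real.arccos y + k * Real.pi := by
      have := Real.arccos_nonneg y
      positivity
    rw [bandParam, if_pos h2, Band, neg_neg, Real.sqrt_sq ha]
    have : Real.arccos y < Real.pi := by
      refine lt_of_le_of_ne (Real.arccos_le_pi y) fun he => ?_
      rw [Real.arccos_eq_pi] at he; linarith
    refine ⟨h1.imp_right fun h1 => ?_, by linarith⟩
    have := Real.arccos_pos.2 h1
    linarith
  · obtain rfl : k = 0 := h1.resolve_right (by linarith)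
    rw [bandParam, if_neg h2, Band, Real.sqrt_eq_zero_of_nonpos (by nlinarith [sq_nonneg (Real.arcosh y)])]
    exact ⟨Or.inl rfl, by simpa using hpi⟩

/-- For κ < 0 the number √(−κ) − kπ lies in (0, π), where cosine is injective, and the shift by kπ
accounts for the sign. Only the band k = 0 contains κ ≥ 0; there cosh and `arcosh` take over. So y
is a faithful coordinate on each band. -/
theorem Band.cosk_mem {k : ℕ} {κ : ℝ} (h : Band k κ) :
    (-1) ^ k * cosk κ 1 ∈ bandDomain k ∧ bandParam k ((-1) ^ k * cosk κ 1) = κ := by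
  obtain ⟨h1, h2⟩ := h
  have hpi := Real.pi_pos
  by_cases hκ : κ < 0
  · have hν : 0 < √(-κ) := Real.sqrt_pos.2 (by linarith)
    have hν2 := Real.sq_sqrt (show 0 ≤ -κ by linarith)
    have hμ : 0 < √(-κ) - k * Real.pi := by
      rcases h1 with rfl | h1
      · simpa using hν
      · linarith
    have e : (-1) ^ k * cosk κ 1 = Real.cos (√(-κ) - k * Real.pi) := by
      rw [cosk, if_pos hκ, mul_one, Real.cos_sub_nat_mul_pi]
    have hlt : Real.cos (√(-κ) - k * Real.pi) < 1 := by
      rw [← Real.cos_zero]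
      exact Real.cos_lt_cos_of_nonneg_of_le_pi le_rfl (by linarith) hμ
    have hgt : -1 < Real.cos (√(-κ) - k * Real.pi) := by
      rw [← Real.cos_pi]
      exact Real.cos_lt_cos_of_nonneg_of_le_pi hμ.le le_rfl (by linarith)
    rw [e]
    refine ⟨⟨hgt, Or.inr hlt⟩, ?_⟩
    rw [bandParam, if_pos hlt.le, Real.arccos_cos hμ.le (by linarith)]
    linarith [show √(-κ) - k * Real.pi + k * Real.pi = √(-κ) by ring,
      congrArg (· ^ 2) (show √(-κ) - k * Real.pi + k * Real.pi = √(-κ) by ring)]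
  · have hν : √(-κ) = 0 := Real.sqrt_eq_zero_of_nonpos (by linarith)
    rw [hν] at h1
    obtain rfl : k = 0 := h1.resolve_right (by have := Real.pi_pos; exact not_lt.2 (by positivity))
    rw [pow_zero, one_mul, cosk, if_neg hκ, mul_one]
    refine ⟨⟨by linarith [Real.one_le_cosh √κ], Or.inl rfl⟩, ?_⟩
    rcases (not_lt.1 hκ).eq_or_lt with rfl | hpos
    · simp [bandParam]
    · have := Real.sqrt_pos.2 hpos
      rw [bandParam, if_neg (not_le.2 (Real.one_lt_cosh.2 this.ne')), Real.arcosh_cosh this.le,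
        Real.sq_sqrt hpos.le]

theorem Band.sink_pos {k : ℕ} {κ : ℝ} (h : Band k κ) : 0 < (-1) ^ k * sink κ 1 := by
  obtain ⟨h1, h2⟩ := h.cosk_mem
  have := bandSink_pos h1
  rwa [bandSink, h2] at this

theorem band_or_sink_eq_zero (κ : ℝ) :
    (∃ k, Band k κ) ∨ ∃ k : ℕ, 1 ≤ k ∧ κ < 0 ∧ √(-κ) = k * Real.pi := by
  have hpi := Real.pi_pos
  set k := ⌊√(-κ) / Real.pi⌋₊
  have h1 : k * Real.pi ≤ √(-κ) := by
    rw [← le_div_iff₀ hpi]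
    exact Nat.floor_le (by positivity)
  have h2 : √(-κ) < (k + 1) * Real.pi := by
    rw [← div_lt_iff₀ hpi]
    exact Nat.lt_floor_add_one _
  rcases Nat.eq_zero_or_pos k with hk | hk
  · exact Or.inl ⟨k, Or.inl hk, h2⟩
  · rcases h1.lt_or_eq with h | h
    · exact Or.inl ⟨k, Or.inr h, h2⟩
    · refine Or.inr ⟨k, hk, ?_, h.symm⟩
      have : 0 < √(-κ) := by rw [← h]; positivity
      have := Real.sqrt_pos.1 this
      linarith

/-! ### The winding of the geodesics -/

theorem re_im_entry (q : Cover) : (entry q).re = radius q.2 * Real.cos q.1 ∧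
    (entry q).im = radius q.2 * Real.sin q.1 := by
  rw [entry, Complex.re_ofReal_mul, Complex.im_ofReal_mul, Complex.exp_ofReal_mul_I_re,
    Complex.exp_ofReal_mul_I_im]
  exact ⟨rfl, rfl⟩

/-- The diagonal entry, which starts at 1, never lies on the negative ray through e^{−iνt}, where ν
= √(−κ). Hence the continuous angle cannot drift as far as π from −νt. For κ ≥ 0 the convention √ =
0 makes ν = 0, so one statement covers all cases. -/
theorem abs_curve_fst_add_lt {r θ α : ℝ} (hr : 0 < r) :
    |(curve r θ α 1).1 + √(-(α ^ 2 - r ^ 2))| < Real.pi := by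
  by_contra! hcon
  have hpi := Real.pi_pos
  set D : ℝ → ℝ := fun t => |(curve r θ α t).1 + √(-(α ^ 2 - r ^ 2)) * t| with hD
  have hcont : Continuous D := by
    have : Continuous (curve r θ α) :=
      continuous_iff_continuousAt.2 fun t => (hasDerivAt_curve r θ α t).continuousAt
    exact ((continuous_fst.comp this).add (continuous_const.mul continuous_id)).abs
  have h0 : D 0 = 0 := by simp [hD, curve_zero, one]
  have h1 : Real.pi ≤ D 1 := by simpa [hD] using hcon
  obtain ⟨t, -, ht⟩ := intermediate_value_Icc zero_le_one hcont.continuousOn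
    (show Real.pi ∈ Set.Icc (D 0) (D 1) from ⟨by rw [h0]; exact hpi.le, h1⟩)
  -- At distance exactly π the entry would be a negative multiple of e^{−iνt}. For κ < 0, comparing
  -- imaginary parts forces sin νt = 0, and real parts then force cos νt = 0.
  have hsin : Real.sin (curve r θ α t).1 = Real.sin (√(-(α ^ 2 - r ^ 2)) * t) := by
    rcases (abs_eq hpi.le).1 ht with h | h
    · rw [show (curve r θ α t).1 = Real.pi - √(-(α ^ 2 - r ^ 2)) * t by linarith, Real.sin_pi_sub]
    · rw [show (curve r θ α t).1 = -(√(-(α ^ 2 - r ^ 2)) * t + Real.pi) by linarith, Real.sin_neg,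
        Real.sin_add_pi, neg_neg]
  have hcos : Real.cos (curve r θ α t).1 = -Real.cos (√(-(α ^ 2 - r ^ 2)) * t) := by
    rcases (abs_eq hpi.le).1 ht with h | h
    · rw [show (curve r θ α t).1 = Real.pi - √(-(α ^ 2 - r ^ 2)) * t by linarith, Real.cos_pi_sub]
    · rw [show (curve r θ α t).1 = -(√(-(α ^ 2 - r ^ 2)) * t + Real.pi) by linarith, Real.cos_neg,
        Real.cos_add_pi]
  obtain ⟨e1, e2⟩ := re_im_entry (curve r θ α t)
  rw [entry_curve, hcos] at e1
  rw [entry_curve, hsin] at e2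
  simp only [diag] at e1 e2
  have hR := radius_pos (curve r θ α t).2
  have hch := Real.cosh_pos (θ + α * t)
  have hch' := Real.cosh_pos (α * t)
  by_cases hκ : α ^ 2 - r ^ 2 < 0
  · have hν : 0 < √(-(α ^ 2 - r ^ 2)) := Real.sqrt_pos.2 (by linarith)
    rw [sink, if_pos hκ, cosk, if_pos hκ] at e1
    rw [sink, if_pos hκ] at e2
    have hs : Real.sin (√(-(α ^ 2 - r ^ 2)) * t) = 0 := by
      have : Real.sin (√(-(α ^ 2 - r ^ 2)) * t) * (radius (curve r θ α t).2
          + r * Real.cosh (θ + α * t) / √(-(α ^ 2 - r ^ 2))) = 0 := by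
        linear_combination -e2
      exact (mul_eq_zero.1 this).resolve_right (by positivity)
    rw [hs] at e1
    have hc : Real.cos (√(-(α ^ 2 - r ^ 2)) * t) = 0 := by
      have : Real.cos (√(-(α ^ 2 - r ^ 2)) * t) * (radius (curve r θ α t).2
          + Real.cosh (α * t)) = 0 := by
        linear_combination e1
      exact (mul_eq_zero.1 this).resolve_right (by positivity)
    have := Real.sin_sq_add_cos_sq (√(-(α ^ 2 - r ^ 2)) * t)
    rw [hs, hc] at this
    norm_num at this
  · have hν : √(-(α ^ 2 - r ^ 2)) = 0 := Real.sqrt_eq_zero_of_nonpos (by linarith)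
    rw [hν, zero_mul, Real.sin_zero, mul_zero, neg_eq_zero] at e2
    have hS : sink (α ^ 2 - r ^ 2) t = 0 := by
      simpa [hr.ne', hch.ne'] using e2
    rw [hν, zero_mul, Real.cos_zero, hS, cosk, if_neg hκ] at e1
    have := Real.cosh_pos (√(α ^ 2 - r ^ 2) * t)
    nlinarith

theorem mem_Ioo_of_sin_neg {x : ℝ} (h1 : -(2 * Real.pi) < x) (h2 : x < Real.pi)
    (h : Real.sin x < 0) : -Real.pi < x ∧ x < 0 := by
  constructor
  · by_contra! hx
    have := Real.sin_nonneg_of_nonneg_of_le_pi (show 0 ≤ x + 2 * Real.pi by linarith) (by linarith)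
    rw [Real.sin_add_two_pi] at this
    linarith
  · by_contra! hx
    linarith [Real.sin_nonneg_of_nonneg_of_le_pi hx h2.le]

theorem sin_curve_fst {r θ α : ℝ} : radius (curve r θ α 1).2 * Real.sin (curve r θ α 1).1
    = -(sink (α ^ 2 - r ^ 2) 1 * r * Real.cosh (θ + α)) := by
  rw [← (re_im_entry _).2, entry_curve, diag, mul_one]

/-- The winding estimate leaves the interval (−2π, π) after the shift by kπ, and the sign of the
imaginary part of the entry selects (−π, 0) in it. -/
theorem curve_fst_of_band {r θ α : ℝ} {k : ℕ} (hr : 0 < r) (h : Band k (α ^ 2 - r ^ 2)) :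
    -Real.pi < (curve r θ α 1).1 + k * Real.pi ∧ (curve r θ α 1).1 + k * Real.pi < 0 := by
  obtain ⟨h1, h2⟩ := abs_lt.1 (abs_curve_fst_add_lt (θ := θ) (α := α) hr)
  have h3 : k * Real.pi ≤ √(-(α ^ 2 - r ^ 2)) := by
    rcases h.1 with h | h
    · rw [h]; simp
    · exact h.le
  have h4 := h.2
  refine mem_Ioo_of_sin_neg (by linarith) (by linarith) ?_
  have hs := sin_curve_fst (r := r) (θ := θ) (α := α)
  have hS := h.sink_pos
  have hR := radius_pos (curve r θ α 1).2
  have hch := Real.cosh_pos (θ + α)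
  rw [Real.sin_add_nat_mul_pi]
  have : radius (curve r θ α 1).2 * ((-1) ^ k * Real.sin (curve r θ α 1).1) < 0 := by
    have : radius (curve r θ α 1).2 * ((-1) ^ k * Real.sin (curve r θ α 1).1) =
      -((-1) ^ k * sink (α ^ 2 - r ^ 2) 1 * (r * Real.cosh (θ + α))) := by
      linear_combination (-1) ^ k * hs
    rw [this, neg_lt_zero]
    positivity
  exact (pos_iff_neg_of_mul_neg this).1 hR

theorem curve_fst_of_eq_mul_pi {r θ α : ℝ} {k : ℕ} (hr : 0 < r) (hκ : α ^ 2 - r ^ 2 < 0)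
    (h : √(-(α ^ 2 - r ^ 2)) = k * Real.pi) : (curve r θ α 1).1 = -(Real.pi * k) := by
  obtain ⟨h1, h2⟩ := abs_lt.1 (abs_curve_fst_add_lt (θ := θ) (α := α) hr)
  have hs := sin_curve_fst (r := r) (θ := θ) (α := α)
  rw [sink, if_pos hκ, mul_one, h, Real.sin_nat_mul_pi] at hs
  have hs : Real.sin (curve r θ α 1).1 = 0 := by simpa [(radius_pos _).ne'] using hs
  have : Real.sin ((curve r θ α 1).1 + k * Real.pi) = 0 := by
    rw [Real.sin_add_nat_mul_pi, hs, mul_zero]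
  rw [h] at h1 h2
  have := (Real.sin_eq_zero_iff_of_lt_of_lt h1 h2).1 this
  linarith

theorem band_unique {k l : ℕ} {x : ℝ} (h1 : -Real.pi < x + k * Real.pi) (h2 : x + k * Real.pi < 0)
    (h3 : -Real.pi < x + l * Real.pi) (h4 : x + l * Real.pi < 0) : k = l := by
  have hpi := Real.pi_pos
  have h5 : (k : ℝ) < l + 1 := by
    by_contra! h
    nlinarith
  have h6 : (l : ℝ) < k + 1 := by
    by_contra! h
    nlinarith
  have h5 : k < l + 1 := by exact_mod_cast h5
  have h6 : l < k + 1 := by exact_mod_cast h6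
  omega

theorem eq_of_entry_eq {p q : Cover} (h : entry p = entry q) (h2 : p.2 = q.2)
    (hd : |p.1 - q.1| < 2 * Real.pi) : p = q := by
  obtain ⟨e1, e2⟩ := re_im_entry p
  obtain ⟨e3, e4⟩ := re_im_entry q
  rw [h, h2] at e1 e2
  have hR := radius_pos q.2
  have hc := mul_left_cancel₀ hR.ne' (e1.symm.trans e3)
  have hs := mul_left_cancel₀ hR.ne' (e2.symm.trans e4)
  have : Real.cos (p.1 - q.1) = 1 := by
    rw [Real.cos_sub, hc, hs, ← pow_two, ← pow_two, Real.cos_sq_add_sin_sq]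
  obtain ⟨h3, h4⟩ := abs_lt.1 hd
  have := (Real.cos_eq_one_iff_of_lt_of_lt h3 h4).1 this
  exact Prod.ext (by linarith) h2

/-- The first coordinate of the endpoint determines its band. Conversely, once the band is fixed,
two points with the same matrix have first coordinates less than 2π apart, so they coincide. -/
theorem curve_eq_iff {r θ α : ℝ} {k : ℕ} {g : Cover} (hr : 0 < r)
    (h1 : -Real.pi < g.1 + k * Real.pi) (h2 : g.1 + k * Real.pi < 0) :
    curve r θ α 1 = g ↔
      Band k (α ^ 2 - r ^ 2) ∧ diag r θ α 1 = entry g ∧ offDiag r θ α 1 = g.2 := by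
  constructor
  · rintro rfl
    refine ⟨?_, (entry_curve r θ α 1).symm, rfl⟩
    rcases band_or_sink_eq_zero (α ^ 2 - r ^ 2) with ⟨l, hl⟩ | ⟨l, -, hκ, hl⟩
    · obtain ⟨h3, h4⟩ := curve_fst_of_band (θ := θ) hr hl
      rwa [band_unique h1 h2 h3 h4]
    · rw [curve_fst_of_eq_mul_pi hr hκ hl] at h1 h2
      have hpi := Real.pi_pos
      have h5 : (k : ℝ) < l := by
        by_contra! h
        nlinarith
      have h6 : (l : ℝ) < k + 1 := by
        by_contra! h
        nlinarith
      have h5 : k < l := by exact_mod_cast h5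
      have h6 : l < k + 1 := by exact_mod_cast h6
      omega
  · rintro ⟨hB, hd, ho⟩
    obtain ⟨h3, h4⟩ := curve_fst_of_band (θ := θ) hr hB
    refine eq_of_entry_eq ((entry_curve r θ α 1).trans hd) ho (abs_lt.2 ⟨?_, ?_⟩) <;> linarith

end SubLorentzSU11

namespace SubLorentzSU11

/-! ### Reduction of the count to two real equations -/

/-- The points of which the regions consist. -/
noncomputable def regionPoint (k : ℕ) (s x₁ x₂ y₂ : ℝ) : Cover :=
  (-(Real.pi * k) + Complex.arg ((x₁ : ℂ) - Complex.I * (√(s ^ 2 + y₂ ^ 2) : ℝ)),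
    x₂ + Complex.I * y₂)

theorem regionPoint_fst_mem {k : ℕ} {s x₁ x₂ y₂ : ℝ} (hs : 0 < s) :
    -Real.pi < (regionPoint k s x₁ x₂ y₂).1 + k * Real.pi ∧
      (regionPoint k s x₁ x₂ y₂).1 + k * Real.pi < 0 := by
  have h : 0 < √(s ^ 2 + y₂ ^ 2) := Real.sqrt_pos.2 (by positivity)
  have h1 := Complex.neg_pi_lt_arg ((x₁ : ℂ) - Complex.I * (√(s ^ 2 + y₂ ^ 2) : ℝ))
  have h2 : Complex.arg ((x₁ : ℂ) - Complex.I * (√(s ^ 2 + y₂ ^ 2) : ℝ)) < 0 :=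
    Complex.arg_neg_iff.2 (by simpa using h)
  simp only [regionPoint]
  constructor <;> linarith

theorem exp_neg_nat_mul_pi_add (k : ℕ) (x : ℝ) :
    Complex.exp ((-(Real.pi * k) + x : ℝ) * Complex.I) =
      (-1) ^ k * Complex.exp (x * Complex.I) := by
  apply Complex.ext
  · rw [Complex.exp_ofReal_mul_I_re, show -(Real.pi * k) + x = x - k * Real.pi by ring,
      Real.cos_sub_nat_mul_pi, ← Complex.exp_ofReal_mul_I_re, ← Complex.re_ofReal_mul]
    push_cast; rfl
  · rw [Complex.exp_ofReal_mul_I_im, show -(Real.pi * k) + x = x - k * Real.pi by ring,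
      Real.sin_sub_nat_mul_pi, ← Complex.exp_ofReal_mul_I_im, ← Complex.im_ofReal_mul]
    push_cast; rfl

theorem entry_regionPoint {k : ℕ} {s x₁ x₂ y₂ : ℝ} (hx : x₂ ^ 2 = x₁ ^ 2 + s ^ 2 - 1) :
    entry (regionPoint k s x₁ x₂ y₂) =
      (-1) ^ k * ((x₁ : ℂ) - Complex.I * (√(s ^ 2 + y₂ ^ 2) : ℝ)) := by
  have hn : radius (x₂ + Complex.I * y₂) =
      ‖(x₁ : ℂ) - Complex.I * (√(s ^ 2 + y₂ ^ 2) : ℝ)‖ := by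
    have h := Real.sq_sqrt (show 0 ≤ s ^ 2 + y₂ ^ 2 by positivity)
    refine (pow_left_inj₀ (radius_pos _).le (norm_nonneg _) two_ne_zero).1 ?_
    rw [radius_sq, ← Complex.normSq_eq_norm_sq, ← Complex.normSq_eq_norm_sq, Complex.normSq_apply,
      Complex.normSq_apply]
    simp
    linear_combination hx - h
  rw [entry, regionPoint, exp_neg_nat_mul_pi_add, hn, mul_left_comm,
    Complex.norm_mul_exp_arg_mul_I]

/-- Pairs of a value `y` of `(-1) ^ k * cosk κ 1` and a value of `α` that satisfy the endpoint
equations. -/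
def solutionSet (k : ℕ) (x₁ x₂ : ℝ) : Set (ℝ × ℝ) :=
  {p | p.1 ∈ bandDomain k ∧
    p.1 * Real.cosh p.2 - p.2 * bandSink k p.1 * Real.sinh p.2 = x₁ ∧
    p.2 * bandSink k p.1 * Real.cosh p.2 - p.1 * Real.sinh p.2 = x₂}

theorem bandSink_eq {k : ℕ} {κ : ℝ} (h : Band k κ) :
    bandSink k ((-1) ^ k * cosk κ 1) = (-1) ^ k * sink κ 1 := by
  rw [bandSink, h.cosk_mem.2]

theorem sq_eq_one_add_bandParam {k : ℕ} {y : ℝ} (hy : y ∈ bandDomain k) :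
    y ^ 2 = 1 + bandParam k y * bandSink k y ^ 2 := by
  have h := cosk_sq (bandParam k y) 1
  have h1 := cosk_bandParam hy
  have hσ := neg_one_pow_mul_self k
  rw [bandSink, mul_pow, pow_two ((-1 : ℝ) ^ k), hσ, one_mul, ← h, ← h1, mul_pow,
    pow_two ((-1 : ℝ) ^ k), hσ, one_mul, h1]

/-- The parameters of the geodesics that end at `g`. -/
def parameterSet (g : Cover) : Set (ℝ × ℝ × ℝ) :=
  {p | 0 < p.1 ∧ curve p.1 p.2.1 p.2.2 1 = g}

theorem encard_geodesicsTo_eq_parameterSet (g : Cover) :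
    (geodesicsTo g).encard = (parameterSet g).encard := by
  have h : geodesicsTo g =
      (fun (p : ℝ × ℝ × ℝ) (t : unitInterval) => curve p.1 p.2.1 p.2.2 t) '' parameterSet g := by
    ext σ
    rw [mem_geodesicsTo_iff]
    constructor
    · rintro ⟨r, θ, α, hr, h1, rfl⟩
      exact ⟨(r, θ, α), ⟨hr, h1⟩, rfl⟩
    · rintro ⟨⟨r, θ, α⟩, ⟨hr, h1⟩, rfl⟩
      exact ⟨r, θ, α, hr, h1, rfl⟩
  rw [h, Set.InjOn.encard_image]
  rintro ⟨r, θ, α⟩ ⟨hr, -⟩ ⟨r', θ', α'⟩ ⟨hr', -⟩ h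
  obtain ⟨rfl, rfl, rfl⟩ := curve_injective hr hr' h
  rfl

/-- The angle θ enters only the last two equations, while the first two depend only on κ and α. This
separation is what makes the count two-dimensional. -/
theorem curve_eq_regionPoint_iff {r θ α : ℝ} {k : ℕ} {s x₁ x₂ y₂ : ℝ} (hr : 0 < r) (hs : 0 < s)
    (hx : x₂ ^ 2 = x₁ ^ 2 + s ^ 2 - 1) :
    curve r θ α 1 = regionPoint k s x₁ x₂ y₂ ↔
      Band k (α ^ 2 - r ^ 2) ∧ ((-1) ^ k * cosk (α ^ 2 - r ^ 2) 1, α) ∈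
          solutionSet k x₁ ((-1) ^ k * x₂) ∧
        (-1) ^ k * sink (α ^ 2 - r ^ 2) 1 * r * Real.cosh (θ + α) = √(s ^ 2 + y₂ ^ 2) ∧
        sink (α ^ 2 - r ^ 2) 1 * r * Real.sinh (θ + α) = y₂ := by
  obtain ⟨h1, h2⟩ := regionPoint_fst_mem (k := k) (x₁ := x₁) (x₂ := x₂) (y₂ := y₂) hs
  rw [curve_eq_iff hr h1 h2, entry_regionPoint hx]
  refine and_congr_right fun hB => ?_
  have hσ := neg_one_pow_mul_self k
  simp only [solutionSet, Set.mem_ofPred_eq, bandSink_eq hB, hB.cosk_mem.1, true_and]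
  have hc : ((-1 : ℂ) ^ k) = (((-1 : ℝ) ^ k : ℝ) : ℂ) := by push_cast; rfl
  rw [hc]
  generalize ((-1 : ℝ) ^ k) = σ at *
  simp only [Complex.ext_iff, Complex.re_ofReal_mul, Complex.im_ofReal_mul, diag, offDiag,
    mul_one, regionPoint]
  simp
  generalize cosk (α ^ 2 - r ^ 2) 1 = C
  generalize sink (α ^ 2 - r ^ 2) 1 = S
  constructor
  · rintro ⟨⟨e1, e2⟩, e3, e4⟩
    refine ⟨⟨?_, ?_⟩, ?_, e4⟩
    · linear_combination σ * e1 + x₁ * hσ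
    · linear_combination σ * e3
    · linear_combination σ * e2 + √(s ^ 2 + y₂ ^ 2) * hσ
  · rintro ⟨⟨e1, e2⟩, e3, e4⟩
    refine ⟨⟨?_, ?_⟩, ?_, e4⟩
    · linear_combination σ * e1 + (α * S * Real.sinh α - C * Real.cosh α) * hσ
    · linear_combination σ * e3 - (S * r * Real.cosh (θ + α)) * hσ
    · linear_combination σ * e2 + (C * Real.sinh α - α * S * Real.cosh α + x₂) * hσ

theorem solutionSet_sq_sub_sq {k : ℕ} {x₁ x₂ : ℝ} {p : ℝ × ℝ} (hp : p ∈ solutionSet k x₁ x₂) :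
    (p.2 * bandSink k p.1) ^ 2 = p.1 ^ 2 - (x₁ ^ 2 - x₂ ^ 2) := by
  obtain ⟨-, rfl, rfl⟩ := hp
  have := Real.cosh_sq p.2
  linear_combination (p.1 ^ 2 - (p.2 * bandSink k p.1) ^ 2) * this

/-- Passing from (r, θ, α) to (y, α) loses nothing: y and α give κ and hence r > 0, and then sinh(θ
+ α) is determined by y₂. -/
theorem encard_parameterSet {k : ℕ} {s x₁ x₂ y₂ : ℝ} (hs : 0 < s)
    (hx : x₂ ^ 2 = x₁ ^ 2 + s ^ 2 - 1) :
    (parameterSet (regionPoint k s x₁ x₂ y₂)).encard =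
      (solutionSet k x₁ ((-1) ^ k * x₂)).encard := by
  have hσ := neg_one_pow_mul_self k
  have h : solutionSet k x₁ ((-1) ^ k * x₂) =
      (fun p : ℝ × ℝ × ℝ => ((-1) ^ k * cosk (p.2.2 ^ 2 - p.1 ^ 2) 1, p.2.2)) ''
        parameterSet (regionPoint k s x₁ x₂ y₂) := by
    ext ⟨y, α⟩
    constructor
    · intro hp
      have hy : y ∈ bandDomain k := hp.1
      have e := solutionSet_sq_sub_sq hp
      have e2 := sq_eq_one_add_bandParam hy
      have hS := bandSink_pos hy
      simp only [mul_pow, ← pow_mul, mul_comm k 2] at e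
      simp only [pow_mul, neg_one_sq, one_pow, one_mul] at e
      -- As s > 0, this makes α² − κ positive, so a positive r exists, and it satisfies r ·
      -- `bandSink k y` = s.
      have e3 : bandSink k y ^ 2 * (α ^ 2 - bandParam k y) = s ^ 2 := by
        linear_combination e + e2 + hx
      have hpos : 0 < α ^ 2 - bandParam k y := by
        by_contra! hcon
        nlinarith [mul_nonneg (sq_nonneg (bandSink k y)) (sub_nonneg.2 hcon), pow_pos hs 2]
      have hr := Real.sqrt_pos.2 hpos
      have hr2 := Real.sq_sqrt hpos.le
      set r := √(α ^ 2 - bandParam k y)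
      have hκ : α ^ 2 - r ^ 2 = bandParam k y := by linarith
      have hsr : bandSink k y * r = s := by
        refine (pow_left_inj₀ (by positivity) hs.le two_ne_zero).1 ?_
        rw [mul_pow, hr2, e3]
      have hc := cosk_bandParam hy
      have hsink : sink (bandParam k y) 1 = (-1) ^ k * bandSink k y := by
        rw [bandSink, ← mul_assoc, hσ, one_mul]
      refine ⟨(r, Real.arsinh ((-1) ^ k * y₂ / s) - α, α), ⟨hr, ?_⟩, by
        simp only [hκ, hc]⟩
      refine (curve_eq_regionPoint_iff hr hs hx).2 ⟨?_, ?_, ?_, ?_⟩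
      · rw [hκ]; exact band_bandParam hy
      · rw [hκ, hc]; exact hp
      · rw [hκ, sub_add_cancel, ← bandSink, hsr, Real.cosh_arsinh, ← Real.sqrt_sq hs.le,
          ← Real.sqrt_mul (by positivity), Real.sqrt_sq hs.le]
        congr 1
        have hs0 := hs.ne'
        field_simp
        rw [← pow_mul, mul_comm k 2, pow_mul, neg_one_sq, one_pow, one_mul]
      · rw [hκ, sub_add_cancel, hsink, mul_assoc ((-1) ^ k), hsr, Real.sinh_arsinh]
        have hs0 := hs.ne'
        field_simp
        rw [← pow_mul, mul_comm k 2, pow_mul, neg_one_sq, one_pow, one_mul]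
    · rintro ⟨⟨r, θ, α'⟩, ⟨hr, hc⟩, h⟩
      obtain ⟨-, h1, -⟩ := (curve_eq_regionPoint_iff hr hs hx).1 hc
      rw [← h]
      exact h1
  rw [h, Set.InjOn.encard_image]
  rintro ⟨r, θ, α⟩ ⟨hr, hc⟩ ⟨r', θ', α'⟩ ⟨hr', hc'⟩ h
  obtain ⟨h1, -, -, h4⟩ := (curve_eq_regionPoint_iff hr hs hx).1 hc
  obtain ⟨h1', -, -, h4'⟩ := (curve_eq_regionPoint_iff hr' hs hx).1 hc'
  simp only [Prod.mk.injEq] at h h1 h1' h4 h4' hr hr'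
  obtain ⟨h, rfl⟩ := h
  have hκ : α ^ 2 - r ^ 2 = α ^ 2 - r' ^ 2 := by
    rw [← h1.cosk_mem.2, h, h1'.cosk_mem.2]
  have hrr : r = r' := (pow_left_inj₀ hr.le hr'.le two_ne_zero).1 (by linarith)
  subst hrr
  have hS : sink (α ^ 2 - r ^ 2) 1 ≠ 0 := fun h0 => by
    have := h1.sink_pos
    rw [h0, mul_zero] at this
    exact lt_irrefl _ this
  have := Real.sinh_injective (mul_left_cancel₀ (mul_ne_zero hS hr.ne') (h4.trans h4'.symm))
  have : θ = θ' := by linarith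
  rw [this]

theorem encard_solutionSet_neg (k : ℕ) (x₁ x₂ : ℝ) :
    (solutionSet k x₁ (-x₂)).encard = (solutionSet k x₁ x₂).encard := by
  have h : solutionSet k x₁ (-x₂) = (fun p : ℝ × ℝ => (p.1, -p.2)) '' solutionSet k x₁ x₂ := by
    ext ⟨y, α⟩
    constructor
    · rintro ⟨h1, h2, h3⟩
      refine ⟨(y, -α), ⟨h1, ?_, ?_⟩, by simp⟩
      · simpa using h2
      · simp only [Real.cosh_neg, Real.sinh_neg]
        linarith
    · rintro ⟨⟨y', α'⟩, ⟨h1, h2, h3⟩, h⟩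
      simp only [Prod.mk.injEq] at h
      obtain ⟨rfl, rfl⟩ := h
      refine ⟨h1, ?_, ?_⟩
      · simpa using h2
      · simp only [Real.cosh_neg, Real.sinh_neg]
        linarith
  rw [h, Set.InjOn.encard_image]
  rintro ⟨y, α⟩ - ⟨y', α'⟩ - h
  simpa using h

theorem encard_geodesicsTo {k : ℕ} {s x₁ x₂ y₂ : ℝ} (hs : 0 < s)
    (hx : x₂ ^ 2 = x₁ ^ 2 + s ^ 2 - 1) :
    (geodesicsTo (regionPoint k s x₁ x₂ y₂)).encard =
      (solutionSet k x₁ √(x₁ ^ 2 + s ^ 2 - 1)).encard := by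
  rw [encard_geodesicsTo_eq_parameterSet, encard_parameterSet hs hx, ← hx, Real.sqrt_sq_eq_abs]
  rcases neg_one_pow_eq_or ℝ k with h | h <;> rcases abs_choice x₂ with h' | h' <;> rw [h, h'] <;>
    simp [encard_solutionSet_neg]

/-- A geodesic ends at a point of a region or on one of the exceptional lines. -/
theorem exists_regionPoint {g : Cover} (hg : (geodesicsTo g).Nonempty) :
    (∃ k, 1 ≤ k ∧ g ∈ XiSet k) ∨ ∃ (k : ℕ) (s x₁ x₂ y₂ : ℝ), 0 < s ∧ x₂ ^ 2 = x₁ ^ 2 + s ^ 2 - 1 ∧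
      g = regionPoint k s x₁ x₂ y₂ := by
  obtain ⟨σ, hσ⟩ := hg
  obtain ⟨r, θ, α, hr, rfl, -⟩ := mem_geodesicsTo_iff.1 hσ
  rcases band_or_sink_eq_zero (α ^ 2 - r ^ 2) with ⟨k, hk⟩ | ⟨k, hk1, hκ, hk⟩
  · right
    obtain ⟨h1, h2⟩ := curve_fst_of_band (θ := θ) hr hk
    have hσ := neg_one_pow_mul_self k
    have hS := hk.sink_pos
    have hx : (offDiag r θ α 1).re ^ 2 = ((-1) ^ k * (diag r θ α 1).re) ^ 2
        + ((-1) ^ k * sink (α ^ 2 - r ^ 2) 1 * r) ^ 2 - 1 := by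
      have e := normSq_diag r θ α 1
      rw [← Complex.normSq_eq_norm_sq, ← Complex.normSq_eq_norm_sq, Complex.normSq_apply,
        Complex.normSq_apply] at e
      simp only [diag, offDiag, mul_one] at e ⊢
      have h3 := Real.cosh_sq (θ + α)
      rw [mul_pow, mul_assoc ((-1) ^ k), mul_pow, ← pow_mul, mul_comm k 2, pow_mul, neg_one_sq,
        one_pow, one_mul, one_mul]
      linear_combination -e + (sink (α ^ 2 - r ^ 2) 1 * r) ^ 2 * h3
    refine ⟨k, (-1) ^ k * sink (α ^ 2 - r ^ 2) 1 * r, (-1) ^ k * (diag r θ α 1).re,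
      (offDiag r θ α 1).re, (offDiag r θ α 1).im, by positivity, hx, ?_⟩
    obtain ⟨h3, h4⟩ := regionPoint_fst_mem (k := k)
      (s := (-1) ^ k * sink (α ^ 2 - r ^ 2) 1 * r) (x₁ := (-1) ^ k * (diag r θ α 1).re)
      (x₂ := (offDiag r θ α 1).re) (y₂ := (offDiag r θ α 1).im) (by positivity)
    refine eq_of_entry_eq ?_ ?_ (abs_lt.2 ⟨by linarith, by linarith⟩)
    · rw [entry_curve, entry_regionPoint hx]
      have hp : √(((-1) ^ k * sink (α ^ 2 - r ^ 2) 1 * r) ^ 2 + (offDiag r θ α 1).im ^ 2) =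
          -((-1) ^ k * (diag r θ α 1).im) := by
        have h5 := Real.cosh_sq (θ + α)
        have h6 := Real.cosh_pos (θ + α)
        have : 0 ≤ -((-1) ^ k * (diag r θ α 1).im) := by
          simp only [diag, mul_one]
          rw [mul_neg, neg_neg, ← mul_assoc, ← mul_assoc]
          positivity
        rw [← Real.sqrt_sq this]
        congr 1
        simp only [offDiag, diag, mul_one]
        rw [mul_neg, neg_neg, mul_assoc ((-1) ^ k), mul_pow, mul_pow ((-1) ^ k), ← pow_mul,
          mul_comm k 2, pow_mul, neg_one_sq, one_pow, one_mul, one_mul]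
        linear_combination (-(sink (α ^ 2 - r ^ 2) 1 * r) ^ 2) * h5
      rw [hp]
      have hc : ((-1 : ℂ) ^ k) * (-1) ^ k = 1 := by exact_mod_cast congrArg Complex.ofReal hσ
      have := Complex.re_add_im (diag r θ α 1)
      push_cast
      linear_combination -this - (diag r θ α 1).re * hc - Complex.I * (diag r θ α 1).im * hc
    · simp only [curve, regionPoint]
      rw [mul_comm Complex.I, Complex.re_add_im]
  · left
    refine ⟨k, hk1, curve_fst_of_eq_mul_pi hr hκ hk, ?_⟩
    simp only [curve, offDiag]
    rw [sink, if_pos hκ, mul_one, hk, Real.sin_nat_mul_pi]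
    simp

/-! ### The exceptional lines -/

/-- At κ = −(kπ)² the function `sink` vanishes at time 1, so the endpoint does not depend on θ,
although the geodesics for different θ differ. -/
theorem not_countable_geodesicsTo {k : ℕ} (hk : 1 ≤ k) {g : Cover} (hg : g ∈ XiSet k) :
    ¬ (geodesicsTo g).Countable := by
  obtain ⟨h1, h2⟩ := hg
  have hσ := neg_one_pow_mul_self k
  have hkpi : 0 < k * Real.pi := mul_pos (by exact_mod_cast hk) Real.pi_pos
  -- With `sink` gone, the off-diagonal entry at time 1 is −(−1)^k sinh α, and any real value can be
  -- matched.
  obtain ⟨α, hα⟩ : ∃ α, Real.sinh α = -((-1) ^ k * g.2.re) := Real.sinh_surjective _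
  set r := √(α ^ 2 + (k * Real.pi) ^ 2)
  have hr : 0 < r := Real.sqrt_pos.2 (by positivity)
  have hr2 : r ^ 2 = α ^ 2 + (k * Real.pi) ^ 2 := Real.sq_sqrt (by positivity)
  have hκ : α ^ 2 - r ^ 2 < 0 := by rw [hr2]; nlinarith
  have hν : √(-(α ^ 2 - r ^ 2)) = k * Real.pi := by
    rw [hr2, show -(α ^ 2 - (α ^ 2 + (k * Real.pi) ^ 2)) = (k * Real.pi) ^ 2 by ring,
      Real.sqrt_sq hkpi.le]
  have hend (θ : ℝ) : curve r θ α 1 = g := by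
    refine Prod.ext ((curve_fst_of_eq_mul_pi hr hκ hν).trans h1.symm) ?_
    simp only [curve, offDiag]
    rw [sink, cosk, if_pos hκ, if_pos hκ, mul_one, hν, Real.sin_nat_mul_pi, Real.cos_nat_mul_pi,
      mul_one, hα]
    refine Complex.ext ?_ ?_
    · simp only
      linear_combination g.2.re * hσ
    · simp [h2]
  intro hc
  have hinj : Function.Injective fun (θ : ℝ) (t : unitInterval) => curve r θ α t :=
    fun θ θ' h => (curve_injective hr hr h).2.1
  have hsub : Set.range (fun (θ : ℝ) (t : unitInterval) => curve r θ α t) ⊆ geodesicsTo g := by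
    rintro _ ⟨θ, rfl⟩
    exact mem_geodesicsTo_iff.2 ⟨r, θ, α, hr, hend θ, rfl⟩
  have := (hc.mono hsub).preimage_of_injOn hinj.injOn
  rw [Set.preimage_range] at this
  exact Set.not_countable_univ this

end SubLorentzSU11

namespace SubLorentzSU11

open Filter Topology

/-! ### The null coordinates along a band -/

/-- The absolute value of `α * bandSink k y` for solutions of the endpoint equations. -/
noncomputable def eps (s y : ℝ) : ℝ := √(y ^ 2 + s ^ 2 - 1)

/-- The absolute value of `α` for solutions of the endpoint equations. -/
noncomputable def amp (k : ℕ) (s y : ℝ) : ℝ := eps s y / bandSink k y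

/-- The null coordinate `x₁ + x₂` of the solutions with `α ≥ 0`. -/
noncomputable def nullP (k : ℕ) (s y : ℝ) : ℝ := Real.exp (-amp k s y) * (y + eps s y)

/-- The null coordinate `x₁ - x₂` of the solutions with `α ≥ 0`. -/
noncomputable def nullQ (k : ℕ) (s y : ℝ) : ℝ := Real.exp (amp k s y) * (y - eps s y)

/-- The derivative of `bandSink`. -/
noncomputable def bandSinkDeriv (k : ℕ) (y : ℝ) : ℝ :=
  (bandSink k y - y) * bandSink k y / (1 - y ^ 2)

theorem arccos_add_pos {k : ℕ} {y : ℝ} (h : y < 1) : 0 < Real.arccos y + k * Real.pi := by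
  have := Real.arccos_pos.2 h
  have := Real.pi_pos
  positivity

theorem hasDerivAt_sqrt_one_sub_sq {y : ℝ} (h : -1 < y) (h1 : y < 1) :
    HasDerivAt (fun y => √(1 - y ^ 2)) (-y / √(1 - y ^ 2)) y := by
  have : 0 < 1 - y ^ 2 := by nlinarith
  refine (((hasDerivAt_id' y).pow 2).const_sub 1 |>.sqrt this.ne').congr_deriv ?_
  have := Real.sqrt_pos.2 this
  simp only [Nat.cast_ofNat, Nat.add_one_sub_one, pow_one, mul_one, Pi.pow_apply]
  field_simp

theorem hasDerivAt_bandSink_of_lt_one {k : ℕ} {y : ℝ} (h : -1 < y) (h1 : y < 1) :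
    HasDerivAt (bandSink k) (bandSinkDeriv k y) y := by
  have hn := arccos_add_pos (k := k) h1
  have hpos : 0 < 1 - y ^ 2 := by nlinarith
  have hs := Real.sqrt_pos.2 hpos
  have hs2 := Real.sq_sqrt hpos.le
  have he : bandSink k =ᶠ[𝓝 y] fun y => √(1 - y ^ 2) / (Real.arccos y + k * Real.pi) := by
    filter_upwards [Iio_mem_nhds h1] with z hz using bandSink_of_lt_one hz
  refine HasDerivAt.congr_of_eventuallyEq ?_ he
  refine ((hasDerivAt_sqrt_one_sub_sq h h1).div
    ((Real.hasDerivAt_arccos h.ne' h1.ne).add_const (k * Real.pi)) hn.ne').congr_deriv ?_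
  rw [bandSinkDeriv, bandSink_of_lt_one h1]
  generalize √(1 - y ^ 2) = S at *
  rw [← hs2]
  field_simp
  ring

theorem hasDerivAt_sqrt_sq_sub_one {y : ℝ} (h : 1 < y) :
    HasDerivAt (fun y => √(y ^ 2 - 1)) (y / √(y ^ 2 - 1)) y := by
  have : 0 < y ^ 2 - 1 := by nlinarith
  refine (((hasDerivAt_id' y).pow 2).sub_const 1 |>.sqrt this.ne').congr_deriv ?_
  have := Real.sqrt_pos.2 this
  simp only [Nat.cast_ofNat, Nat.add_one_sub_one, pow_one, mul_one, Pi.pow_apply]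
  field_simp

theorem hasDerivAt_bandSink_of_one_lt {y : ℝ} (h : 1 < y) :
    HasDerivAt (bandSink 0) (bandSinkDeriv 0 y) y := by
  have hn := Real.arcosh_pos h
  have hpos : 0 < y ^ 2 - 1 := by nlinarith
  have hs := Real.sqrt_pos.2 hpos
  have hs2 := Real.sq_sqrt hpos.le
  have he : bandSink 0 =ᶠ[𝓝 y] fun y => √(y ^ 2 - 1) / Real.arcosh y := by
    filter_upwards [Ioi_mem_nhds h] with z hz using bandSink_of_one_lt hz
  refine HasDerivAt.congr_of_eventuallyEq ?_ he
  refine ((hasDerivAt_sqrt_sq_sub_one h).div (Real.hasDerivAt_arcosh h) hn.ne').congr_deriv ?_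
  rw [bandSinkDeriv, bandSink_of_one_lt h, show 1 - y ^ 2 = -(√(y ^ 2 - 1) ^ 2) by rw [hs2]; ring]
  field_simp
  ring

/-- Here κ = 0 and the trigonometric formula changes into the hyperbolic one: sinc of `arccos` on
the left, the difference quotient of sinh at `arcosh` on the right. Continuity suffices at this
point, because monotonicity is proved on the two sides and glued. -/
theorem continuousAt_bandSink_one : ContinuousAt (bandSink 0) 1 := by
  have hd : Continuous (dslope Real.sinh 0) := by
    refine continuous_iff_continuousAt.2 fun x => ?_
    rcases eq_or_ne x 0 with rfl | hx
    · exact continuousAt_dslope_same.2 Real.differentiable_sinh.differentiableAt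
    · exact (continuousAt_dslope_of_ne hx).2 Real.continuous_sinh.continuousAt
  rw [continuousAt_iff_continuous_left_right]
  constructor
  · have h : ContinuousWithinAt (fun y => Real.sinc (Real.arccos y)) (Set.Iic 1) 1 :=
      (Real.continuous_sinc.comp Real.continuous_arccos).continuousWithinAt
    have he (y : ℝ) (hy : y ≤ 1) : bandSink 0 y = Real.sinc (Real.arccos y) := by
      rcases hy.lt_or_eq with hy | rfl
      · rw [bandSink_of_lt_one hy, Real.sinc_of_ne_zero (Real.arccos_pos.2 hy).ne',
          Real.sin_arccos]
        simp
      · simp [bandSink_one]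
    exact h.congr he (he 1 le_rfl)
  · have h : ContinuousWithinAt (fun y => dslope Real.sinh 0 (Real.arcosh y)) (Set.Ici 1) 1 :=
      hd.continuousAt.comp_continuousWithinAt (Real.continuousOn_arcosh 1 Set.self_mem_Ici)
    have he (y : ℝ) (hy : 1 ≤ y) : bandSink 0 y = dslope Real.sinh 0 (Real.arcosh y) := by
      rcases hy.lt_or_eq with hy | rfl
      · rw [bandSink_of_one_lt hy, dslope_of_ne _ (Real.arcosh_pos hy).ne', slope_def_field,
          Real.sinh_arcosh hy.le]
        simp
      · rw [bandSink_one, (Real.arcosh_eq_zero_iff le_rfl).2 rfl, dslope_same, Real.deriv_sinh,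
          Real.cosh_zero]
    exact h.congr he (he 1 le_rfl)

theorem continuousAt_bandSink {k : ℕ} {y : ℝ} (hy : y ∈ bandDomain k) :
    ContinuousAt (bandSink k) y := by
  obtain ⟨h, h1⟩ := hy
  rcases lt_trichotomy y 1 with h2 | rfl | h2
  · exact (hasDerivAt_bandSink_of_lt_one h h2).continuousAt
  · obtain rfl : k = 0 := h1.resolve_right (lt_irrefl _)
    exact continuousAt_bandSink_one
  · obtain rfl : k = 0 := h1.resolve_right h2.not_gt
    exact (hasDerivAt_bandSink_of_one_lt h2).continuousAt

theorem continuous_eps (s : ℝ) : Continuous (eps s) := by unfold eps; fun_prop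

theorem continuousAt_amp {k : ℕ} {s y : ℝ} (hy : y ∈ bandDomain k) : ContinuousAt (amp k s) y :=
  (continuous_eps s).continuousAt.div (continuousAt_bandSink hy) (bandSink_pos hy).ne'

theorem continuousAt_nullP {k : ℕ} {s y : ℝ} (hy : y ∈ bandDomain k) :
    ContinuousAt (nullP k s) y :=
  (continuousAt_amp hy).neg.rexp.mul (continuousAt_id.add (continuous_eps s).continuousAt)

theorem continuousAt_nullQ {k : ℕ} {s y : ℝ} (hy : y ∈ bandDomain k) :
    ContinuousAt (nullQ k s) y :=
  (continuousAt_amp hy).rexp.mul (continuousAt_id.sub (continuous_eps s).continuousAt)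

theorem eps_sq {s y : ℝ} (h : 1 - s ^ 2 ≤ y ^ 2) : eps s y ^ 2 = y ^ 2 + s ^ 2 - 1 :=
  Real.sq_sqrt (by linarith)

theorem eps_nonneg (s y : ℝ) : 0 ≤ eps s y := Real.sqrt_nonneg _

theorem eps_pos {s y : ℝ} (h : 1 - s ^ 2 < y ^ 2) : 0 < eps s y := Real.sqrt_pos.2 (by linarith)

theorem nullP_mul_nullQ {k : ℕ} {s y : ℝ} (h : 1 - s ^ 2 ≤ y ^ 2) :
    nullP k s y * nullQ k s y = 1 - s ^ 2 := by
  have h1 : Real.exp (-amp k s y) * Real.exp (amp k s y) = 1 := by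
    rw [← Real.exp_add]; simp
  rw [nullP, nullQ]
  linear_combination (y + eps s y) * (y - eps s y) * h1 - eps_sq h

theorem amp_nonneg {k : ℕ} {s y : ℝ} (hy : y ∈ bandDomain k) : 0 ≤ amp k s y :=
  div_nonneg (eps_nonneg s y) (bandSink_pos hy).le

/-- The relations ε² = y² + s² − 1 and (1 − y²)Φ' = (Φ − y)Φ collapse the logarithmic derivative to
s²Φ'/(εΦ²). Where `nullP` is positive, its monotonicity is therefore that of Φ = `bandSink k`,
whatever s is. -/
theorem hasDerivAt_nullP {k : ℕ} {s y : ℝ} (hy : y ∈ bandDomain k) (hy1 : y ≠ 1)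
    (h : 1 - s ^ 2 < y ^ 2) : HasDerivAt (nullP k s)
      (nullP k s y * (s ^ 2 * bandSinkDeriv k y / (eps s y * bandSink k y ^ 2))) y := by
  have hΦ := bandSink_pos hy
  have hε := eps_pos h
  have hε2 := eps_sq h.le
  have hd : HasDerivAt (bandSink k) (bandSinkDeriv k y) y := by
    rcases lt_or_gt_of_ne hy1 with h1 | h1
    · exact hasDerivAt_bandSink_of_lt_one hy.1 h1
    · obtain rfl : k = 0 := hy.2.resolve_right h1.not_gt
      exact hasDerivAt_bandSink_of_one_lt h1
  have hde : HasDerivAt (eps s) (y / eps s y) y := by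
    have := (((hasDerivAt_id' y).pow 2).add_const (s ^ 2)).sub_const 1 |>.sqrt
      (show y ^ 2 + s ^ 2 - 1 ≠ 0 by linarith)
    refine this.congr_deriv ?_
    have hε' : 0 < √(y ^ 2 + s ^ 2 - 1) := hε
    simp only [Nat.cast_ofNat, Nat.add_one_sub_one, pow_one, mul_one, Pi.pow_apply]
    change _ = y / √(y ^ 2 + s ^ 2 - 1)
    field_simp
  have hamp := hde.div hd hΦ.ne'
  have hy2 : 1 - y ^ 2 ≠ 0 := by
    intro h0
    have : (y - 1) * (y + 1) = 0 := by linarith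
    rcases mul_eq_zero.1 this with h | h
    · exact hy1 (by linarith)
    · linarith [hy.1]
  have hode : (1 - y ^ 2) * bandSinkDeriv k y = (bandSink k y - y) * bandSink k y := by
    rw [bandSinkDeriv]; field_simp
  refine (hamp.neg.exp.mul ((hasDerivAt_id' y).add hde)).congr_deriv ?_
  have key : -((y / eps s y * bandSink k y - eps s y * bandSinkDeriv k y) / bandSink k y ^ 2)
      * (y + eps s y) + (1 + y / eps s y) =
      (y + eps s y) * (s ^ 2 * bandSinkDeriv k y / (eps s y * bandSink k y ^ 2)) := by
    field_simp
    linear_combination (y + eps s y) * (bandSinkDeriv k y * hε2 - hode)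
  simp only [nullP, amp, Pi.neg_apply, Pi.div_apply, Pi.add_apply]
  linear_combination Real.exp (-(eps s y / bandSink k y)) * key

/-! ### Signs -/

/-- The points `cos μ_k` where `bandSink k y = y`, for `k ≥ 1`. -/
noncomputable def ystar (k : ℕ) : ℝ := √(1 - omega k ^ 2)

/-- This is Φ − y multiplied by the positive number `arccos y + kπ`, and its derivative is minus
that number. So Φ − y changes sign at most once. -/
theorem strictAntiOn_aux (k : ℕ) : StrictAntiOn
    (fun y => √(1 - y ^ 2) - (Real.arccos y + k * Real.pi) * y) (Set.Icc (-1) 1) := by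
  refine strictAntiOn_of_deriv_neg (convex_Icc _ _) ?_ fun y hy => ?_
  · have := Real.continuous_arccos
    exact Continuous.continuousOn (by fun_prop)
  · rw [interior_Icc] at hy
    have hs : 0 < √(1 - y ^ 2) := Real.sqrt_pos.2 (by nlinarith [hy.1, hy.2])
    have := (hasDerivAt_sqrt_one_sub_sq hy.1 hy.2).sub
      (((Real.hasDerivAt_arccos hy.1.ne' hy.2.ne).add_const (k * Real.pi)).mul (hasDerivAt_id' y))
    refine lt_of_eq_of_lt (HasDerivAt.deriv this) ?_
    have hn := arccos_add_pos (k := k) hy.2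
    have e : -y / √(1 - y ^ 2) - (-(1 / √(1 - y ^ 2)) * y + (Real.arccos y + k * Real.pi) * 1)
        = -(Real.arccos y + k * Real.pi) := by
      field_simp
      ring
    rw [e]
    linarith

theorem omega_lt_one {k : ℕ} (hk : 1 ≤ k) : omega k < 1 := (omega_spec k hk).1.2

theorem omega_pos {k : ℕ} (hk : 1 ≤ k) : 0 < omega k := (omega_spec k hk).1.1

theorem ystar_pos {k : ℕ} (hk : 1 ≤ k) : 0 < ystar k :=
  Real.sqrt_pos.2 (by nlinarith [omega_pos hk, omega_lt_one hk])

theorem ystar_sq {k : ℕ} (hk : 1 ≤ k) : ystar k ^ 2 = 1 - omega k ^ 2 :=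
  Real.sq_sqrt (by nlinarith [omega_pos hk, omega_lt_one hk])

theorem ystar_lt_one {k : ℕ} (hk : 1 ≤ k) : ystar k < 1 := by
  have := ystar_sq hk
  have := omega_pos hk
  nlinarith [ystar_pos hk]

/-- With y = √(1 − ω²) one has `arcsin ω = arccos y`, and the equation defining ω_k becomes Φ(y) = y
after clearing denominators. -/
theorem ystar_aux {k : ℕ} (hk : 1 ≤ k) :
    √(1 - ystar k ^ 2) - (Real.arccos (ystar k) + k * Real.pi) * ystar k = 0 := by
  have h := (omega_spec k hk).2
  have hy := ystar_pos hk
  rw [Real.arcsin_eq_arccos (omega_pos hk).le, ← ystar] at h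
  rw [ystar_sq hk, sub_sub_cancel, Real.sqrt_sq (omega_pos hk).le]
  field_simp at h
  linarith

theorem sub_bandSink_sign {k : ℕ} {y : ℝ} (h1 : y < 1) :
    (bandSink k y - y) * (Real.arccos y + k * Real.pi) =
      √(1 - y ^ 2) - (Real.arccos y + k * Real.pi) * y := by
  have hn := arccos_add_pos (k := k) h1
  rw [bandSink_of_lt_one h1]
  field_simp

theorem bandSinkDeriv_pos_of_lt_ystar {k : ℕ} (hk : 1 ≤ k) {y : ℝ} (h : -1 < y)
    (h1 : y < ystar k) : 0 < bandSinkDeriv k y := by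
  have hlt := h1.trans (ystar_lt_one hk)
  have hn := arccos_add_pos (k := k) hlt
  have h2 := strictAntiOn_aux k ⟨h.le, hlt.le⟩
    ⟨by linarith [ystar_pos hk], (ystar_lt_one hk).le⟩ h1
  beta_reduce at h2
  rw [ystar_aux hk, ← sub_bandSink_sign hlt] at h2
  have := (pos_iff_pos_of_mul_pos h2).2 hn
  have := bandSink_pos (k := k) ⟨h, Or.inr hlt⟩
  exact div_pos (by positivity) (by nlinarith)

theorem bandSinkDeriv_neg_of_ystar_lt {k : ℕ} (hk : 1 ≤ k) {y : ℝ} (h : y < 1)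
    (h1 : ystar k < y) : bandSinkDeriv k y < 0 := by
  have hn := arccos_add_pos (k := k) h
  have h0 := ystar_pos hk
  have h2 := strictAntiOn_aux k ⟨by linarith, (ystar_lt_one hk).le⟩ ⟨by linarith, h.le⟩ h1
  beta_reduce at h2
  rw [ystar_aux hk, ← sub_bandSink_sign h] at h2
  have := (neg_iff_pos_of_mul_neg h2).2 hn
  have := bandSink_pos (k := k) (y := y) ⟨by linarith, Or.inr h⟩
  exact div_neg_of_neg_of_pos (by nlinarith) (by nlinarith)

theorem bandSink_ystar {k : ℕ} (hk : 1 ≤ k) : bandSink k (ystar k) = ystar k := by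
  have h := sub_bandSink_sign (k := k) (ystar_lt_one hk)
  rw [ystar_aux hk] at h
  have := (mul_eq_zero.1 h).resolve_right (arccos_add_pos (ystar_lt_one hk)).ne'
  linarith

/-- Both Φ − y and 1 − y² change sign at y = 1, so their quotient stays positive. To the right of 1
the sign of Φ − y follows from the growth of y `arcosh y` − √(y² − 1), whose derivative is `arcosh
y`. -/
theorem bandSinkDeriv_zero_pos {y : ℝ} (h : -1 < y) (h1 : y ≠ 1) : 0 < bandSinkDeriv 0 y := by
  have hΦ := bandSink_pos (k := 0) (y := y) ⟨h, Or.inl rfl⟩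
  rcases lt_or_gt_of_ne h1 with h1 | h1
  · have hn := arccos_add_pos (k := 0) h1
    have h2 := strictAntiOn_aux 0 ⟨h.le, h1.le⟩ ⟨by linarith, le_rfl⟩ h1
    beta_reduce at h2
    rw [← sub_bandSink_sign h1] at h2
    simp only [one_pow, sub_self, Real.sqrt_zero, Real.arccos_one, Nat.cast_zero, zero_mul,
      add_zero, mul_one] at h2
    rw [Nat.cast_zero, zero_mul, add_zero] at hn
    have := (pos_iff_pos_of_mul_pos h2).2 hn
    exact div_pos (by positivity) (by nlinarith)
  · have ha := Real.arcosh_pos h1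
    have hmono : StrictMonoOn (fun y => y * Real.arcosh y - √(y ^ 2 - 1)) (Set.Ici 1) := by
      refine strictMonoOn_of_deriv_pos (convex_Ici _) ?_ fun z hz => ?_
      · exact (continuousOn_id.mul Real.continuousOn_arcosh).sub
          (Continuous.continuousOn (by fun_prop))
      · rw [interior_Ici] at hz
        have := ((hasDerivAt_id' z).mul (Real.hasDerivAt_arcosh hz)).sub
          (hasDerivAt_sqrt_sq_sub_one hz)
        refine lt_of_lt_of_eq ?_ (HasDerivAt.deriv this).symm
        have := Real.arcosh_pos hz
        rw [div_eq_mul_inv]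
        linarith
    have h2 := hmono Set.self_mem_Ici h1.le h1
    simp only [one_pow, sub_self, Real.sqrt_zero, (Real.arcosh_eq_zero_iff le_rfl).2 rfl,
      mul_zero] at h2
    have : bandSink 0 y < y := by
      rw [bandSink_of_one_lt h1, div_lt_iff₀ ha]
      linarith
    exact div_pos_of_neg_of_neg (by nlinarith) (by nlinarith)

end SubLorentzSU11

namespace SubLorentzSU11

open Filter Topology

/-! ### Limits at the ends of the bands -/

theorem eps_one {s : ℝ} (hs : 0 < s) : eps s 1 = s ∧ eps s (-1) = s := by
  constructor <;> simp [eps, Real.sqrt_sq hs.le]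

theorem tendsto_bandSink_one {k : ℕ} (hk : 1 ≤ k) :
    Tendsto (bandSink k) (𝓝[<] 1) (𝓝[>] 0) := by
  have hkpi : 0 < (k : ℝ) * Real.pi := mul_pos (by exact_mod_cast hk) Real.pi_pos
  refine tendsto_nhdsWithin_iff.2 ⟨?_, ?_⟩
  · have h : ContinuousAt (fun y => √(1 - y ^ 2) / (Real.arccos y + k * Real.pi)) 1 := by
      have := Real.continuous_arccos
      refine ContinuousAt.div ?_ ?_ (by simpa using hkpi.ne') <;>
        exact Continuous.continuousAt (by fun_prop)
    have h' := h.tendsto.mono_left (nhdsWithin_le_nhds (s := Set.Iio 1))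
    simp only [one_pow, sub_self, Real.sqrt_zero, zero_div] at h'
    refine h'.congr' ?_
    filter_upwards [self_mem_nhdsWithin] with y hy using (bandSink_of_lt_one hy).symm
  · filter_upwards [Ioo_mem_nhdsLT (show (-1 : ℝ) < 1 by norm_num)] with y hy
    exact bandSink_pos ⟨hy.1, Or.inr hy.2⟩

theorem tendsto_bandSink_neg_one (k : ℕ) : Tendsto (bandSink k) (𝓝[>] (-1)) (𝓝[>] 0) := by
  refine tendsto_nhdsWithin_iff.2 ⟨?_, ?_⟩
  · have h : ContinuousAt (fun y => √(1 - y ^ 2) / (Real.arccos y + k * Real.pi)) (-1) := by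
      have := Real.continuous_arccos
      refine ContinuousAt.div ?_ ?_ (arccos_add_pos (by norm_num)).ne' <;>
        exact Continuous.continuousAt (by fun_prop)
    have h' := h.tendsto.mono_left (nhdsWithin_le_nhds (s := Set.Ioi (-1)))
    simp only [neg_sq, one_pow, sub_self, Real.sqrt_zero, zero_div] at h'
    refine h'.congr' ?_
    filter_upwards [Ioo_mem_nhdsGT (show (-1 : ℝ) < 1 by norm_num)] with y hy
      using (bandSink_of_lt_one hy.2).symm
  · filter_upwards [Ioo_mem_nhdsGT (show (-1 : ℝ) < 1 by norm_num)] with y hy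
    exact bandSink_pos ⟨hy.1, Or.inr hy.2⟩

theorem tendsto_amp {k : ℕ} {s z : ℝ} {l : Filter ℝ} (hs : 0 < s) (hl : l ≤ 𝓝 z)
    (hz : eps s z = s) (h : Tendsto (bandSink k) l (𝓝[>] 0)) : Tendsto (amp k s) l atTop := by
  have h1 : Tendsto (eps s) l (𝓝 s) := by
    have := ((continuous_eps s).tendsto z).mono_left hl
    rwa [hz] at this
  have h2 : Tendsto (fun y => (bandSink k y)⁻¹) l atTop := h.inv_tendsto_nhdsGT_zero
  exact (h1.pos_mul_atTop hs h2).congr fun y => (div_eq_mul_inv _ _).symm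

theorem tendsto_nullP {k : ℕ} {s z : ℝ} {l : Filter ℝ} (hs : 0 < s) (hl : l ≤ 𝓝 z)
    (hz : eps s z = s) (h : Tendsto (bandSink k) l (𝓝[>] 0)) :
    Tendsto (nullP k s) l (𝓝 0) := by
  have h1 : Tendsto (fun y => y + eps s y) l (𝓝 (z + eps s z)) :=
    ((continuous_id.add (continuous_eps s)).tendsto z).mono_left hl
  have h2 : Tendsto (fun y => Real.exp (-amp k s y)) l (𝓝 0) :=
    Real.tendsto_exp_neg_atTop_nhds_zero.comp (tendsto_amp hs hl hz h)
  have := h2.mul h1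
  rwa [zero_mul] at this

theorem tendsto_nullQ_neg_one (k : ℕ) {s : ℝ} (hs : 0 < s) :
    Tendsto (nullQ k s) (𝓝[>] (-1)) atBot := by
  have h1 : Tendsto (fun y => y - eps s y) (𝓝[>] (-1)) (𝓝 (-1 - eps s (-1))) :=
    ((continuous_id.sub (continuous_eps s)).tendsto (-1)).mono_left nhdsWithin_le_nhds
  have h2 : Tendsto (fun y => Real.exp (amp k s y)) (𝓝[>] (-1)) atTop :=
    Real.tendsto_exp_atTop.comp
      (tendsto_amp hs nhdsWithin_le_nhds (eps_one hs).2 (tendsto_bandSink_neg_one k))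
  exact h2.atTop_mul_neg (by rw [(eps_one hs).2]; linarith) h1

theorem tendsto_sinh_atTop : Tendsto Real.sinh atTop atTop :=
  tendsto_atTop_mono' _ ((eventually_ge_atTop 0).mono fun _ h => Real.self_le_sinh_iff.2 h) tendsto_id

theorem tendsto_cosh_atTop : Tendsto Real.cosh atTop atTop :=
  tendsto_atTop_mono (fun a => (Real.sinh_lt_cosh a).le) tendsto_sinh_atTop

/-- For y = cosh a with a > 0, ε = q sinh a and the amplitude is a q, where q = √(1 + s²/sinh² a).
If q were 1 the value would be e^{−a}(cosh a + sinh a) = 1, so it remains to control the error in q.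
-/
theorem tendsto_nullP_cosh (s : ℝ) :
    Tendsto (fun a => nullP 0 s (Real.cosh a)) atTop (𝓝 1) := by
  set q : ℝ → ℝ := fun a => √(1 + s ^ 2 / Real.sinh a ^ 2) with hq
  have hsinh : Tendsto Real.sinh atTop atTop := tendsto_sinh_atTop
  have hinv : Tendsto (fun a => (Real.sinh a)⁻¹) atTop (𝓝 0) := tendsto_inv_atTop_zero.comp hsinh
  have hq1 : Tendsto q atTop (𝓝 1) := by
    have h : Tendsto (fun a => √(1 + s ^ 2 * (Real.sinh a)⁻¹ ^ 2)) atTop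
        (𝓝 √(1 + s ^ 2 * 0 ^ 2)) := ((hinv.pow 2).const_mul (s ^ 2) |>.const_add 1).sqrt
    simp only [ne_eq, OfNat.ofNat_ne_zero, not_false_eq_true, zero_pow, mul_zero, add_zero,
      Real.sqrt_one] at h
    refine h.congr fun a => ?_
    rw [hq, inv_pow, ← div_eq_mul_inv]
  -- Convergence q → 1 alone is not enough in the exponent. The bound q − 1 ≤ s²/(2 sinh² a)
  -- together with a ≤ sinh a also absorbs the factor a.
  have hq0 : Tendsto (fun a => a * (q a - 1)) atTop (𝓝 0) := by
    have hb : Tendsto (fun a => s ^ 2 / 2 * (Real.sinh a)⁻¹) atTop (𝓝 0) := by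
      simpa using hinv.const_mul (s ^ 2 / 2)
    refine tendsto_of_tendsto_of_tendsto_of_le_of_le' tendsto_const_nhds hb ?_ ?_
    · filter_upwards [eventually_gt_atTop 0] with a ha
      have : 1 ≤ q a := Real.one_le_sqrt.2 (by simp; positivity)
      exact mul_nonneg ha.le (by linarith)
    · filter_upwards [eventually_gt_atTop 0] with a ha
      have h1 : 0 < Real.sinh a := Real.sinh_pos_iff.2 ha
      have h2 : a ≤ Real.sinh a := Real.self_le_sinh_iff.2 ha.le
      have h3 : q a - 1 ≤ s ^ 2 / 2 / Real.sinh a ^ 2 := by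
        have : q a ≤ 1 + s ^ 2 / Real.sinh a ^ 2 / 2 :=
          Real.sqrt_one_add_le (by have : 0 ≤ s ^ 2 / Real.sinh a ^ 2 := by positivity
                                   linarith)
        rw [div_right_comm]; linarith
      have h4 : 0 ≤ s ^ 2 / 2 / Real.sinh a ^ 2 := by positivity
      calc a * (q a - 1) ≤ a * (s ^ 2 / 2 / Real.sinh a ^ 2) := by gcongr
        _ ≤ Real.sinh a * (s ^ 2 / 2 / Real.sinh a ^ 2) := by gcongr
        _ = s ^ 2 / 2 * (Real.sinh a)⁻¹ := by field_simp
  have he : Tendsto (fun a => Real.exp (-a) * Real.exp (-a)) atTop (𝓝 0) := by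
    simpa using Real.tendsto_exp_neg_atTop_nhds_zero.mul Real.tendsto_exp_neg_atTop_nhds_zero
  have hlim : Tendsto (fun a => Real.exp (-(a * (q a - 1))) *
      ((1 + Real.exp (-a) * Real.exp (-a)) / 2 + q a * ((1 - Real.exp (-a) * Real.exp (-a)) / 2)))
      atTop (𝓝 (Real.exp (-0) * ((1 + 0) / 2 + 1 * ((1 - 0) / 2)))) :=
    ((Real.continuous_exp.tendsto _).comp hq0.neg).mul
      (((he.const_add 1).div_const 2).add (hq1.mul ((he.const_sub 1).div_const 2)))
  have e1 : Real.exp (-0) * ((1 + 0) / 2 + 1 * ((1 - 0) / 2)) = 1 := by norm_num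
  rw [e1] at hlim
  refine hlim.congr' ?_
  filter_upwards [eventually_gt_atTop 0] with a ha
  have h1 : 0 < Real.sinh a := Real.sinh_pos_iff.2 ha
  have hc : 1 < Real.cosh a := Real.one_lt_cosh.2 ha.ne'
  have hc2 := Real.cosh_sq a
  have heps : eps s (Real.cosh a) = Real.sinh a * q a := by
    have : Real.sinh a * q a = √(Real.sinh a ^ 2 * (1 + s ^ 2 / Real.sinh a ^ 2)) := by
      rw [Real.sqrt_mul (by positivity), Real.sqrt_sq h1.le]
    rw [this, eps]
    congr 1
    field_simp
    linarith
  have hamp : amp 0 s (Real.cosh a) = a * q a := by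
    rw [amp, bandSink_of_one_lt hc, Real.arcosh_cosh ha.le, heps,
      show Real.cosh a ^ 2 - 1 = Real.sinh a ^ 2 by linarith, Real.sqrt_sq h1.le]
    field_simp
  have hee : Real.exp (-a) * Real.exp a = 1 := by rw [← Real.exp_add]; simp
  rw [nullP, hamp, heps, Real.cosh_eq, Real.sinh_eq,
    show -(a * q a) = -(a * (q a - 1)) + -a by ring, Real.exp_add]
  linear_combination (-Real.exp (-(a * (q a - 1))) * (1 + q a) / 2) * hee

/-! ### Monotonicity -/

/-- The part of the band on which `nullP` is nonnegative. -/
def posDomain (k : ℕ) (s : ℝ) : Set ℝ := {y | y ∈ bandDomain k ∧ (1 < s ∨ √(1 - s ^ 2) ≤ y)}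

theorem ordConnected_posDomain (k : ℕ) (s : ℝ) : (posDomain k s).OrdConnected := by
  refine ⟨fun a ha b hb y hy => ⟨⟨ha.1.1.trans_le hy.1, ?_⟩, ?_⟩⟩
  · exact hb.1.2.imp_right fun h => lt_of_le_of_lt hy.2 h
  · exact ha.2.imp_right fun h => h.trans hy.1

theorem one_sub_sq_le {s y : ℝ} (h : 1 < s ∨ √(1 - s ^ 2) ≤ y) : 1 - s ^ 2 ≤ y ^ 2 := by
  rcases h with h | h
  · nlinarith [sq_nonneg y]
  · rcases le_total 0 (1 - s ^ 2) with h1 | h1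
    · rw [← Real.sq_sqrt h1]
      exact pow_le_pow_left₀ (Real.sqrt_nonneg _) h 2
    · nlinarith [sq_nonneg y]

theorem one_sub_sq_lt {s y : ℝ} (h : 1 < s ∨ √(1 - s ^ 2) < y) : 1 - s ^ 2 < y ^ 2 := by
  rcases h with h | h
  · nlinarith [sq_nonneg y]
  · rcases le_total 0 (1 - s ^ 2) with h1 | h1
    · rw [← Real.sq_sqrt h1]
      exact pow_lt_pow_left₀ h (Real.sqrt_nonneg _) two_ne_zero
    · have := (Real.sqrt_nonneg (1 - s ^ 2)).trans_lt h
      nlinarith [pow_pos this 2]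

theorem neg_lt_eps {s y : ℝ} (h : 1 < s ∨ √(1 - s ^ 2) < y) : 0 < y + eps s y := by
  rcases h with h | h
  · have : |y| < eps s y := by
      rw [← Real.sqrt_sq_eq_abs]
      exact Real.sqrt_lt_sqrt (sq_nonneg _) (by nlinarith)
    linarith [(abs_lt.1 this).1]
  · have := (Real.sqrt_nonneg (1 - s ^ 2)).trans_lt h
    have := eps_nonneg s y
    linarith

theorem nullP_pos {k : ℕ} {s y : ℝ} (h : 1 < s ∨ √(1 - s ^ 2) < y) : 0 < nullP k s y :=
  mul_pos (Real.exp_pos _) (neg_lt_eps h)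

theorem interior_posDomain {k : ℕ} {s y : ℝ} {I : Set ℝ} (hI : I ⊆ posDomain k s)
    (hy : y ∈ interior I) : y ∈ bandDomain k ∧ (1 < s ∨ √(1 - s ^ 2) < y) := by
  refine ⟨(hI (interior_subset hy)).1, ?_⟩
  by_cases h : 1 < s
  · exact Or.inl h
  · right
    have hsub : I ⊆ Set.Ici √(1 - s ^ 2) := fun z hz => (hI hz).2.resolve_left h
    have := interior_mono hsub hy
    rwa [interior_Ici] at this

theorem strictMonoOn_nullP {k : ℕ} {s : ℝ} {I : Set ℝ} (hs : 0 < s) (hc : I.OrdConnected)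
    (hI : I ⊆ posDomain k s) (hd : ∀ y ∈ interior I, y ≠ 1 ∧ 0 < bandSinkDeriv k y) :
    StrictMonoOn (nullP k s) I := by
  refine strictMonoOn_of_deriv_pos hc.convex
    (fun y hy => (continuousAt_nullP (hI hy).1).continuousWithinAt) fun y hy => ?_
  obtain ⟨h1, h2⟩ := interior_posDomain hI hy
  rw [(hasDerivAt_nullP h1 (hd y hy).1 (one_sub_sq_lt h2)).deriv]
  have := nullP_pos (k := k) h2
  have := (hd y hy).2
  have := bandSink_pos h1
  have := eps_pos (one_sub_sq_lt h2)
  positivity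

theorem strictAntiOn_nullP {k : ℕ} {s : ℝ} {I : Set ℝ} (hs : 0 < s) (hc : I.OrdConnected)
    (hI : I ⊆ posDomain k s) (hd : ∀ y ∈ interior I, y ≠ 1 ∧ bandSinkDeriv k y < 0) :
    StrictAntiOn (nullP k s) I := by
  refine strictAntiOn_of_deriv_neg hc.convex
    (fun y hy => (continuousAt_nullP (hI hy).1).continuousWithinAt) fun y hy => ?_
  obtain ⟨h1, h2⟩ := interior_posDomain hI hy
  rw [(hasDerivAt_nullP h1 (hd y hy).1 (one_sub_sq_lt h2)).deriv]
  have := nullP_pos (k := k) h2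
  have := (hd y hy).2
  have := bandSink_pos h1
  have := eps_pos (one_sub_sq_lt h2)
  refine mul_neg_of_pos_of_neg ‹_› (div_neg_of_neg_of_pos ?_ (by positivity))
  exact mul_neg_of_pos_of_neg (by positivity) ‹_›

theorem strictMonoOn_nullP_left {k : ℕ} (hk : 1 ≤ k) {s : ℝ} (hs : 0 < s) :
    StrictMonoOn (nullP k s) (posDomain k s ∩ Set.Iic (ystar k)) := by
  have := ordConnected_posDomain k s
  refine strictMonoOn_nullP hs (this.inter Set.ordConnected_Iic) Set.inter_subset_left fun y hy => ?_
  have h1 := (interior_subset hy).1.1.1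
  have h2 := interior_mono Set.inter_subset_right hy
  rw [interior_Iic] at h2
  exact ⟨(h2.trans (ystar_lt_one hk)).ne, bandSinkDeriv_pos_of_lt_ystar hk h1 h2⟩

theorem strictAntiOn_nullP_right {k : ℕ} (hk : 1 ≤ k) {s : ℝ} (hs : 0 < s) :
    StrictAntiOn (nullP k s) (posDomain k s ∩ Set.Ici (ystar k)) := by
  have := ordConnected_posDomain k s
  refine strictAntiOn_nullP hs (this.inter Set.ordConnected_Ici) Set.inter_subset_left fun y hy => ?_
  have h1 := (interior_subset hy).1.1.2.resolve_left (by omega)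
  have h2 := interior_mono Set.inter_subset_right hy
  rw [interior_Ici] at h2
  exact ⟨h1.ne, bandSinkDeriv_neg_of_ystar_lt hk h1 h2⟩

theorem sqrt_one_sub_sq_lt_one {s : ℝ} (hs : 0 < s) : √(1 - s ^ 2) < 1 := by
  rw [Real.sqrt_lt' one_pos]
  nlinarith

/-- The derivative formula excludes y = 1, so the domain is cut there and the two monotone pieces
are joined at their common endpoint. -/
theorem strictMonoOn_nullP_zero {s : ℝ} (hs : 0 < s) :
    StrictMonoOn (nullP 0 s) (posDomain 0 s) := by
  have hc := ordConnected_posDomain 0 s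
  have h1 : (1 : ℝ) ∈ posDomain 0 s :=
    ⟨⟨by norm_num, Or.inl rfl⟩, Or.inr (sqrt_one_sub_sq_lt_one hs).le⟩
  have hl : StrictMonoOn (nullP 0 s) (posDomain 0 s ∩ Set.Iic 1) := by
    refine strictMonoOn_nullP hs (hc.inter Set.ordConnected_Iic) Set.inter_subset_left fun y hy => ?_
    have h2 := interior_mono Set.inter_subset_right hy
    rw [interior_Iic] at h2
    exact ⟨h2.ne, bandSinkDeriv_zero_pos (interior_subset hy).1.1.1 h2.ne⟩
  have hr : StrictMonoOn (nullP 0 s) (posDomain 0 s ∩ Set.Ici 1) := by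
    refine strictMonoOn_nullP hs (hc.inter Set.ordConnected_Ici) Set.inter_subset_left fun y hy => ?_
    have h2 := interior_mono Set.inter_subset_right hy
    rw [interior_Ici] at h2
    exact ⟨h2.ne', bandSinkDeriv_zero_pos (interior_subset hy).1.1.1 h2.ne'⟩
  have := hl.union hr ⟨⟨h1, Set.self_mem_Iic⟩, fun y hy => hy.2⟩
    ⟨⟨h1, Set.self_mem_Ici⟩, fun y hy => hy.2⟩
  rwa [← Set.inter_union_distrib_left, Set.Iic_union_Ici, Set.inter_univ] at this

/-! ### Level sets -/

theorem nullP_sqrt {k : ℕ} {s : ℝ} (hs : s ≤ 1) (hs0 : 0 < s) :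
    √(1 - s ^ 2) ∈ posDomain k s ∧ eps s √(1 - s ^ 2) = 0 ∧ amp k s √(1 - s ^ 2) = 0 ∧
      nullP k s √(1 - s ^ 2) = √(1 - s ^ 2) := by
  have h1 : eps s √(1 - s ^ 2) = 0 := by
    rw [eps, Real.sq_sqrt (by nlinarith)]
    simp
  have h2 : amp k s √(1 - s ^ 2) = 0 := by rw [amp, h1, zero_div]
  refine ⟨⟨⟨by linarith [Real.sqrt_nonneg (1 - s ^ 2)], Or.inr (sqrt_one_sub_sq_lt_one hs0)⟩,
    Or.inr le_rfl⟩, h1, h2, ?_⟩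
  rw [nullP, h1, h2]; simp

/-- At its left end `nullP` tends to 0 as y → −1 if s > 1, and starts with the value √(1 − s²) if s
≤ 1. Both are captured by √(1 − s²), as the root of a negative number is 0. -/
theorem exists_le_nullP_lt {k : ℕ} {s p b : ℝ} (hs : 0 < s) (hp : √(1 - s ^ 2) < p)
    (hb : b ∈ posDomain k s) : ∃ a ∈ posDomain k s, a ≤ b ∧ nullP k s a < p := by
  by_cases h : 1 < s
  · have h1 := tendsto_nullP hs nhdsWithin_le_nhds (eps_one hs).2 (tendsto_bandSink_neg_one k)
    have h2 := h1.eventually_lt_const ((Real.sqrt_nonneg _).trans_lt hp)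
    obtain ⟨a, ha, ha'⟩ := (h2.and (Ioo_mem_nhdsGT hb.1.1)).exists
    exact ⟨a, ⟨⟨ha'.1, hb.1.2.imp_right fun h => ha'.2.trans h⟩, Or.inl h⟩, ha'.2.le, ha⟩
  · obtain ⟨h1, -, -, h2⟩ := nullP_sqrt (k := k) (not_lt.1 h) hs
    exact ⟨_, h1, hb.2.resolve_left h, by rwa [h2]⟩

theorem exists_ge_nullP_lt {k : ℕ} (hk : 1 ≤ k) {s p b : ℝ} (hs : 0 < s) (hp : 0 < p)
    (hb : b ∈ posDomain k s) : ∃ c ∈ posDomain k s, b ≤ c ∧ nullP k s c < p := by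
  have h1 := tendsto_nullP hs nhdsWithin_le_nhds (eps_one hs).1 (tendsto_bandSink_one hk)
  have h2 := h1.eventually_lt_const hp
  obtain ⟨c, hc, hc'⟩ := (h2.and (Ioo_mem_nhdsLT (hb.1.2.resolve_left (by omega)))).exists
  exact ⟨c, ⟨⟨hb.1.1.trans hc'.1, Or.inr hc'.2⟩, hb.2.imp_right fun h => h.trans hc'.1.le⟩,
    hc'.1.le, hc⟩

theorem exists_ge_lt_nullP {s p b : ℝ} (hp : p < 1) (hb : b ∈ posDomain 0 s) :
    ∃ c ∈ posDomain 0 s, b ≤ c ∧ p < nullP 0 s c := by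
  have h2 := (tendsto_nullP_cosh s).eventually_const_lt hp
  have h3 : Tendsto Real.cosh atTop atTop := tendsto_cosh_atTop
  obtain ⟨a, ha, ha'⟩ := (h2.and (h3.eventually_ge_atTop b)).exists
  exact ⟨_, ⟨⟨hb.1.1.trans_le ha', Or.inl rfl⟩, hb.2.imp_right fun h => h.trans ha'⟩, ha', ha⟩

theorem nullP_zero_lt_one {s y : ℝ} (hs : 0 < s) (hy : y ∈ posDomain 0 s) : nullP 0 s y < 1 := by
  by_contra! h
  have hm := strictMonoOn_nullP_zero hs
  have hmem (z : ℝ) (hz : y ≤ z) : z ∈ posDomain 0 s :=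
    ⟨⟨hy.1.1.trans_le hz, Or.inl rfl⟩, hy.2.imp_right fun h => h.trans hz⟩
  have h1 : nullP 0 s y < nullP 0 s (y + 1) := hm hy (hmem _ (by linarith)) (by linarith)
  have h2 := (tendsto_nullP_cosh s).eventually_lt_const (h.trans_lt h1)
  obtain ⟨a, ha, ha'⟩ := (h2.and (tendsto_cosh_atTop.eventually_ge_atTop (y + 1))).exists
  have := hm.monotoneOn (hmem _ (by linarith)) (hmem _ (by linarith)) ha'
  linarith

theorem exists_nullP_eq {k : ℕ} {s p a b : ℝ} (ha : a ∈ posDomain k s) (hb : b ∈ posDomain k s)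
    (hp : p ∈ Set.uIcc (nullP k s a) (nullP k s b)) :
    ∃ y ∈ posDomain k s, y ∈ Set.uIcc a b ∧ nullP k s y = p := by
  have hsub := (ordConnected_posDomain k s).uIcc_subset ha hb
  obtain ⟨y, hy, hyp⟩ := intermediate_value_uIcc
    (fun y hy => (continuousAt_nullP (hsub hy).1).continuousWithinAt) hp
  exact ⟨y, hsub hy, hy, hyp⟩

end SubLorentzSU11

namespace SubLorentzSU11

open Filter Topology

/-! ### The endpoint equations in null coordinates -/

theorem mem_solutionSet_iff {k : ℕ} {x₁ x₂ y α : ℝ} :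
    (y, α) ∈ solutionSet k x₁ x₂ ↔ y ∈ bandDomain k ∧
      Real.exp (-α) * (y + α * bandSink k y) = x₁ + x₂ ∧
      Real.exp α * (y - α * bandSink k y) = x₁ - x₂ := by
  simp only [solutionSet, Set.mem_ofPred_eq, Real.cosh_eq, Real.sinh_eq]
  refine and_congr_right fun _ => ⟨fun ⟨h1, h2⟩ => ⟨?_, ?_⟩, fun ⟨h1, h2⟩ => ⟨?_, ?_⟩⟩
  · linear_combination h1 + h2
  · linear_combination h1 - h2
  · linear_combination (h1 + h2) / 2
  · linear_combination (h1 - h2) / 2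

theorem mem_solutionSet_neg_iff {k : ℕ} {x₁ x₂ y α : ℝ} :
    (y, -α) ∈ solutionSet k x₁ (-x₂) ↔ (y, α) ∈ solutionSet k x₁ x₂ := by
  rw [mem_solutionSet_iff, mem_solutionSet_iff]
  simp only [neg_neg, neg_mul, ← sub_eq_add_neg, sub_neg_eq_add]
  exact and_congr_right fun _ => and_comm

/-- The difference of squares of the two equations fixes (α · `bandSink k y`)², so the sign of α
makes it a function of y. -/
theorem mem_solutionSet_iff_of_nonneg {k : ℕ} {s x₁ x₂ y α : ℝ} (hx : x₁ ^ 2 - x₂ ^ 2 = 1 - s ^ 2)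
    (hα : 0 ≤ α) : (y, α) ∈ solutionSet k x₁ x₂ ↔ y ∈ bandDomain k ∧ 1 - s ^ 2 ≤ y ^ 2 ∧
      α = amp k s y ∧ nullP k s y = x₁ + x₂ ∧ nullQ k s y = x₁ - x₂ := by
  constructor
  · intro h
    have hy : y ∈ bandDomain k := h.1
    have hΦ := bandSink_pos hy
    have h2 := solutionSet_sq_sub_sq h
    simp only [hx] at h2
    have h3 : 1 - s ^ 2 ≤ y ^ 2 := by
      have := sq_nonneg (α * bandSink k y)
      linarith
    have h4 : α * bandSink k y = eps s y := by
      rw [eps, show y ^ 2 + s ^ 2 - 1 = (α * bandSink k y) ^ 2 by linarith,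
        Real.sqrt_sq (by positivity)]
    have h5 : α = amp k s y := by rw [amp, ← h4]; field_simp
    obtain ⟨-, e1, e2⟩ := mem_solutionSet_iff.1 h
    refine ⟨hy, h3, h5, ?_, ?_⟩
    · rw [nullP, ← h5, ← h4, e1]
    · rw [nullQ, ← h5, ← h4, e2]
  · rintro ⟨hy, h3, rfl, h1, h2⟩
    have hΦ := bandSink_pos hy
    have h4 : amp k s y * bandSink k y = eps s y := by rw [amp]; field_simp
    exact mem_solutionSet_iff.2 ⟨hy, by rw [h4]; exact h1, by rw [h4]; exact h2⟩

theorem mem_solutionSet_iff_of_nonpos {k : ℕ} {s x₁ x₂ y α : ℝ} (hx : x₁ ^ 2 - x₂ ^ 2 = 1 - s ^ 2)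
    (hα : α ≤ 0) : (y, α) ∈ solutionSet k x₁ x₂ ↔ y ∈ bandDomain k ∧ 1 - s ^ 2 ≤ y ^ 2 ∧
      -α = amp k s y ∧ nullP k s y = x₁ - x₂ ∧ nullQ k s y = x₁ + x₂ := by
  rw [← mem_solutionSet_neg_iff, mem_solutionSet_iff_of_nonneg
    (show x₁ ^ 2 - (-x₂) ^ 2 = 1 - s ^ 2 by rw [neg_sq]; exact hx) (neg_nonneg.2 hα), sub_neg_eq_add, ← sub_eq_add_neg]

/-- The points of the band where `nullP` takes a given value. -/
def levelSet (k : ℕ) (s p : ℝ) : Set ℝ := {y | y ∈ posDomain k s ∧ nullP k s y = p}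

theorem eps_mono_aux {s y : ℝ} (h : 1 ≤ s) : |y| ≤ eps s y := by
  rw [← Real.sqrt_sq_eq_abs]
  exact Real.sqrt_le_sqrt (by nlinarith)

theorem eps_le_abs {s y : ℝ} (h0 : 0 < s) (h : s ≤ 1) : eps s y ≤ |y| := by
  rw [← Real.sqrt_sq_eq_abs]
  exact Real.sqrt_le_sqrt (by nlinarith)

/-- For s ≤ 1 one has ε ≤ |y|, so a positive `nullP` forces y ≥ 0 and excludes the left component of
y² ≥ 1 − s². -/
theorem mem_posDomain_of_nullP_pos {k : ℕ} {s y : ℝ} (hs : 0 < s) (hy : y ∈ bandDomain k)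
    (h1 : 1 - s ^ 2 ≤ y ^ 2) (hp : 0 < nullP k s y) : y ∈ posDomain k s := by
  refine ⟨hy, ?_⟩
  by_cases h : 1 < s
  · exact Or.inl h
  · right
    have h2 : 0 < y + eps s y := pos_of_mul_pos_right hp (Real.exp_pos _).le
    have h3 := eps_le_abs (y := y) hs (not_lt.1 h)
    have h4 : 0 ≤ y := by
      by_contra! hneg
      rw [abs_of_neg hneg] at h3
      linarith
    rw [← Real.sqrt_sq h4]
    exact Real.sqrt_le_sqrt h1

theorem nullQ_eq_of_nullP_eq {k : ℕ} {s y a b : ℝ} (h1 : 1 - s ^ 2 ≤ y ^ 2) (ha : a ≠ 0)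
    (hab : a * b = 1 - s ^ 2) (h : nullP k s y = a) : nullQ k s y = b := by
  have := nullP_mul_nullQ (k := k) h1
  rw [h, ← hab] at this
  exact mul_left_cancel₀ ha this

/-- For s ≥ 1 one has ε ≥ |y|, so `nullQ` is never positive and solutions with α ≤ 0 would
contradict x₁ + x₂ > 0. Only one level set is left. -/
theorem encard_solutionSet_of_one_le {k : ℕ} {s x₁ x₂ : ℝ} (hs : 1 ≤ s)
    (hx : x₁ ^ 2 - x₂ ^ 2 = 1 - s ^ 2) (hp : 0 < x₁ + x₂) :
    (solutionSet k x₁ x₂).encard = (levelSet k s (x₁ + x₂)).encard := by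
  have h : solutionSet k x₁ x₂ = (fun y => (y, amp k s y)) '' levelSet k s (x₁ + x₂) := by
    ext ⟨y, α⟩
    constructor
    · intro h
      rcases le_total 0 α with hα | hα
      · obtain ⟨h1, h2, rfl, h3, h4⟩ := (mem_solutionSet_iff_of_nonneg hx hα).1 h
        exact ⟨y, ⟨mem_posDomain_of_nullP_pos (by linarith) h1 h2 (by rw [h3]; exact hp), h3⟩, rfl⟩
      · obtain ⟨h1, h2, h3, h4, h5⟩ := (mem_solutionSet_iff_of_nonpos hx hα).1 h
        have h6 : 0 < y - eps s y := by
          rw [← h5] at hp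
          exact pos_of_mul_pos_right hp (Real.exp_pos _).le
        have := eps_mono_aux (y := y) hs
        linarith [le_abs_self y]
    · rintro ⟨y', ⟨h1, h2⟩, h⟩
      simp only [Prod.mk.injEq] at h
      obtain ⟨rfl, rfl⟩ := h
      have h3 := one_sub_sq_le h1.2
      refine (mem_solutionSet_iff_of_nonneg hx (amp_nonneg h1.1)).2
        ⟨h1.1, h3, rfl, h2, nullQ_eq_of_nullP_eq h3 hp.ne' ?_ h2⟩
      linarith
  rw [h, Set.InjOn.encard_image]
  intro a _ b _ h
  exact (Prod.mk.inj h).1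

theorem solutionSet_eq_union {k : ℕ} {s x₁ x₂ : ℝ} (hs0 : 0 < s)
    (hx : x₁ ^ 2 - x₂ ^ 2 = 1 - s ^ 2) (hp : 0 < x₁ + x₂) (hq : 0 < x₁ - x₂) :
    solutionSet k x₁ x₂ = (fun y => (y, amp k s y)) '' levelSet k s (x₁ + x₂) ∪
      (fun y => (y, -amp k s y)) '' levelSet k s (x₁ - x₂) := by
  ext ⟨y, α⟩
  constructor
  · intro h
    rcases le_total 0 α with hα | hα
    · obtain ⟨h1, h2, rfl, h3, h4⟩ := (mem_solutionSet_iff_of_nonneg hx hα).1 h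
      exact Or.inl ⟨y, ⟨mem_posDomain_of_nullP_pos hs0 h1 h2 (by rw [h3]; exact hp), h3⟩, rfl⟩
    · obtain ⟨h1, h2, h3, h4, h5⟩ := (mem_solutionSet_iff_of_nonpos hx hα).1 h
      refine Or.inr ⟨y, ⟨mem_posDomain_of_nullP_pos hs0 h1 h2 (by rw [h4]; exact hq), h4⟩, ?_⟩
      simp only [← h3, neg_neg]
  · rintro (⟨y', ⟨h1, h2⟩, h⟩ | ⟨y', ⟨h1, h2⟩, h⟩) <;> simp only [Prod.mk.injEq] at h <;>
      obtain ⟨rfl, rfl⟩ := h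
    · have h3 := one_sub_sq_le h1.2
      exact (mem_solutionSet_iff_of_nonneg hx (amp_nonneg h1.1)).2
        ⟨h1.1, h3, rfl, h2, nullQ_eq_of_nullP_eq h3 hp.ne' (by linarith) h2⟩
    · have h3 := one_sub_sq_le h1.2
      exact (mem_solutionSet_iff_of_nonpos hx (neg_nonpos.2 (amp_nonneg h1.1))).2
        ⟨h1.1, h3, neg_neg _, h2, nullQ_eq_of_nullP_eq h3 hq.ne' (by linarith) h2⟩

/-- If x₂ ≠ 0 the two levels of `nullP` differ, so the branches α ≥ 0 and α ≤ 0 share no solution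
and the counts add. -/
theorem encard_solutionSet_of_ne {k : ℕ} {s x₁ x₂ : ℝ} (hs0 : 0 < s)
    (hx : x₁ ^ 2 - x₂ ^ 2 = 1 - s ^ 2) (hp : 0 < x₁ + x₂) (hq : 0 < x₁ - x₂) (h2 : x₂ ≠ 0) :
    (solutionSet k x₁ x₂).encard =
      (levelSet k s (x₁ + x₂)).encard + (levelSet k s (x₁ - x₂)).encard := by
  rw [solutionSet_eq_union hs0 hx hp hq, Set.encard_union_eq, Set.InjOn.encard_image,
    Set.InjOn.encard_image]
  · intro a _ b _ h
    exact (Prod.mk.inj h).1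
  · intro a _ b _ h
    exact (Prod.mk.inj h).1
  · rw [Set.disjoint_left]
    rintro _ ⟨a, ⟨-, ha⟩, rfl⟩ ⟨b, ⟨-, hb⟩, h⟩
    obtain ⟨rfl, -⟩ := Prod.mk.inj h
    exact h2 (by linarith)

/-! ### The negative branch -/

/-- On negative y, Φ increases and ε decreases, so the amplitude decreases; −`nullQ` is a product of
decreasing positive factors, and no derivative is required. -/
theorem nullQ_strictMono {k : ℕ} {s a b : ℝ} (ha : -1 < a) (hab : a < b)
    (hb : b ≤ -√(1 - s ^ 2)) : nullQ k s a < nullQ k s b := by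
  have hm := Real.sqrt_nonneg (1 - s ^ 2)
  have h1 : bandSink k a ≤ bandSink k b := by
    rw [bandSink_of_lt_one (by linarith), bandSink_of_lt_one (by linarith)]
    refine div_le_div₀ (Real.sqrt_nonneg _) (Real.sqrt_le_sqrt (by nlinarith))
      (arccos_add_pos (by linarith)) ?_
    linarith [Real.antitone_arccos hab.le]
  have ha' : a ∈ bandDomain k := ⟨ha, Or.inr (by linarith)⟩
  have h2 : eps s b ≤ eps s a := Real.sqrt_le_sqrt (by nlinarith)
  have h3 : amp k s b ≤ amp k s a := div_le_div₀ (eps_nonneg _ _) h2 (bandSink_pos ha') h1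
  have h4 := eps_nonneg s b
  have h5 : Real.exp (amp k s b) * (eps s b - b) < Real.exp (amp k s a) * (eps s a - a) :=
    mul_lt_mul' (Real.exp_le_exp.2 h3) (by linarith) (by linarith) (Real.exp_pos _)
  rw [nullQ, nullQ]
  linarith

/-- Here x₁ ± x₂ ≤ 0 for one sign and hence for both, which forces y ≤ 0, and x₂ ≥ 0 then excludes α
< 0. What remains is solved by `nullQ`, increasing from −∞ at −1 to −√(1 − s²) at the right end. -/
theorem encard_solutionSet_of_neg {k : ℕ} {s x₁ x₂ : ℝ} (hs0 : 0 < s) (hs : s ≤ 1)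
    (hx : x₁ ^ 2 - x₂ ^ 2 = 1 - s ^ 2) (h1 : x₁ ≤ -√(1 - s ^ 2)) (h2 : 0 ≤ x₂) :
    (solutionSet k x₁ x₂).encard = 1 := by
  have hm0 : 0 ≤ 1 - s ^ 2 := by nlinarith
  have hm := Real.sqrt_nonneg (1 - s ^ 2)
  have hm2 := Real.sq_sqrt hm0
  have hm1 := sqrt_one_sub_sq_lt_one hs0
  set m := √(1 - s ^ 2) with hmdef
  have hle : x₂ ≤ -x₁ := by
    refine (pow_le_pow_iff_left₀ h2 (by linarith) two_ne_zero).1 ?_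
    nlinarith
  have hle' (y : ℝ) (h3 : 1 - s ^ 2 ≤ y ^ 2) (h4 : y ≤ 0) : y ≤ -m := by
    have : m ≤ -y := by
      rw [hmdef, ← Real.sqrt_sq (show 0 ≤ -y by linarith)]
      exact Real.sqrt_le_sqrt (by linarith [neg_sq y])
    linarith
  have hdom (y : ℝ) (h : -1 < y) (h' : y ≤ -m) : y ∈ bandDomain k := ⟨h, Or.inr (by linarith)⟩
  have hP (y : ℝ) (h : nullP k s y ≤ 0) : y ≤ 0 := by
    have : y + eps s y ≤ 0 := by
      by_contra! hcon
      exact absurd h (not_le.2 (mul_pos (Real.exp_pos _) hcon))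
    linarith [eps_nonneg s y]
  have hmem (y α : ℝ) : (y, α) ∈ solutionSet k x₁ x₂ ↔
      -1 < y ∧ y ≤ -m ∧ nullQ k s y = x₁ - x₂ ∧ α = amp k s y := by
    constructor
    · intro h
      rcases le_or_gt 0 α with hα | hα
      · obtain ⟨e1, e2, e3, e4, e5⟩ := (mem_solutionSet_iff_of_nonneg hx hα).1 h
        exact ⟨e1.1, hle' y e2 (hP y (by rw [e4]; linarith)), e5, e3⟩
      · obtain ⟨e1, e2, e3, e4, e5⟩ := (mem_solutionSet_iff_of_nonpos hx hα.le).1 h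
        have hy := hP y (by rw [e4]; linarith)
        have hsh : Real.sinh α < 0 := Real.sinh_neg_iff.2 hα
        have e6 : α * bandSink k y * Real.cosh α - y * Real.sinh α = x₂ := h.2.2
        have : α * bandSink k y * Real.cosh α < 0 :=
          mul_neg_of_neg_of_pos (mul_neg_of_neg_of_pos hα (bandSink_pos e1)) (Real.cosh_pos α)
        nlinarith [mul_nonneg_of_nonpos_of_nonpos hy hsh.le]
    · rintro ⟨e1, e2, e3, rfl⟩
      have hy := hdom y e1 e2
      have e4 : 1 - s ^ 2 ≤ y ^ 2 := by rw [← hm2]; nlinarith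
      refine (mem_solutionSet_iff_of_nonneg hx (amp_nonneg hy)).2 ⟨hy, e4, rfl, ?_, e3⟩
      -- Normally the product 1 − s² recovers `nullP` from `nullQ`. If x₁ − x₂ = 0 the product says
      -- nothing, but then y = ε with y ≤ 0 ≤ ε, so everything vanishes.
      rcases eq_or_ne (x₁ - x₂) 0 with h0 | h0
      · have e5 : y - eps s y = 0 := by
          rw [h0] at e3
          exact (mul_eq_zero.1 e3).resolve_left (Real.exp_ne_zero _)
        have := eps_nonneg s y
        rw [nullP, show y + eps s y = 0 by linarith, mul_zero]
        linarith
      · have := nullP_mul_nullQ (k := k) e4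
        rw [e3] at this
        refine mul_right_cancel₀ h0 (this.trans ?_)
        linarith
  obtain ⟨y, hy1, hy2, hy3⟩ : ∃ y, -1 < y ∧ y ≤ -m ∧ nullQ k s y = x₁ - x₂ := by
    have hend : nullQ k s (-m) = -m := by
      have : eps s (-m) = 0 := by rw [eps, neg_sq, hm2]; simp
      rw [nullQ, amp, this]; simp
    have hlim := (tendsto_nullQ_neg_one k hs0).eventually_le_atBot (x₁ - x₂)
    obtain ⟨a, ha, ha'⟩ := (hlim.and (Ioo_mem_nhdsGT (show -1 < -m by linarith))).exists
    have hcont : ContinuousOn (nullQ k s) (Set.Icc a (-m)) := fun y hy =>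
      (continuousAt_nullQ (hdom y (ha'.1.trans_le hy.1) hy.2)).continuousWithinAt
    obtain ⟨y, hy, hyq⟩ := intermediate_value_Icc ha'.2.le hcont
      (show x₁ - x₂ ∈ _ from ⟨ha, by rw [hend]; linarith⟩)
    exact ⟨y, ha'.1.trans_le hy.1, hy.2, hyq⟩
  rw [Set.encard_eq_one]
  refine ⟨(y, amp k s y), ?_⟩
  ext ⟨z, α⟩
  rw [hmem, Set.mem_singleton_iff, Prod.mk.injEq]
  constructor
  · rintro ⟨e1, e2, e3, rfl⟩
    have hzy : z = y := by
      rcases lt_trichotomy z y with h | h | h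
      · have := nullQ_strictMono (k := k) e1 h hy2
        linarith
      · exact h
      · have := nullQ_strictMono (k := k) hy1 h e2
        linarith
    rw [hzy]
    exact ⟨rfl, rfl⟩
  · rintro ⟨rfl, rfl⟩
    exact ⟨hy1, hy2, hy3, rfl⟩

/-! ### Cardinalities of level sets -/

theorem encard_levelSet_zero {s p : ℝ} (hs : 0 < s) (hp : √(1 - s ^ 2) < p) (hp1 : p < 1) :
    (levelSet 0 s p).encard = 1 := by
  have h1 : (1 : ℝ) ∈ posDomain 0 s :=
    ⟨⟨by norm_num, Or.inl rfl⟩, Or.inr (sqrt_one_sub_sq_lt_one hs).le⟩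
  obtain ⟨a, ha, -, hap⟩ := exists_le_nullP_lt hs hp h1
  obtain ⟨b, hb, -, hbp⟩ := exists_ge_lt_nullP hp1 h1
  obtain ⟨y, hy, -, hyp⟩ := exists_nullP_eq ha hb (Set.mem_uIcc.2 (Or.inl ⟨hap.le, hbp.le⟩))
  rw [Set.encard_eq_one]
  refine ⟨y, Set.eq_singleton_iff_unique_mem.2 ⟨⟨hy, hyp⟩, fun z hz => ?_⟩⟩
  exact (strictMonoOn_nullP_zero hs).injOn hz.1 hy (hz.2.trans hyp.symm)

theorem levelSet_zero_of_one_le {s p : ℝ} (hs : 0 < s) (hp : 1 ≤ p) : levelSet 0 s p = ∅ :=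
  Set.eq_empty_of_forall_notMem fun y hy => by
    have := nullP_zero_lt_one hs hy.1
    rw [hy.2] at this
    linarith

theorem levelSet_zero_of_lt {s p : ℝ} (hs : 0 < s) (hs1 : s ≤ 1) (hp : p < √(1 - s ^ 2)) :
    levelSet 0 s p = ∅ :=
  Set.eq_empty_of_forall_notMem fun y hy => by
    obtain ⟨h1, -, -, h2⟩ := nullP_sqrt (k := 0) hs1 hs
    have := (strictMonoOn_nullP_zero hs).monotoneOn h1 hy.1 (hy.1.2.resolve_left (by linarith))
    rw [hy.2, h2] at this
    linarith

theorem levelSet_zero_sqrt {s : ℝ} (hs : 0 < s) (hs1 : s ≤ 1) :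
    levelSet 0 s √(1 - s ^ 2) = {√(1 - s ^ 2)} := by
  obtain ⟨h1, -, -, h2⟩ := nullP_sqrt (k := 0) hs1 hs
  exact Set.eq_singleton_iff_unique_mem.2 ⟨⟨h1, h2⟩, fun z hz =>
    (strictMonoOn_nullP_zero hs).injOn hz.1 h1 (hz.2.trans h2.symm)⟩

/-- The part of a level set to the right of a point where `nullP` decreases. -/
theorem exists_right {k : ℕ} (hk : 1 ≤ k) {s p b : ℝ} (hs : 0 < s) (hb : b ∈ posDomain k s)
    (hby : ystar k ≤ b) (hp : 0 < p) (hpb : p ≤ nullP k s b) :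
    ∃ y, b ≤ y ∧ ystar k ≤ y ∧ y ∈ posDomain k s ∧ nullP k s y = p ∧
      ∀ z ∈ posDomain k s, ystar k ≤ z → nullP k s z = p → z = y := by
  obtain ⟨c, hc, hbc, hcp⟩ := exists_ge_nullP_lt hk hs hp hb
  obtain ⟨y, hy, hy', hyp⟩ := exists_nullP_eq hc hb (Set.mem_uIcc.2 (Or.inl ⟨hcp.le, hpb⟩))
  rw [Set.uIcc_of_ge hbc] at hy'
  exact ⟨y, hy'.1, hby.trans hy'.1, hy, hyp, fun z hz hz' hzp =>
    (strictAntiOn_nullP_right hk hs).injOn ⟨hz, hz'⟩ ⟨hy, hby.trans hy'.1⟩ (hzp.trans hyp.symm)⟩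

theorem ystar_lt_of {k : ℕ} (hk : 1 ≤ k) {s : ℝ} (hs : omega k < s) :
    1 < s ∨ √(1 - s ^ 2) < ystar k := by
  by_cases h : 1 < s
  · exact Or.inl h
  · right
    have := omega_pos hk
    exact Real.sqrt_lt_sqrt (by nlinarith) (by nlinarith)

theorem ystar_mem {k : ℕ} (hk : 1 ≤ k) {s : ℝ} (hs : omega k < s) : ystar k ∈ posDomain k s :=
  ⟨⟨by linarith [ystar_pos hk], Or.inr (ystar_lt_one hk)⟩, (ystar_lt_of hk hs).imp_right le_of_lt⟩

theorem sqrt_lt_nullP_ystar {k : ℕ} (hk : 1 ≤ k) {s : ℝ} (hs : omega k < s) :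
    √(1 - s ^ 2) < nullP k s (ystar k) := by
  have hs0 := (omega_pos hk).trans hs
  by_cases h : 1 < s
  · rw [Real.sqrt_eq_zero_of_nonpos (by nlinarith)]
    exact nullP_pos (Or.inl h)
  · obtain ⟨h1, -, -, h2⟩ := nullP_sqrt (k := k) (not_lt.1 h) hs0
    have h3 := (ystar_lt_of hk hs).resolve_left h
    have := strictMonoOn_nullP_left hk hs0 ⟨h1, h3.le⟩ ⟨ystar_mem hk hs, Set.self_mem_Iic⟩ h3
    rwa [h2] at this

theorem nullP_le_ystar {k : ℕ} (hk : 1 ≤ k) {s y : ℝ} (hs : omega k < s) (hy : y ∈ posDomain k s) :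
    nullP k s y ≤ nullP k s (ystar k) := by
  have hs0 := (omega_pos hk).trans hs
  rcases le_total y (ystar k) with h | h
  · exact (strictMonoOn_nullP_left hk hs0).monotoneOn ⟨hy, h⟩ ⟨ystar_mem hk hs, Set.self_mem_Iic⟩ h
  · exact (strictAntiOn_nullP_right hk hs0).antitoneOn ⟨ystar_mem hk hs, Set.self_mem_Ici⟩ ⟨hy, h⟩ h

theorem levelSet_of_ystar_lt {k : ℕ} (hk : 1 ≤ k) {s p : ℝ} (hs : omega k < s)
    (hp : nullP k s (ystar k) < p) : levelSet k s p = ∅ :=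
  Set.eq_empty_of_forall_notMem fun y hy => by
    have := nullP_le_ystar hk hs hy.1
    rw [hy.2] at this
    linarith

theorem levelSet_ystar {k : ℕ} (hk : 1 ≤ k) {s : ℝ} (hs : omega k < s) :
    levelSet k s (nullP k s (ystar k)) = {ystar k} := by
  have hs0 := (omega_pos hk).trans hs
  refine Set.eq_singleton_iff_unique_mem.2 ⟨⟨ystar_mem hk hs, rfl⟩, fun z hz => ?_⟩
  rcases le_total z (ystar k) with h | h
  · exact (strictMonoOn_nullP_left hk hs0).injOn ⟨hz.1, h⟩ ⟨ystar_mem hk hs, Set.self_mem_Iic⟩ hz.2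
  · exact (strictAntiOn_nullP_right hk hs0).injOn ⟨hz.1, h⟩ ⟨ystar_mem hk hs, Set.self_mem_Ici⟩ hz.2

/-- Between the initial value and the maximum, the rising and the falling part of `nullP` each take
the value once. -/
theorem encard_levelSet_of_lt_ystar {k : ℕ} (hk : 1 ≤ k) {s p : ℝ} (hs : omega k < s)
    (hm : √(1 - s ^ 2) < p) (hp : p < nullP k s (ystar k)) : (levelSet k s p).encard = 2 := by
  have hs0 := (omega_pos hk).trans hs
  have hy := ystar_mem hk hs
  obtain ⟨c, hc, hcy, hcp⟩ := exists_le_nullP_lt hs0 hm hy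
  obtain ⟨a, ha, ha', hap⟩ := exists_nullP_eq hc hy (Set.mem_uIcc.2 (Or.inl ⟨hcp.le, hp.le⟩))
  rw [Set.uIcc_of_le hcy] at ha'
  obtain ⟨b, -, hb', hb, hbp, hbu⟩ := exists_right hk hs0 hy le_rfl
    ((Real.sqrt_nonneg _).trans_lt hm) hp.le
  rw [Set.encard_eq_two]
  refine ⟨a, b, ?_, ?_⟩
  · rintro rfl
    rw [le_antisymm ha'.2 hb'] at hap
    exact hp.ne hap.symm
  · ext z
    simp only [Set.mem_insert_iff, Set.mem_singleton_iff]
    constructor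
    · rintro ⟨hz, hzp⟩
      rcases le_total z (ystar k) with h | h
      · exact Or.inl ((strictMonoOn_nullP_left hk hs0).injOn ⟨hz, h⟩ ⟨ha, ha'.2⟩
          (hzp.trans hap.symm))
      · exact Or.inr (hbu z hz h hzp)
    · rintro (rfl | rfl)
      · exact ⟨ha, hap⟩
      · exact ⟨hb, hbp⟩

theorem ystar_le_of {k : ℕ} {s : ℝ} (hs0 : 0 < s) (hs : s ≤ omega k) :
    ystar k ≤ √(1 - s ^ 2) :=
  Real.sqrt_le_sqrt (by nlinarith)

theorem levelSet_of_sqrt_lt {k : ℕ} (hk : 1 ≤ k) {s p : ℝ} (hs0 : 0 < s) (hs : s ≤ omega k)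
    (hp : √(1 - s ^ 2) < p) : levelSet k s p = ∅ :=
  Set.eq_empty_of_forall_notMem fun y hy => by
    have hs1 : s ≤ 1 := hs.trans (omega_lt_one hk).le
    obtain ⟨h1, -, -, h2⟩ := nullP_sqrt (k := k) hs1 hs0
    have h3 := hy.1.2.resolve_left (by linarith)
    have := (strictAntiOn_nullP_right hk hs0).antitoneOn ⟨h1, ystar_le_of hs0 hs⟩
      ⟨hy.1, (ystar_le_of hs0 hs).trans h3⟩ h3
    rw [hy.2, h2] at this
    linarith

theorem levelSet_sqrt_of_le {k : ℕ} (hk : 1 ≤ k) {s : ℝ} (hs0 : 0 < s) (hs : s ≤ omega k) :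
    levelSet k s √(1 - s ^ 2) = {√(1 - s ^ 2)} := by
  have hs1 : s ≤ 1 := hs.trans (omega_lt_one hk).le
  obtain ⟨h1, -, -, h2⟩ := nullP_sqrt (k := k) hs1 hs0
  refine Set.eq_singleton_iff_unique_mem.2 ⟨⟨h1, h2⟩, fun z hz => ?_⟩
  exact (strictAntiOn_nullP_right hk hs0).injOn
    ⟨hz.1, (ystar_le_of hs0 hs).trans (hz.1.2.resolve_left (by linarith))⟩
    ⟨h1, ystar_le_of hs0 hs⟩ (hz.2.trans h2.symm)

/-- Values below the starting value √(1 − s²) are taken only on the final descent to 0, whether or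
not there was a rise before. -/
theorem encard_levelSet_of_lt_sqrt {k : ℕ} (hk : 1 ≤ k) {s p : ℝ} (hs0 : 0 < s) (hs1 : s ≤ 1)
    (hp0 : 0 < p) (hp : p < √(1 - s ^ 2)) : (levelSet k s p).encard = 1 := by
  obtain ⟨h1, -, -, h2⟩ := nullP_sqrt (k := k) hs1 hs0
  rw [Set.encard_eq_one]
  rcases le_or_gt s (omega k) with hs | hs
  · obtain ⟨b, -, hb', hb, hbp, hbu⟩ := exists_right hk hs0 h1 (ystar_le_of hs0 hs) hp0
      (by rw [h2]; exact hp.le)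
    refine ⟨b, Set.eq_singleton_iff_unique_mem.2 ⟨⟨hb, hbp⟩, fun z hz => hbu z hz.1 ?_ hz.2⟩⟩
    exact (ystar_le_of hs0 hs).trans (hz.1.2.resolve_left (by linarith))
  · obtain ⟨b, -, hb', hb, hbp, hbu⟩ := exists_right hk hs0 (ystar_mem hk hs) le_rfl hp0
      (hp.le.trans (sqrt_lt_nullP_ystar hk hs).le)
    refine ⟨b, Set.eq_singleton_iff_unique_mem.2 ⟨⟨hb, hbp⟩, fun z hz => hbu z hz.1 ?_ hz.2⟩⟩
    by_contra! h
    have h3 := hz.1.2.resolve_left (by linarith)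
    have := (strictMonoOn_nullP_left hk hs0).monotoneOn ⟨h1, h3.trans h.le⟩ ⟨hz.1, h.le⟩ h3
    rw [h2, hz.2] at this
    linarith

theorem levelSet_sqrt_of_lt {k : ℕ} (hk : 1 ≤ k) {s : ℝ} (hs : omega k < s) (hs1 : s < 1) :
    ∃ b ∈ posDomain k s, √(1 - s ^ 2) < b ∧ levelSet k s √(1 - s ^ 2) = {√(1 - s ^ 2), b} := by
  have hs0 := (omega_pos hk).trans hs
  obtain ⟨h1, -, -, h2⟩ := nullP_sqrt (k := k) hs1.le hs0
  have h3 := (ystar_lt_of hk hs).resolve_left hs1.not_gt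
  obtain ⟨b, -, hb', hb, hbp, hbu⟩ := exists_right hk hs0 (ystar_mem hk hs) le_rfl
    (Real.sqrt_pos.2 (show 0 < 1 - s ^ 2 by nlinarith)) (sqrt_lt_nullP_ystar hk hs).le
  refine ⟨b, hb, h3.trans_le hb', ?_⟩
  ext z
  simp only [Set.mem_insert_iff, Set.mem_singleton_iff]
  constructor
  · rintro ⟨hz, hzp⟩
    rcases le_total z (ystar k) with h | h
    · exact Or.inl ((strictMonoOn_nullP_left hk hs0).injOn ⟨hz, h⟩ ⟨h1, h3.le⟩
        (hzp.trans h2.symm))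
    · exact Or.inr (hbu z hz h hzp)
  · rintro (rfl | rfl)
    · exact ⟨h1, h2⟩
    · exact ⟨hb, hbp⟩

end SubLorentzSU11

namespace SubLorentzSU11

/-! ### Cardinalities of the solution sets -/

/-- At the critical point Φ = y, so the amplitude is ε/y, the argument of cosh and sinh in F. Thus F
is the coordinate x₁ of the point at which `nullP` is maximal. -/
theorem F_omega {k : ℕ} (hk : 1 ≤ k) {s : ℝ} (hs : omega k ≤ s) :
    2 * F s (omega k) = nullP k s (ystar k) + nullQ k s (ystar k) := by
  have hy := ystar_sq hk
  have hy0 := ystar_pos hk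
  have heps : eps s (ystar k) = √(s ^ 2 - omega k ^ 2) := by
    rw [eps, hy]
    congr 1
    ring
  have hamp : amp k s (ystar k) = √((s ^ 2 - omega k ^ 2) / (1 - omega k ^ 2)) := by
    rw [amp, bandSink_ystar hk, heps, ystar,
      Real.sqrt_div (by nlinarith [omega_pos hk])]
  rw [F, ← hamp, ← heps, nullP, nullQ, ← ystar, Real.cosh_eq, Real.sinh_eq]
  ring

/-- The function p + M/p is increasing for p ≥ √M. This turns comparisons of the null coordinate x₁
+ x₂ into comparisons of x₁. -/
theorem add_lt_add_of_mul_eq {M p q p' q' : ℝ} (h : p * q = M) (h' : p' * q' = M) (hp : 0 < p)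
    (hp' : 0 < p') (hM : √M ≤ p) (hlt : p < p') : p + q < p' + q' := by
  have hM2 : M ≤ p ^ 2 := Real.sqrt_le_left hp.le |>.1 hM
  have h1 : p * p' * (p' + q' - (p + q)) = (p' - p) * (p * p' - M) := by
    linear_combination p * h' - p' * h
  have h2 : 0 < (p' - p) * (p * p' - M) := mul_pos (by linarith) (by nlinarith)
  rw [← h1] at h2
  have := (pos_iff_pos_of_mul_pos h2).1 (by positivity)
  linarith

theorem add_lt_add_iff_of_mul_eq {M p q p' q' : ℝ} (h : p * q = M) (h' : p' * q' = M) (hp : 0 < p)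
    (hp' : 0 < p') (hM : √M ≤ p) (hM' : √M ≤ p') :
    (p + q < p' + q' ↔ p < p') ∧ (p + q = p' + q' ↔ p = p') := by
  rcases lt_trichotomy p p' with hlt | rfl | hlt
  · have := add_lt_add_of_mul_eq h h' hp hp' hM hlt
    exact ⟨⟨fun _ => hlt, fun _ => this⟩, ⟨fun h => absurd h this.ne, fun h => absurd h hlt.ne⟩⟩
  · have : q = q' := mul_left_cancel₀ hp.ne' (h.trans h'.symm)
    simp [this]
  · have := add_lt_add_of_mul_eq h' h hp' hp hM' hlt
    exact ⟨⟨fun h => absurd h this.not_gt, fun h => absurd h hlt.not_gt⟩,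
      ⟨fun h => absurd h this.ne', fun h => absurd h hlt.ne'⟩⟩

section

variable {k : ℕ} {s x₁ x₂ : ℝ}

theorem compare_F (hk : 1 ≤ k) (hs : omega k < s) (hx : x₁ ^ 2 - x₂ ^ 2 = 1 - s ^ 2)
    (hp : 0 < x₁ + x₂) (hm : √(1 - s ^ 2) ≤ x₁ + x₂) :
    (x₁ < F s (omega k) ↔ x₁ + x₂ < nullP k s (ystar k)) ∧
      (x₁ = F s (omega k) ↔ x₁ + x₂ = nullP k s (ystar k)) := by
  have h1 := sqrt_lt_nullP_ystar hk hs
  have h2 := nullP_mul_nullQ (k := k) (one_sub_sq_le (ystar_mem hk hs).2)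
  have h3 := F_omega hk hs.le
  obtain ⟨h4, h5⟩ := add_lt_add_iff_of_mul_eq (q := x₁ - x₂) (by linarith) h2 hp
    ((Real.sqrt_nonneg _).trans_lt h1) hm h1.le
  rw [← h4, ← h5, ← h3]
  constructor <;> constructor <;> intro h <;> linarith

/-- The point of the hyperbola with null coordinates 1 and 1 − s² has x₁ = 1 − s²/2. -/
theorem compare_one (hs0 : 0 < s) (hx : x₁ ^ 2 - x₂ ^ 2 = 1 - s ^ 2)
    (hp : 0 < x₁ + x₂) (hm : √(1 - s ^ 2) ≤ x₁ + x₂) :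
    x₁ < 1 - s ^ 2 / 2 ↔ x₁ + x₂ < 1 := by
  obtain ⟨h4, -⟩ := add_lt_add_iff_of_mul_eq (q := x₁ - x₂) (p' := 1) (q' := 1 - s ^ 2)
    (by linarith) (one_mul _) hp one_pos hm (sqrt_one_sub_sq_lt_one hs0).le
  rw [← h4]
  constructor <;> intro h <;> linarith

theorem add_pos_of_one_le (hs : 1 ≤ s) (hx : x₁ ^ 2 - x₂ ^ 2 = 1 - s ^ 2) (h2 : 0 ≤ x₂)
    (h : 1 < s ∨ 0 < x₁) : 0 < x₁ + x₂ ∧ √(1 - s ^ 2) ≤ x₁ + x₂ := by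
  have : 0 < x₁ + x₂ := by
    rcases h with h | h
    · have : |x₁| < x₂ := by
        rw [← abs_of_nonneg h2, ← sq_lt_sq]
        nlinarith
      linarith [(abs_lt.1 this).1]
    · linarith
  refine ⟨this, ?_⟩
  rw [Real.sqrt_eq_zero_of_nonpos (by nlinarith)]
  exact this.le

theorem encard_lt_F_of_one_le (hk : 1 ≤ k) (hs : 1 ≤ s) (hx : x₁ ^ 2 - x₂ ^ 2 = 1 - s ^ 2)
    (h2 : 0 ≤ x₂) (h : 1 < s ∨ 0 < x₁) (hF : x₁ < F s (omega k)) :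
    (solutionSet k x₁ x₂).encard = 2 := by
  have hω := (omega_lt_one hk).trans_le hs
  obtain ⟨hp, hm⟩ := add_pos_of_one_le hs hx h2 h
  rw [encard_solutionSet_of_one_le hs hx hp]
  refine encard_levelSet_of_lt_ystar hk hω ?_ ((compare_F hk hω hx hp hm).1.1 hF)
  rwa [Real.sqrt_eq_zero_of_nonpos (by nlinarith)]

theorem encard_eq_F_of_one_le (hk : 1 ≤ k) (hs : 1 ≤ s) (hx : x₁ ^ 2 - x₂ ^ 2 = 1 - s ^ 2)
    (h2 : 0 ≤ x₂) (h : 1 < s ∨ 0 < x₁) (hF : x₁ = F s (omega k)) :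
    (solutionSet k x₁ x₂).encard = 1 := by
  have hω := (omega_lt_one hk).trans_le hs
  obtain ⟨hp, hm⟩ := add_pos_of_one_le hs hx h2 h
  rw [encard_solutionSet_of_one_le hs hx hp, (compare_F hk hω hx hp hm).2.1 hF,
    levelSet_ystar hk hω, Set.encard_singleton]

theorem encard_F_lt_of_one_le (hk : 1 ≤ k) (hs : 1 ≤ s) (hx : x₁ ^ 2 - x₂ ^ 2 = 1 - s ^ 2)
    (h2 : 0 ≤ x₂) (h : 1 < s ∨ 0 < x₁) (hF : F s (omega k) < x₁) :
    (solutionSet k x₁ x₂).encard = 0 := by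
  have hω := (omega_lt_one hk).trans_le hs
  obtain ⟨hp, hm⟩ := add_pos_of_one_le hs hx h2 h
  obtain ⟨c1, c2⟩ := compare_F hk hω hx hp hm
  rw [encard_solutionSet_of_one_le hs hx hp, levelSet_of_ystar_lt hk hω, Set.encard_empty]
  refine lt_of_le_of_ne (not_lt.1 fun h => ?_) fun h => ?_
  · exact hF.not_gt (c1.2 h)
  · exact hF.ne' (c2.2 h.symm)

theorem F_one_pos (hk : 1 ≤ k) : 0 < F 1 (omega k) := by
  have h := F_omega hk (omega_lt_one hk).le
  have h1 := sqrt_lt_nullP_ystar hk (omega_lt_one hk)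
  have h2 := nullP_mul_nullQ (k := k) (one_sub_sq_le (ystar_mem hk (omega_lt_one hk)).2)
  rw [one_pow, sub_self] at h1 h2
  rw [Real.sqrt_zero] at h1
  have h3 := (mul_eq_zero.1 h2).resolve_left h1.ne'
  linarith

theorem sqrt_lt_F (hk : 1 ≤ k) (hs : omega k < s) (hs1 : s < 1) :
    √(1 - s ^ 2) < F s (omega k) := by
  have hs0 := (omega_pos hk).trans hs
  have h0 : 0 < 1 - s ^ 2 := by nlinarith
  have h1 := Real.sqrt_pos.2 h0
  refine (compare_F (x₂ := 0) hk hs ?_ ?_ ?_).1.2 ?_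
  · rw [Real.sq_sqrt h0.le]; ring
  · rwa [add_zero]
  · rw [add_zero]
  · rw [add_zero]
    exact sqrt_lt_nullP_ystar hk hs

theorem light_pos (hs0 : 0 < s) (hs1 : s < 1) (hx : x₁ ^ 2 - x₂ ^ 2 = 1 - s ^ 2) (h2 : 0 ≤ x₂)
    (h1 : √(1 - s ^ 2) ≤ x₁) : 0 < x₁ + x₂ ∧ 0 < x₁ - x₂ ∧ √(1 - s ^ 2) ≤ x₁ + x₂ := by
  have h0 : 0 < 1 - s ^ 2 := by nlinarith
  have h3 := Real.sqrt_pos.2 h0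
  have h4 : 0 < x₁ + x₂ := by linarith
  refine ⟨h4, ?_, by linarith⟩
  have h5 : (x₁ + x₂) * (x₁ - x₂) = 1 - s ^ 2 := by linarith
  rw [← h5] at h0
  exact (pos_iff_pos_of_mul_pos h0).1 h4

theorem light_lt (hs0 : 0 < s) (hs1 : s < 1) (hx : x₁ ^ 2 - x₂ ^ 2 = 1 - s ^ 2) (h2 : 0 < x₂)
    (h1 : √(1 - s ^ 2) ≤ x₁) : x₁ - x₂ < √(1 - s ^ 2) ∧ √(1 - s ^ 2) < x₁ + x₂ := by
  obtain ⟨h3, h4, -⟩ := light_pos hs0 hs1 hx h2.le h1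
  refine ⟨?_, by linarith⟩
  exact Real.lt_sqrt_of_sq_lt (by nlinarith)

theorem eq_sqrt_of_light (hx : x₁ ^ 2 - (0 : ℝ) ^ 2 = 1 - s ^ 2)
    (h1 : √(1 - s ^ 2) ≤ x₁) : x₁ = √(1 - s ^ 2) := by
  rw [← hx, zero_pow two_ne_zero, sub_zero, Real.sqrt_sq]
  exact (Real.sqrt_nonneg _).trans h1

/-- The whole domain of `nullP` lies to the right of the critical point, so the values do not exceed
√(1 − s²): the level x₁ + x₂ is empty unless x₂ = 0, and x₁ − x₂ is attained once. -/
theorem encard_of_le_omega (hk : 1 ≤ k) (hs0 : 0 < s) (hs : s ≤ omega k)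
    (hx : x₁ ^ 2 - x₂ ^ 2 = 1 - s ^ 2) (h2 : 0 ≤ x₂) (h1 : √(1 - s ^ 2) ≤ x₁) :
    (solutionSet k x₁ x₂).encard = 1 := by
  have hs1 := hs.trans_lt (omega_lt_one hk)
  obtain ⟨hp, hq, -⟩ := light_pos hs0 hs1 hx h2 h1
  rcases h2.eq_or_lt with rfl | h2
  · have he := eq_sqrt_of_light hx h1
    obtain ⟨-, -, ha, -⟩ := nullP_sqrt (k := k) hs1.le hs0
    rw [solutionSet_eq_union hs0 hx hp hq, add_zero, sub_zero, he, levelSet_sqrt_of_le hk hs0 hs,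
      Set.image_singleton, Set.image_singleton, ha, neg_zero, Set.union_self, Set.encard_singleton]
  · obtain ⟨h3, h4⟩ := light_lt hs0 hs1 hx h2 h1
    rw [encard_solutionSet_of_ne hs0 hx hp hq h2.ne', levelSet_of_sqrt_lt hk hs0 hs h4,
      encard_levelSet_of_lt_sqrt hk hs0 hs1.le hq h3, Set.encard_empty, zero_add]

theorem encard_F_lt (hk : 1 ≤ k) (hs : omega k < s) (hs1 : s < 1)
    (hx : x₁ ^ 2 - x₂ ^ 2 = 1 - s ^ 2) (h2 : 0 ≤ x₂) (hF : F s (omega k) < x₁) :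
    (solutionSet k x₁ x₂).encard = 1 := by
  have hs0 := (omega_pos hk).trans hs
  have h1 := (sqrt_lt_F hk hs hs1).trans hF
  obtain ⟨hp, hq, hm⟩ := light_pos hs0 hs1 hx h2 h1.le
  obtain ⟨c1, c2⟩ := compare_F hk hs hx hp hm
  rcases h2.eq_or_lt with rfl | h2
  · exact absurd (eq_sqrt_of_light hx h1.le) h1.ne'
  obtain ⟨h3, h4⟩ := light_lt hs0 hs1 hx h2 h1.le
  rw [encard_solutionSet_of_ne hs0 hx hp hq h2.ne', levelSet_of_ystar_lt hk hs,
      encard_levelSet_of_lt_sqrt hk hs0 hs1.le hq h3, Set.encard_empty, zero_add]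
  refine lt_of_le_of_ne (not_lt.1 fun h => ?_) fun h => ?_
  · exact hF.not_gt (c1.2 h)
  · exact hF.ne' (c2.2 h.symm)

theorem encard_eq_F (hk : 1 ≤ k) (hs : omega k < s) (hs1 : s < 1)
    (hx : x₁ ^ 2 - x₂ ^ 2 = 1 - s ^ 2) (h2 : 0 ≤ x₂) (hF : x₁ = F s (omega k)) :
    (solutionSet k x₁ x₂).encard = 2 := by
  have hs0 := (omega_pos hk).trans hs
  have h1 : √(1 - s ^ 2) < x₁ := hF ▸ sqrt_lt_F hk hs hs1
  obtain ⟨hp, hq, hm⟩ := light_pos hs0 hs1 hx h2 h1.le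
  obtain ⟨-, c2⟩ := compare_F hk hs hx hp hm
  rcases h2.eq_or_lt with rfl | h2
  · exact absurd (eq_sqrt_of_light hx h1.le) h1.ne'
  obtain ⟨h3, h4⟩ := light_lt hs0 hs1 hx h2 h1.le
  rw [encard_solutionSet_of_ne hs0 hx hp hq h2.ne', c2.1 hF, levelSet_ystar hk hs,
    encard_levelSet_of_lt_sqrt hk hs0 hs1.le hq h3, Set.encard_singleton, one_add_one_eq_two]

theorem encard_lt_F (hk : 1 ≤ k) (hs : omega k < s) (hs1 : s < 1)
    (hx : x₁ ^ 2 - x₂ ^ 2 = 1 - s ^ 2) (h2 : 0 ≤ x₂) (h1 : √(1 - s ^ 2) ≤ x₁)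
    (hF : x₁ < F s (omega k)) : (solutionSet k x₁ x₂).encard = 3 := by
  have hs0 := (omega_pos hk).trans hs
  obtain ⟨hp, hq, hm⟩ := light_pos hs0 hs1 hx h2 h1
  obtain ⟨c1, -⟩ := compare_F hk hs hx hp hm
  rcases h2.eq_or_lt with rfl | h2
  -- For x₂ = 0 both levels equal √(1 − s²), attained at the left end, where α = 0, and at one
  -- further point b. The branches share the first solution, and b occurs with both signs of α:
  -- again three.
  · have he := eq_sqrt_of_light hx h1
    obtain ⟨-, -, ha, -⟩ := nullP_sqrt (k := k) hs1.le hs0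
    obtain ⟨b, hb, hmb, hlev⟩ := levelSet_sqrt_of_lt hk hs hs1
    have hb0 : 0 < amp k s b :=
      div_pos (eps_pos (one_sub_sq_lt (Or.inr hmb))) (bandSink_pos hb.1)
    rw [solutionSet_eq_union hs0 hx hp hq, add_zero, sub_zero, he, hlev, Set.image_pair,
      Set.image_pair, ha, neg_zero, Set.encard_eq_three]
    refine ⟨(√(1 - s ^ 2), 0), (b, amp k s b), (b, -amp k s b), ?_, ?_, ?_, ?_⟩
    · exact fun h => hmb.ne (Prod.mk.inj h).1
    · exact fun h => hmb.ne (Prod.mk.inj h).1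
    · intro h
      have := (Prod.mk.inj h).2
      linarith
    · ext z
      simp only [Set.mem_union, Set.mem_insert_iff, Set.mem_singleton_iff]
      tauto
  · obtain ⟨h3, h4⟩ := light_lt hs0 hs1 hx h2 h1
    rw [encard_solutionSet_of_ne hs0 hx hp hq h2.ne',
      encard_levelSet_of_lt_ystar hk hs h4 (c1.1 hF),
      encard_levelSet_of_lt_sqrt hk hs0 hs1.le hq h3, two_add_one_eq_three]

theorem encard_zero_of_one_le (hs : 1 ≤ s) (hx : x₁ ^ 2 - x₂ ^ 2 = 1 - s ^ 2)
    (h2 : 0 ≤ x₂) (h : 1 < s ∨ 0 < x₁) :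
    (x₁ < 1 - s ^ 2 / 2 → (solutionSet 0 x₁ x₂).encard = 1) ∧
      (¬ x₁ < 1 - s ^ 2 / 2 → (solutionSet 0 x₁ x₂).encard = 0) := by
  have hs0 : 0 < s := by linarith
  obtain ⟨hp, hm⟩ := add_pos_of_one_le hs hx h2 h
  rw [encard_solutionSet_of_one_le hs hx hp, compare_one hs0 hx hp hm]
  constructor
  · refine encard_levelSet_zero hs0 ?_
    rwa [Real.sqrt_eq_zero_of_nonpos (by nlinarith)]
  · intro h
    rw [levelSet_zero_of_one_le hs0 (not_lt.1 h), Set.encard_empty]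

theorem encard_zero_of_lt_one (hs0 : 0 < s) (hs1 : s < 1) (hx : x₁ ^ 2 - x₂ ^ 2 = 1 - s ^ 2)
    (h2 : 0 ≤ x₂) (h1 : √(1 - s ^ 2) ≤ x₁) :
    (x₁ < 1 - s ^ 2 / 2 → (solutionSet 0 x₁ x₂).encard = 1) ∧
      (¬ x₁ < 1 - s ^ 2 / 2 → (solutionSet 0 x₁ x₂).encard = 0) := by
  obtain ⟨hp, hq, hm⟩ := light_pos hs0 hs1 hx h2 h1
  rw [compare_one hs0 hx hp hm]
  rcases h2.eq_or_lt with rfl | h2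
  · have he := eq_sqrt_of_light hx h1
    obtain ⟨-, -, ha, -⟩ := nullP_sqrt (k := 0) hs1.le hs0
    have hlt := sqrt_one_sub_sq_lt_one hs0
    refine ⟨fun _ => ?_, fun h => absurd (by rwa [add_zero, he]) h⟩
    rw [solutionSet_eq_union hs0 hx hp hq, add_zero, sub_zero, he, levelSet_zero_sqrt hs0 hs1.le,
      Set.image_singleton, Set.image_singleton, ha, neg_zero, Set.union_self, Set.encard_singleton]
  · obtain ⟨h3, h4⟩ := light_lt hs0 hs1 hx h2 h1
    rw [encard_solutionSet_of_ne hs0 hx hp hq h2.ne', levelSet_zero_of_lt hs0 hs1.le h3,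
      Set.encard_empty, add_zero]
    refine ⟨encard_levelSet_zero hs0 h4, fun h => ?_⟩
    rw [levelSet_zero_of_one_le hs0 (not_lt.1 h), Set.encard_empty]

end

/-! ### The regions -/

/-- The condition on P keeps the radicand nonnegative, so the choice of sign in front of the root
can be replaced by a real x₂ with the given square. -/
theorem mem_region_iff {k : ℕ} {P : ℝ → Set ℝ} {g : Cover}
    (hP : ∀ s x, 0 < s → x ∈ P s → 1 - s ^ 2 ≤ x ^ 2) :
    g ∈ region k P ↔ ∃ s x₁ x₂ y₂, 0 < s ∧ x₁ ∈ P s ∧ x₂ ^ 2 = x₁ ^ 2 + s ^ 2 - 1 ∧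
      g = regionPoint k s x₁ x₂ y₂ := by
  constructor
  · rintro ⟨s, x₁, y₂, hs, hx, h1, h2 | h2⟩
    · refine ⟨s, x₁, √(x₁ ^ 2 + s ^ 2 - 1), y₂, hs, hx,
        Real.sq_sqrt (by linarith [hP s x₁ hs hx]), Prod.ext h1 h2⟩
    · refine ⟨s, x₁, -√(x₁ ^ 2 + s ^ 2 - 1), y₂, hs, hx, ?_, Prod.ext h1 ?_⟩
      · rw [neg_sq, Real.sq_sqrt (by linarith [hP s x₁ hs hx])]
      · rw [h2, regionPoint]; push_cast; rfl
  · rintro ⟨s, x₁, x₂, y₂, hs, hx, h, rfl⟩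
    refine ⟨s, x₁, y₂, hs, hx, rfl, ?_⟩
    rw [← h, Real.sqrt_sq_eq_abs]
    rcases abs_choice x₂ with h' | h'
    · left; rw [h']; rfl
    · right; rw [h']; simp [regionPoint]

theorem one_sub_sq_le_sq {s x : ℝ} (h : 1 ≤ s ∨ x ≤ -√(1 - s ^ 2) ∨ √(1 - s ^ 2) ≤ x) (hs : 0 < s) :
    1 - s ^ 2 ≤ x ^ 2 := by
  have h1 : 1 ≤ s → 1 - s ^ 2 ≤ x ^ 2 := fun h => by nlinarith [sq_nonneg x]
  rcases h with h | h | h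
  · exact h1 h
  · rw [← neg_sq x]
    exact one_sub_sq_le (Or.inr (by linarith))
  · exact one_sub_sq_le (Or.inr h)

theorem sqrt_hyp {s x₁ x₂ : ℝ} (h : x₂ ^ 2 = x₁ ^ 2 + s ^ 2 - 1) :
    x₁ ^ 2 - √(x₁ ^ 2 + s ^ 2 - 1) ^ 2 = 1 - s ^ 2 := by
  rw [Real.sq_sqrt (by rw [← h]; positivity)]
  ring

theorem sqrt_one_sub_one_sq : √(1 - (1 : ℝ) ^ 2) = 0 := by simp

theorem encard_of_mem_Omega0 {g : Cover} (hg : g ∈ Omega0) : (geodesicsTo g).encard = 1 := by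
  obtain ⟨s, x₁, x₂, y₂, hs, hx, h, rfl⟩ := (mem_region_iff (by
    rintro s x hs (⟨-, h | ⟨h, -⟩⟩ | ⟨h, -⟩)
    · exact one_sub_sq_le_sq (Or.inr (Or.inl h)) hs
    · exact one_sub_sq_le_sq (Or.inr (Or.inr h)) hs
    · exact one_sub_sq_le_sq (Or.inl h) hs)).1 hg
  rw [encard_geodesicsTo hs h]
  have h0 := Real.sqrt_nonneg (x₁ ^ 2 + s ^ 2 - 1)
  rcases hx with ⟨h1, hx | ⟨hx, hx'⟩⟩ | ⟨h1, hx⟩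
  · exact encard_solutionSet_of_neg hs h1.le (sqrt_hyp h) hx h0
  · exact (encard_zero_of_lt_one hs h1 (sqrt_hyp h) h0 hx).1 hx'
  · by_cases hc : 1 < s ∨ 0 < x₁
    · exact (encard_zero_of_one_le h1 (sqrt_hyp h) h0 hc).1 hx
    · push Not at hc
      obtain rfl : s = 1 := le_antisymm hc.1 h1
      exact encard_solutionSet_of_neg hs le_rfl (sqrt_hyp h)
        (by rw [sqrt_one_sub_one_sq, neg_zero]; exact hc.2) h0

theorem encard_of_mem_ASet {k : ℕ} (hk : 1 ≤ k) {g : Cover} (hg : g ∈ ASet k) :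
    (geodesicsTo g).encard = 1 := by
  obtain ⟨s, x₁, x₂, y₂, hs, hx, h, rfl⟩ := (mem_region_iff (by
    rintro s x hs (⟨-, h⟩ | ⟨h1, h2, h | h⟩ | ⟨rfl, -⟩ | ⟨h, -⟩)
    · exact one_sub_sq_le_sq (Or.inr h) hs
    · exact one_sub_sq_le_sq (Or.inr (Or.inl h)) hs
    · exact one_sub_sq_le_sq (Or.inr (Or.inr ((sqrt_lt_F hk h1 h2).trans h).le)) hs
    · exact one_sub_sq_le_sq (Or.inl le_rfl) hs
    · exact one_sub_sq_le_sq (Or.inl h.le) hs)).1 hg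
  rw [encard_geodesicsTo hs h]
  have h0 := Real.sqrt_nonneg (x₁ ^ 2 + s ^ 2 - 1)
  rcases hx with ⟨h1, hx | hx⟩ | ⟨h1, h2, hx | hx⟩ | ⟨rfl, hx | hx⟩ | ⟨h1, hx⟩
  · exact encard_solutionSet_of_neg hs (h1.trans (omega_lt_one hk).le) (sqrt_hyp h) hx h0
  · exact encard_of_le_omega hk hs h1 (sqrt_hyp h) h0 hx
  · exact encard_solutionSet_of_neg hs h2.le (sqrt_hyp h) hx h0
  · exact encard_F_lt hk h1 h2 (sqrt_hyp h) h0 hx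
  · exact encard_solutionSet_of_neg hs le_rfl (sqrt_hyp h)
      (by rw [sqrt_one_sub_one_sq, neg_zero]; exact hx) h0
  · exact encard_eq_F_of_one_le hk le_rfl (sqrt_hyp h) h0 (Or.inr (hx ▸ F_one_pos hk)) hx
  · exact encard_eq_F_of_one_le hk h1.le (sqrt_hyp h) h0 (Or.inl h1) hx

theorem encard_of_mem_BSet {k : ℕ} (hk : 1 ≤ k) {g : Cover} (hg : g ∈ BSet k) :
    (geodesicsTo g).encard = 2 := by
  obtain ⟨s, x₁, x₂, y₂, hs, hx, h, rfl⟩ := (mem_region_iff (by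
    rintro s x hs (⟨h1, h2, rfl⟩ | ⟨rfl, -⟩ | ⟨h, -⟩)
    · exact one_sub_sq_le_sq (Or.inr (Or.inr (sqrt_lt_F hk h1 h2).le)) hs
    · exact one_sub_sq_le_sq (Or.inl le_rfl) hs
    · exact one_sub_sq_le_sq (Or.inl h.le) hs)).1 hg
  rw [encard_geodesicsTo hs h]
  have h0 := Real.sqrt_nonneg (x₁ ^ 2 + s ^ 2 - 1)
  rcases hx with ⟨h1, h2, hx⟩ | ⟨rfl, h1, hx⟩ | ⟨h1, hx⟩
  · exact encard_eq_F hk h1 h2 (sqrt_hyp h) h0 hx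
  · exact encard_lt_F_of_one_le hk le_rfl (sqrt_hyp h) h0 (Or.inr h1) hx
  · exact encard_lt_F_of_one_le hk h1.le (sqrt_hyp h) h0 (Or.inl h1) hx

theorem encard_of_mem_CSet {k : ℕ} (hk : 1 ≤ k) {g : Cover} (hg : g ∈ CSet k) :
    (geodesicsTo g).encard = 3 := by
  obtain ⟨s, x₁, x₂, y₂, hs, ⟨h1, h2, h3, h4⟩, h, rfl⟩ := (mem_region_iff (by
    rintro s x hs ⟨h1, h2, h3, h4⟩
    exact one_sub_sq_le_sq (Or.inr (Or.inr h3)) hs)).1 hg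
  rw [encard_geodesicsTo hs h]
  exact encard_lt_F hk h1 h2 (sqrt_hyp h) (Real.sqrt_nonneg _) h3 h4

theorem mem_Omega_of_nonempty {g : Cover} (hg : (geodesicsTo g).Nonempty) : g ∈ Omega := by
  rcases exists_regionPoint hg with ⟨k, hk, hk'⟩ | ⟨k, s, x₁, x₂, y₂, hs, h, rfl⟩
  · exact Or.inr ⟨k, hk, Or.inr hk'⟩
  rw [← Set.encard_pos, encard_geodesicsTo hs h] at hg
  have h0 := Real.sqrt_nonneg (x₁ ^ 2 + s ^ 2 - 1)
  have hx := sqrt_hyp h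
  have habs : s < 1 → x₁ ≤ -√(1 - s ^ 2) ∨ √(1 - s ^ 2) ≤ x₁ := fun hs1 => by
    have : √(1 - s ^ 2) ≤ |x₁| := by
      rw [← Real.sqrt_sq_eq_abs]
      exact Real.sqrt_le_sqrt (by nlinarith [sq_nonneg x₂])
    rcases le_abs.1 this with h | h
    · exact Or.inr h
    · exact Or.inl (by linarith)
  rcases Nat.eq_zero_or_pos k with rfl | hk
  · refine Or.inl ((mem_region_iff (by
      rintro s x hs (⟨-, h | ⟨h, -⟩⟩ | ⟨h, -⟩)
      · exact one_sub_sq_le_sq (Or.inr (Or.inl h)) hs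
      · exact one_sub_sq_le_sq (Or.inr (Or.inr h)) hs
      · exact one_sub_sq_le_sq (Or.inl h) hs)).2 ⟨s, x₁, x₂, y₂, hs, ?_, h, rfl⟩)
    rcases lt_or_ge s 1 with hs1 | hs1
    · refine Or.inl ⟨hs1, (habs hs1).imp_right fun h1 => ⟨h1, ?_⟩⟩
      by_contra hcon
      exact hg.ne' ((encard_zero_of_lt_one hs hs1 hx h0 h1).2 hcon)
    · refine Or.inr ⟨hs1, ?_⟩
      by_cases hc : 1 < s ∨ 0 < x₁
      · by_contra hcon
        exact hg.ne' ((encard_zero_of_one_le hs1 hx h0 hc).2 hcon)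
      · push Not at hc
        obtain rfl : s = 1 := le_antisymm hc.1 hs1
        linarith [hc.2]
  · refine Or.inr ⟨k, hk, Or.inl ((mem_region_iff (by
      rintro s x hs (⟨-, h⟩ | ⟨h, -⟩)
      · exact one_sub_sq_le_sq (Or.inr h) hs
      · exact one_sub_sq_le_sq (Or.inl h) hs)).2 ⟨s, x₁, x₂, y₂, hs, ?_, h, rfl⟩)⟩
    rcases lt_or_ge s 1 with hs1 | hs1
    · exact Or.inl ⟨hs1, habs hs1⟩
    · refine Or.inr ⟨hs1, ?_⟩
      by_cases hc : 1 < s ∨ 0 < x₁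
      · by_contra! hcon
        exact hg.ne' (encard_F_lt_of_one_le hk hs1 hx h0 hc hcon)
      -- The remaining case is s = 1 and x₁ ≤ 0, where no count is needed: F is positive there, so
      -- the bound on x₁ holds anyway.
      · push Not at hc
        obtain rfl : s = 1 := le_antisymm hc.1 hs1
        exact hc.2.trans (F_one_pos hk).le

end SubLorentzSU11

/-- Reachability by, and number of, timelike future-directed normal geodesics from the identity. -/
theorem mainTheorem6 :
    (∀ g : SubLorentzSU11.Cover,
      (SubLorentzSU11.geodesicsTo g).Nonempty → g ∈ SubLorentzSU11.Omega) ∧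
    (∀ g ∈ SubLorentzSU11.A, (SubLorentzSU11.geodesicsTo g).encard = 1) ∧
    (∀ g ∈ SubLorentzSU11.B, (SubLorentzSU11.geodesicsTo g).encard = 2) ∧
    (∀ g ∈ SubLorentzSU11.C, (SubLorentzSU11.geodesicsTo g).encard = 3) ∧
    (∀ g ∈ SubLorentzSU11.Xi, ¬ (SubLorentzSU11.geodesicsTo g).Countable) := by
  refine ⟨fun g hg => SubLorentzSU11.mem_Omega_of_nonempty hg, ?_, ?_, ?_, ?_⟩
  · rintro g (hg | ⟨k, hk, hg⟩)
    · exact SubLorentzSU11.encard_of_mem_Omega0 hg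
    · exact SubLorentzSU11.encard_of_mem_ASet hk hg
  · rintro g ⟨k, hk, hg⟩
    exact SubLorentzSU11.encard_of_mem_BSet hk hg
  · rintro g ⟨k, hk, hg⟩
    exact SubLorentzSU11.encard_of_mem_CSet hk hg
  · rintro g ⟨k, hk, hg⟩
    exact SubLorentzSU11.not_countable_geodesicsTo hk hg
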